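/- **Setting.** Let $n\ge 1$. $\mathcal S_P\subset\mathcal S(\mathbb R^n)$ (resp. $\mathcal D_P\subset C_0^\infty(\mathbb R^n)$) is the subspace of functions whose moments $\int x^\beta f$, $|\beta|\le P$, vanish, and $\mathcal S_\infty=\bigcap_P\mathcal S_P$. All operators $T$ come with a transpose $T^*$: for some $P\in\mathbb N_0$ there are tempered distributions $\mathcal K,\mathcal K^*\in\mathcal S'(\mathbb R^{2n})$ with $\langle Tf,g\rangle=\langle\mathcal K,g\otimes f\rangle$ and $\langle T^*f,g\rangle=\langle\mathcal K^*,g\otimes f\rangle$ for $f\in\mathcal S_P$, $g\in\mathcal S$, and $\langle Tf,g\rangle=\langle T^*g,f\rangle$ for $f,g\in\mathcal S_P$. Equalities between operators are equalities, also of the transposes, on $\mathcal S_P$ for some $P$. *$SIO_\nu(M+\gamma)$* ($M\in\mathbb N_0$, $0<\gamma\le1$): there is a function $K(x,y)$, of class $C^M$ for $x\ne y$, with $\langle Tf,g\rangle=\int_{\mathbb R^{2n}}K(x,y)f(y)g(x)\,dy\,dx$ whenever $f,g$ have disjoint supports and $(f,g)\in\mathcal D_P\times C_0^\infty$ or $(f,g)\in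 C_0^\infty\times\mathcal D_P$ (in the second case the left side means $\langle T^*g,f\rangle$), such that $$|D_x^\alpha D_y^\beta K(x,y)|\lesssim|x-y|^{-(n+\nu+|\alpha|+|\beta|)}\qquad(x\neq y,\ |\alpha|+|\beta|\le M),$$ $$|D_x^\alpha D_y^\beta K(x+h,y)-D_x^\alpha D_y^\beta K(x,y)|+|D_x^\alpha D_y^\beta K(x,y)-D_x^\alpha D_y^\beta K(x,y+h)|\lesssim\frac{|h|^\gamma}{|x-y|^{n+\nu+M+\gamma}}\qquad(|h|<\tfrac{|x-y|}2,\ |\alpha|+|\beta|=M).$$ $SIO_\nu(\infty)$ is the intersection of these classes over all $M$ and $\gamma$. *$WBP_\nu$*: there are $M',N\in\mathbb N_0$ (with $\mathcal S_{M'}$ in the domain of $T$ and $T^*$) and $C$ such that $|\langle T\psi,\varphi\rangle|+|\langle T^*\psi,\varphi\rangle|\le C|B|^{1-\nu/n}$ for all balls $B$, $\psi\in\mathcal D_{M'}$, $\varphi\in C_0^\infty$ supported in $B$ with $\|D^\beta\psi\|_\infty,\|D^\beta\varphi\|_\infty\le|B|^{-|\beta|/n}$ for $|\beta|\le N$. *Moments*: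 below, $\eta$ is any function in $\mathcal D_{2P}$ with $\eta=1$ on $B(0,1)$, $\eta_R(x)=\eta(x/R)$, $\psi\in\mathcal D_P$, and $P$ is at least $|\alpha|$ and at least the integer $P$ of $T$. $T(x^\alpha)=0$ means that for some such $P$, $\lim_{R\to\infty}\langle T(x^\alpha\eta_R),\psi\rangle=0$ for all $\psi$ and $\eta$. The non-convolution moment $[[T]]_\alpha$ is $$\langle[[T]]_\alpha,\psi\rangle=\lim_{R\to\infty}\int_{\mathbb R^{2n}}\mathcal K(x,y)(x-y)^\alpha\eta_R(y)\psi(x)\,dy\,dx$$ (a distribution pairing). *Besov spaces*: for any function $\theta$, write $\theta_k(x)=2^{kn}\theta(2^kx)$. Fix $\chi\in\mathcal S_\infty$ with $\widehat\chi$ supported in $1/2<|\xi|<2$ and $\widehat\chi\ge c>0$ on $3/5<|\xi|<5/3$; $b\in\dot B^{s,\infty}_\infty$ means $\sup_{k\in\mathbb Z}2^{sk}\|\chi_k*b\|_{L^\infty}<\infty$, $b$ being a tempered distribution modulo polynomials. $[[T]]_\alpha\in\dot B^{s,\infty}_\infty$ means that for some $P$ the limit defining $[[T]]_\alpha$ exists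 for all $\psi\in\mathcal D_P$ and all $\eta$ and equals $\langle b,\psi\rangle$, where $b\in\mathcal S'$ represents an element of $\dot B^{s,\infty}_\infty$. *Paraproducts*: given $\psi\in\mathcal D_L$ (some $L\in\mathbb N_0$) and $\tilde\psi\in\mathcal S_\infty$ with $f=\sum_{k\in\mathbb Z}\psi_k*\tilde\psi_k*f$ in $\mathcal S_\infty$ for all $f\in\mathcal S_\infty$, and $\varphi\in\mathcal S$ with $\int\varphi=1$, $$\Pi_b^\alpha f=\frac{(-1)^{|\alpha|}}{\alpha!}\sum_{k\in\mathbb Z}\tilde\psi_k*\big((\psi_k*b)\,(\varphi_k*D^\alpha f)\big).$$ **Theorem 7.8.** Let $\nu>-n$, $M\in\mathbb N_0$, $0<\gamma\le1$ and $T\in SIO_\nu(M+\gamma)$. Suppose that $[[T]]_\alpha\in\dot B^{|\alpha|-\nu,\infty}_\infty$ for all $|\alpha|\le M$. Then there are operators $S\in SIO_\nu(M+\gamma)$ and $O\in SIO_\nu(\infty)$ such that $T=S+O$, $S(x^\alpha)=0$ for all $|\alpha|\le M$, and $O^*(x^\alpha)=0$ for all $\alpha\in\mathbb N_0^n$. Moreover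 $O$ is a finite sum of generalized paraproducts, $O=\sum_{|\alpha|\le M}\Pi^\alpha_{b_\alpha}$ for some $\psi,\tilde\psi,\varphi$ as above and some $b_\alpha\in\dot B^{|\alpha|-\nu,\infty}_\infty$, with representatives in $\mathcal S'$ chosen such that $\sup_k2^{(|\alpha|-\nu)k}\|\psi_k*b_\alpha\|_{L^\infty}<\infty$. If in addition $T$ satisfies $WBP_\nu$, then so do $S$ and $O$. -/

import Mathlib

open SchwartzMap MeasureTheory Filter Topology
open scoped FourierTransform ContDiff

namespace SingInt

/-- The space `ℝⁿ` with its Euclidean norm. -/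
abbrev E (n : ℕ) : Type := EuclideanSpace ℝ (Fin n)

/-- The order `|α|` of a multi-index. -/
def order {n : ℕ} (α : Fin n → ℕ) : ℕ := ∑ i, α i

/-- The finite set of multi-indices of order at most `M`. -/
def multiIndices (n M : ℕ) : Finset (Fin n → ℕ) :=
  (Fintype.piFinset fun _ => Finset.range (M + 1)).filter fun α => order α ≤ M

/-- The monomial `x ^ α`, as a complex valued function on `ℝⁿ`. -/
noncomputable def mono {n : ℕ} (α : Fin n → ℕ) (x : E n) : ℂ := ∏ i, ((x i : ℝ) : ℂ) ^ α i

/-- The first order partial derivative in the `i`-th coordinate direction. -/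
noncomputable def partialD {n : ℕ} (i : Fin n) (f : E n → ℂ) : E n → ℂ :=
  fun x => fderiv ℝ f x (EuclideanSpace.single i 1)

/-- The partial derivative `D ^ α f`. -/
noncomputable def multiD {n : ℕ} (α : Fin n → ℕ) (f : E n → ℂ) : E n → ℂ :=
  (List.finRange n).foldr (fun i F => (partialD i)^[α i] F) f

/-- The mixed partial derivative `D_x ^ α D_y ^ β K (x, y)`. -/
noncomputable def mixedD {n : ℕ} (α β : Fin n → ℕ) (K : E n → E n → ℂ) (x y : E n) : ℂ :=
  multiD α (fun x' => multiD β (K x') y) x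

/-! ### Test functions -/

/-- `f ∈ 𝓢_P`: all moments of the Schwartz function `f` of order at most `P` vanish. -/
def InSP {n : ℕ} (P : ℕ) (f : 𝓢(E n, ℂ)) : Prop :=
  ∀ β : Fin n → ℕ, order β ≤ P → ∫ x, mono β x * f x = 0

/-- `f ∈ 𝓢_∞`. -/
def InSInf {n : ℕ} (f : 𝓢(E n, ℂ)) : Prop := ∀ P : ℕ, InSP P f

/-- `f ∈ 𝓓_P`: `f` is smooth with compact support, and its moments of order at most `P` vanish.
Membership in `C₀^∞` is just `HasCompactSupport f`. -/
def InDP {n : ℕ} (P : ℕ) (f : 𝓢(E n, ℂ)) : Prop := HasCompactSupport f ∧ InSP P f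

/-- The function `x ↦ f (c x)` for `c ≠ 0` (and `0` for the irrelevant value `c = 0`). -/
noncomputable def scale {n : ℕ} (c : ℝ) (f : 𝓢(E n, ℂ)) : 𝓢(E n, ℂ) :=
  if h : c ≠ 0 then
    compCLMOfContinuousLinearEquiv ℂ (ContinuousLinearEquiv.smulLeft (Units.mk0 c h)) f
  else 0

theorem scale_apply {n : ℕ} {c : ℝ} (hc : c ≠ 0) (f : 𝓢(E n, ℂ)) (x : E n) :
    scale c f x = f (c • x) := by
  simp [scale, hc, Units.smul_def]

/-- The `L¹`-normalized dilation `f_k (x) = 2 ^ (k n) f (2 ^ k x)`. -/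
noncomputable def dyadic {n : ℕ} (k : ℤ) (f : 𝓢(E n, ℂ)) : 𝓢(E n, ℂ) :=
  (((2 : ℝ) ^ (k * (n : ℤ)) : ℝ) : ℂ) • scale ((2 : ℝ) ^ k) f

theorem dyadic_apply {n : ℕ} (k : ℤ) (f : 𝓢(E n, ℂ)) (x : E n) :
    dyadic k f x = (((2 : ℝ) ^ (k * (n : ℤ)) : ℝ) : ℂ) * f ((2 : ℝ) ^ k • x) := by
  simp [dyadic, scale_apply (zpow_ne_zero k (two_ne_zero' ℝ))]

/-- The tensor product `(g ⊗ f) (x, y) = g x * f y`, a Schwartz function on `ℝⁿ × ℝⁿ`. -/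
noncomputable def tensor {n : ℕ} (g f : 𝓢(E n, ℂ)) : 𝓢(E n × E n, ℂ) where
  toFun p := g p.1 * f p.2
  smooth' := by
    have h1 : ContDiff ℝ ∞ (fun p : E n × E n => g p.1) := (g.smooth ⊤).comp contDiff_fst
    have h2 : ContDiff ℝ ∞ (fun p : E n × E n => f p.2) := (f.smooth ⊤).comp contDiff_snd
    exact h1.mul h2
  decay' := by
    intro k m
    have key : ∀ (a b : ℕ) (u : 𝓢(E n, ℂ)), ∃ C : ℝ, 0 ≤ C ∧
        ∀ x, ‖x‖ ^ a * ‖iteratedFDeriv ℝ b u x‖ ≤ C := by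
      intro a b u
      obtain ⟨C, hC, h⟩ := u.decay a b
      exact ⟨C, hC.le, h⟩
    choose C hC0 hC using key
    refine ⟨∑ i ∈ Finset.range (m + 1), (m.choose i : ℝ) *
      (C k i g * C 0 (m - i) f + C 0 i g * C k (m - i) f), ?_⟩
    intro p
    have h1 : ContDiff ℝ ∞ (fun p : E n × E n => g p.1) := (g.smooth ⊤).comp contDiff_fst
    have h2 : ContDiff ℝ ∞ (fun p : E n × E n => f p.2) := (f.smooth ⊤).comp contDiff_snd
    have hm := norm_iteratedFDeriv_mul_le (𝕜 := ℝ) h1 h2 p (n := m) (by exact_mod_cast le_top)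
    have hg : ∀ i, ‖iteratedFDeriv ℝ i (fun p : E n × E n => g p.1) p‖ ≤
        ‖iteratedFDeriv ℝ i g p.1‖ := by
      intro i
      have e := (ContinuousLinearMap.fst ℝ (E n) (E n)).iteratedFDeriv_comp_right
        (g.smooth ⊤) p (i := i) (by exact_mod_cast le_top)
      have e' : iteratedFDeriv ℝ i (fun p : E n × E n => g p.1) p =
        (iteratedFDeriv ℝ i g p.1).compContinuousLinearMap
          fun _ => ContinuousLinearMap.fst ℝ (E n) (E n) := e
      rw [e']
      refine (ContinuousMultilinearMap.norm_compContinuousLinearMap_le _ _).trans ?_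
      refine mul_le_of_le_one_right (norm_nonneg _) ?_
      exact Finset.prod_le_one (fun _ _ => norm_nonneg _)
        (fun _ _ => ContinuousLinearMap.norm_fst_le ..)
    have hf : ∀ i, ‖iteratedFDeriv ℝ i (fun p : E n × E n => f p.2) p‖ ≤
        ‖iteratedFDeriv ℝ i f p.2‖ := by
      intro i
      have e := (ContinuousLinearMap.snd ℝ (E n) (E n)).iteratedFDeriv_comp_right
        (f.smooth ⊤) p (i := i) (by exact_mod_cast le_top)
      have e' : iteratedFDeriv ℝ i (fun p : E n × E n => f p.2) p =
        (iteratedFDeriv ℝ i f p.2).compContinuousLinearMap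
          fun _ => ContinuousLinearMap.snd ℝ (E n) (E n) := e
      rw [e']
      refine (ContinuousMultilinearMap.norm_compContinuousLinearMap_le _ _).trans ?_
      refine mul_le_of_le_one_right (norm_nonneg _) ?_
      exact Finset.prod_le_one (fun _ _ => norm_nonneg _)
        (fun _ _ => ContinuousLinearMap.norm_snd_le ..)
    have hp : ‖p‖ ^ k ≤ ‖p.1‖ ^ k + ‖p.2‖ ^ k := by
      rw [Prod.norm_def]
      rcases max_cases ‖p.1‖ ‖p.2‖ with ⟨h, -⟩ | ⟨h, -⟩ <;> rw [h]
      · exact le_add_of_nonneg_right (by positivity)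
      · exact le_add_of_nonneg_left (by positivity)
    refine (mul_le_mul_of_nonneg_left hm (by positivity)).trans ?_
    rw [Finset.mul_sum]
    refine Finset.sum_le_sum fun i _ => ?_
    have a1 := hC k i g p.1
    have a2 := hC 0 (m - i) f p.2
    have a3 := hC 0 i g p.1
    have a4 := hC k (m - i) f p.2
    rw [pow_zero, one_mul] at a2 a3
    have b1 := mul_le_mul a1 a2 (norm_nonneg _) (hC0 k i g)
    have b2 := mul_le_mul a3 a4 (by positivity) (hC0 0 i g)
    calc ‖p‖ ^ k * ((m.choose i : ℝ) * ‖iteratedFDeriv ℝ i (fun p : E n × E n => g p.1) p‖ *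
            ‖iteratedFDeriv ℝ (m - i) (fun p : E n × E n => f p.2) p‖)
        ≤ (‖p.1‖ ^ k + ‖p.2‖ ^ k) * ((m.choose i : ℝ) * ‖iteratedFDeriv ℝ i g p.1‖ *
            ‖iteratedFDeriv ℝ (m - i) f p.2‖) := by
          gcongr
          · exact hg i
          · exact hf (m - i)
      _ = (m.choose i : ℝ) * (‖p.1‖ ^ k * ‖iteratedFDeriv ℝ i g p.1‖ *
            ‖iteratedFDeriv ℝ (m - i) f p.2‖ + ‖iteratedFDeriv ℝ i g p.1‖ *
            (‖p.2‖ ^ k * ‖iteratedFDeriv ℝ (m - i) f p.2‖)) := by ring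
      _ ≤ _ := by gcongr

@[simp] theorem tensor_apply {n : ℕ} (g f : 𝓢(E n, ℂ)) (p : E n × E n) :
    tensor g f p = g p.1 * f p.2 := rfl

theorem mono_hasTemperateGrowth {n : ℕ} (α : Fin n → ℕ) :
    (mono α : E n → ℂ).HasTemperateGrowth := by
  classical
  have hc : ∀ i : Fin n, (fun x : E n => ((x i : ℝ) : ℂ)).HasTemperateGrowth := fun i =>
    (Complex.ofRealCLM.comp (EuclideanSpace.proj (𝕜 := ℝ) i)).hasTemperateGrowth
  have : ∀ s : Finset (Fin n),
      (fun x : E n => ∏ i ∈ s, ((x i : ℝ) : ℂ) ^ α i).HasTemperateGrowth := by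
    intro s
    induction s using Finset.induction_on with
    | empty => simp [Function.HasTemperateGrowth.const]
    | insert i s his ih =>
      simp only [Finset.prod_insert his]
      exact ((hc i).pow (α i)).mul ih
  exact this Finset.univ

theorem mono_sub_hasTemperateGrowth {n : ℕ} (α : Fin n → ℕ) :
    (fun p : E n × E n => mono α (p.1 - p.2)).HasTemperateGrowth :=
  (mono_hasTemperateGrowth α).comp
    (ContinuousLinearMap.fst ℝ (E n) (E n) - ContinuousLinearMap.snd ℝ (E n) (E n)).hasTemperateGrowth

/-- The Schwartz function `y ↦ y ^ α η (y / R)`. -/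
noncomputable def cutMono {n : ℕ} (α : Fin n → ℕ) (η : 𝓢(E n, ℂ)) (R : ℝ) : 𝓢(E n, ℂ) :=
  smulLeftCLM ℂ (mono α) (scale R⁻¹ η)

theorem cutMono_apply {n : ℕ} (α : Fin n → ℕ) (η : 𝓢(E n, ℂ)) {R : ℝ} (hR : R ≠ 0) (y : E n) :
    cutMono α η R y = mono α y * η (R⁻¹ • y) := by
  simp [cutMono, smulLeftCLM_apply_apply (mono_hasTemperateGrowth α),
    scale_apply (inv_ne_zero hR)]

/-- The Schwartz function `(x, y) ↦ (x - y) ^ α η (y / R) ψ (x)`. -/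
noncomputable def cutMoment {n : ℕ} (α : Fin n → ℕ) (η ψ : 𝓢(E n, ℂ)) (R : ℝ) :
    𝓢(E n × E n, ℂ) :=
  smulLeftCLM ℂ (fun p : E n × E n => mono α (p.1 - p.2)) (tensor ψ (scale R⁻¹ η))

theorem cutMoment_apply {n : ℕ} (α : Fin n → ℕ) (η ψ : 𝓢(E n, ℂ)) {R : ℝ} (hR : R ≠ 0)
    (x y : E n) :
    cutMoment α η ψ R (x, y) = mono α (x - y) * (ψ x * η (R⁻¹ • y)) := by
  simp [cutMoment, smulLeftCLM_apply_apply (mono_sub_hasTemperateGrowth α),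
    scale_apply (inv_ne_zero hR)]

/-! ### Operators -/

/-- A linear operator `T` which, together with a transpose `T*`, is continuous from `𝓢_P` into
`𝓢'`. Continuity means that the operator is given by a tempered distribution kernel `𝒦` on
`ℝⁿ × ℝⁿ`, through `⟨T f, g⟩ = 𝒦 (g ⊗ f)` for `f ∈ 𝓢_P` and `g ∈ 𝓢`; similarly for `T*`. The two are
transposes of each other in the sense that `⟨T f, g⟩ = ⟨T* g, f⟩` for `f, g ∈ 𝓢_P`.
Two of these structures represent the same operators when they agree on `𝓢_P` for some `P`. -/
structure Operator (n : ℕ) where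
  /-- `T` and `T*` are defined on `𝓢_P`. -/
  P : ℕ
  /-- A distribution kernel of `T`. -/
  ker : 𝓢'(E n × E n, ℂ)
  /-- A distribution kernel of `T*`. -/
  kerT : 𝓢'(E n × E n, ℂ)
  /-- The transposition identity. -/
  transpose_eq : ∀ f g : 𝓢(E n, ℂ), InSP P f → InSP P g → ker (tensor g f) = kerT (tensor f g)

namespace Operator

/-- The pairing `⟨T f, g⟩`, meaningful for `f ∈ 𝓢_P` and `g ∈ 𝓢`. -/
noncomputable def pair {n : ℕ} (T : Operator n) (f g : 𝓢(E n, ℂ)) : ℂ := T.ker (tensor g f)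

/-- The transpose `T*`. -/
def trans {n : ℕ} (T : Operator n) : Operator n where
  P := T.P
  ker := T.kerT
  kerT := T.ker
  transpose_eq f g hf hg := (T.transpose_eq g f hg hf).symm

/-- `T = S + O`, together with `T* = S* + O*`, as operators from `𝓢_P` into `𝓢'`, for some `P` for
which they are all defined. -/
def IsSum {n : ℕ} (T S O : Operator n) : Prop :=
  ∃ P : ℕ, T.P ≤ P ∧ S.P ≤ P ∧ O.P ≤ P ∧ ∀ f g : 𝓢(E n, ℂ), InSP P f →
    T.pair f g = S.pair f g + O.pair f g ∧
    T.trans.pair f g = S.trans.pair f g + O.trans.pair f g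

/-- `T ∈ SIO_ν(M + γ)`: off the diagonal, `T` is represented by a function kernel `K` with the
standard size and regularity estimates. Tested against `f ∈ C₀^∞` and `g ∈ 𝓓_P`, the value
`⟨T f, g⟩` is `⟨T* g, f⟩`. -/
def IsSingular {n : ℕ} (ν : ℝ) (M : ℕ) (γ : ℝ) (T : Operator n) : Prop :=
  ∃ K : E n → E n → ℂ,
    ContDiffOn ℝ M (fun p : E n × E n => K p.1 p.2) {p | p.1 ≠ p.2} ∧
    (∀ f g : 𝓢(E n, ℂ), InDP T.P f → HasCompactSupport g → Disjoint (tsupport f) (tsupport g) →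
      T.pair f g = ∫ p : E n × E n, K p.1 p.2 * f p.2 * g p.1) ∧
    (∀ f g : 𝓢(E n, ℂ), HasCompactSupport f → InDP T.P g → Disjoint (tsupport f) (tsupport g) →
      T.trans.pair g f = ∫ p : E n × E n, K p.1 p.2 * f p.2 * g p.1) ∧
    ∃ C : ℝ,
      (∀ α β : Fin n → ℕ, order α + order β ≤ M → ∀ x y : E n, x ≠ y →
        ‖mixedD α β K x y‖ ≤ C * ‖x - y‖ ^ (-((n : ℝ) + ν + order α + order β))) ∧
      (∀ α β : Fin n → ℕ, order α + order β = M → ∀ x y h : E n, ‖h‖ < ‖x - y‖ / 2 →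
        ‖mixedD α β K (x + h) y - mixedD α β K x y‖ +
            ‖mixedD α β K x y - mixedD α β K x (y + h)‖ ≤
          C * (‖h‖ ^ γ * ‖x - y‖ ^ (-((n : ℝ) + ν + M + γ))))

/-- `T ∈ SIO_ν(∞)`. -/
def IsSingularInf {n : ℕ} (ν : ℝ) (T : Operator n) : Prop :=
  ∀ (M : ℕ) (γ : ℝ), 0 < γ → γ ≤ 1 → T.IsSingular ν M γ

/-- The weak boundedness property `WBP_ν`. -/
def WBP {n : ℕ} (ν : ℝ) (T : Operator n) : Prop :=
  ∃ (M N : ℕ) (C : ℝ), T.P ≤ M ∧ ∀ (c : E n) (r : ℝ), 0 < r → ∀ ψ φ : 𝓢(E n, ℂ),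
    InDP M ψ → HasCompactSupport φ →
    tsupport ψ ⊆ Metric.ball c r → tsupport φ ⊆ Metric.ball c r →
    (∀ β : Fin n → ℕ, order β ≤ N → ∀ x,
      ‖multiD β ψ x‖ ≤ volume.real (Metric.ball c r) ^ (-(order β : ℝ) / n) ∧
      ‖multiD β φ x‖ ≤ volume.real (Metric.ball c r) ^ (-(order β : ℝ) / n)) →
    ‖T.pair ψ φ‖ + ‖T.trans.pair ψ φ‖ ≤ C * volume.real (Metric.ball c r) ^ (1 - ν / n)

/-- `T(x ^ α) = 0`: there is `P` such that `⟨T(x ^ α η(x / R)), ψ⟩ → 0` as `R → ∞` for every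
`ψ ∈ 𝓓_P` and every `η ∈ 𝓓_{2P}` which is `1` on the unit ball. The conditions on `P` ensure that
`x ^ α η(x / R)` lies in the domain of `T`. -/
def Annihilates {n : ℕ} (T : Operator n) (α : Fin n → ℕ) : Prop :=
  ∃ P : ℕ, T.P ≤ P ∧ order α ≤ P ∧
    ∀ η : 𝓢(E n, ℂ), InDP (2 * P) η → (∀ x ∈ Metric.ball (0 : E n) 1, η x = 1) →
    ∀ ψ : 𝓢(E n, ℂ), InDP P ψ →
      Tendsto (fun R : ℝ => T.pair (cutMono α η R) ψ) atTop (𝓝 0)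

/-- `[[T]]_α = u` in `𝓓_P'`: the non-convolution moment
`lim_{R → ∞} ∫∫ 𝒦(x, y) (x - y) ^ α η(y / R) ψ(x) dy dx` exists and equals `⟨u, ψ⟩`, for every
`ψ ∈ 𝓓_P` and every `η ∈ 𝓓_{2P}` which is `1` on the unit ball. -/
def HasMoment {n : ℕ} (T : Operator n) (α : Fin n → ℕ) (P : ℕ) (u : 𝓢'(E n, ℂ)) : Prop :=
  T.P ≤ P ∧ order α ≤ P ∧
    ∀ η : 𝓢(E n, ℂ), InDP (2 * P) η → (∀ x ∈ Metric.ball (0 : E n) 1, η x = 1) →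
    ∀ ψ : 𝓢(E n, ℂ), InDP P ψ →
      Tendsto (fun R : ℝ => T.ker (cutMoment α η ψ R)) atTop (𝓝 (u ψ))

end Operator

/-! ### Besov spaces -/

/-- A Littlewood-Paley function: `χ ∈ 𝓢_∞`, its Fourier transform is supported in the annulus
`1/2 < |ξ| < 2` and is real and bounded below by a positive constant on `3/5 < |ξ| < 5/3`. -/
def IsLittlewoodPaley {n : ℕ} (χ : 𝓢(E n, ℂ)) : Prop :=
  InSInf χ ∧ (∀ ξ : E n, 𝓕 χ ξ ≠ 0 → 1 / 2 < ‖ξ‖ ∧ ‖ξ‖ < 2) ∧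
  ∃ c : ℝ, 0 < c ∧ ∀ ξ : E n, 3 / 5 < ‖ξ‖ → ‖ξ‖ < 5 / 3 → (𝓕 χ ξ).im = 0 ∧ c ≤ (𝓕 χ ξ).re

/-- The function `ψ_k * b`, that is, `x ↦ ⟨b, ψ_k (x - ·)⟩`. -/
noncomputable def distConv {n : ℕ} (ψ : 𝓢(E n, ℂ)) (k : ℤ) (b : 𝓢'(E n, ℂ)) (x : E n) : ℂ :=
  b (compSubConstCLM ℂ x (scale (-1) (dyadic k ψ)))

/-- `sup_k 2 ^ (s k) ‖ψ_k * b‖_∞ < ∞`. When `ψ` is a Littlewood-Paley function this says that the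
class of `b` modulo polynomials belongs to the homogeneous Besov space `Ḃ^{s,∞}_∞`. -/
def BesovBound {n : ℕ} (ψ : 𝓢(E n, ℂ)) (s : ℝ) (b : 𝓢'(E n, ℂ)) : Prop :=
  ∃ C : ℝ, ∀ (k : ℤ) (x : E n), (2 : ℝ) ^ (s * k) * ‖distConv ψ k b x‖ ≤ C

/-- `[[T]]_α ∈ Ḃ^{s,∞}_∞`: in `𝓓_P'` for some `P`, the moment `[[T]]_α` is defined and agrees with
a tempered distribution whose class modulo polynomials lies in `Ḃ^{s,∞}_∞`. -/
def MomentInBesov {n : ℕ} (χ : 𝓢(E n, ℂ)) (T : Operator n) (α : Fin n → ℕ) (s : ℝ) : Prop :=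
  ∃ (P : ℕ) (b : 𝓢'(E n, ℂ)), BesovBound χ s b ∧ T.HasMoment α P b

/-! ### Paraproducts -/

/-- A pair `ψ ∈ 𝓓_L`, `ψ' ∈ 𝓢_∞` such that `f = ∑_k ψ_k * ψ'_k * f` in `𝓢_∞` for `f ∈ 𝓢_∞`. -/
def IsCalderonPair {n : ℕ} (L : ℕ) (ψ ψ' : 𝓢(E n, ℂ)) : Prop :=
  InDP L ψ ∧ InSInf ψ' ∧ ∀ f : 𝓢(E n, ℂ), InSInf f →
    HasSum (fun k : ℤ => convolution (ContinuousLinearMap.mul ℂ ℂ) (dyadic k ψ)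
      (convolution (ContinuousLinearMap.mul ℂ ℂ) (dyadic k ψ') f)) f

/-- The convolution `u * v` of functions. -/
noncomputable def conv {n : ℕ} (u v : E n → ℂ) (x : E n) : ℂ := ∫ y, u (x - y) * v y

/-- The `k`-th term of `⟨Π_b^α f, g⟩`, where
`Π_b^α f = (-1) ^ |α| / α! * ∑_k ψ'_k * ((ψ_k * b) (φ_k * D ^ α f))`. -/
noncomputable def paraTerm {n : ℕ} (ψ ψ' φ : 𝓢(E n, ℂ)) (α : Fin n → ℕ) (b : 𝓢'(E n, ℂ))
    (f g : 𝓢(E n, ℂ)) (k : ℤ) : ℂ :=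
  ((-1 : ℂ) ^ order α / ((∏ i, (α i).factorial : ℕ) : ℂ)) *
    ∫ x, conv (dyadic k ψ') (fun u => distConv ψ k b u * conv (dyadic k φ) (multiD α f) u) x * g x

/-- `O = ∑_{|α| ≤ M} Π_{b_α}^α` (and `O*` is the sum of their transposes), each `B α = Π_{b_α}^α` being
defined by its series. -/
def IsSumOfParaproducts {n : ℕ} (ψ ψ' φ : 𝓢(E n, ℂ)) (M : ℕ) (b : (Fin n → ℕ) → 𝓢'(E n, ℂ))
    (O : Operator n) : Prop :=
  ∃ B : (Fin n → ℕ) → Operator n,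
    (∀ α ∈ multiIndices n M, (B α).P = O.P ∧
      (∀ f g : 𝓢(E n, ℂ), InSP O.P f →
        HasSum (paraTerm ψ ψ' φ α (b α) f g) ((B α).pair f g)) ∧
      (∀ f g : 𝓢(E n, ℂ), InSP O.P g →
        HasSum (paraTerm ψ ψ' φ α (b α) f g) ((B α).trans.pair g f))) ∧
    ∀ f g : 𝓢(E n, ℂ), InSP O.P f →
      O.pair f g = ∑ α ∈ multiIndices n M, (B α).pair f g ∧
      O.trans.pair f g = ∑ α ∈ multiIndices n M, (B α).trans.pair f g

/-- `O` is a finite sum `∑_{|α| ≤ M} Π_{b_α}^α` of generalized paraproducts of order `ν`: the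
functions `ψ, ψ'` form a Calderón pair, `φ` is a Schwartz function with integral `1`, and `b_α`
belongs to `Ḃ^{|α| - ν,∞}_∞`. The distribution `b_α` representing its class modulo polynomials is
normalized so that the functions `ψ_k * b_α` obey the Besov bound too. -/
def IsParaproductSum {n : ℕ} (χ : 𝓢(E n, ℂ)) (ν : ℝ) (M : ℕ) (O : Operator n) : Prop :=
  ∃ (L : ℕ) (ψ ψ' φ : 𝓢(E n, ℂ)) (b : (Fin n → ℕ) → 𝓢'(E n, ℂ)),
    IsCalderonPair L ψ ψ' ∧ ∫ x, φ x = 1 ∧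
    (∀ α ∈ multiIndices n M,
      BesovBound χ ((order α : ℝ) - ν) (b α) ∧ BesovBound ψ ((order α : ℝ) - ν) (b α)) ∧
    IsSumOfParaproducts ψ ψ' φ M b O

end SingInt

/-! The operator `O` is built to have the same non-convolution moments as `T` up to order `M`, so
that `S = T - O` has none. Expanding `y^α = (x - (x - y))^α` turns `⟨S(x^α η_R), ψ⟩` into a
combination of moments of index at most `α`, tested on the functions `x^γ ψ` (`tensor_cutMono`), and
therefore `S(x^α) = 0`.

Prescribing moments rests on a function `φ` whose Fourier transform is `1` near the origin: `D^α φ`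
then has exactly one nonzero moment, the one of index `α`, with value `(-1)^|α| α!`. The kernel of
`Π_b^α` is `∑_k ∫ ψ'_k(x - z) B_k(z) (D^α φ)_k(z - y) dz`, where `B_k` is `2^(k|α|) (ψ_k * b)` times
`(-1)^|α| / α!`. Writing `x - y = (x - z) + (z - y)`, expanding `(x - y)^β` and letting the
truncation tend to `1`, only the terms with that one moment of `D^α φ` survive. Hence for `|β| ≤
|α|` the moment of index `β` of `Π_b^α` is `b` if `β = α`, by the reproducing formula, and `0`
otherwise; for `|β| > |α|` it is some element of the Besov space of order `|β| - ν`. The equations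
for the `b_α` are thus triangular with identity diagonal and are solved by recursion on the order
(`exists_triangular_solution`, `exists_paraproduct_data`).

The analytic properties of `O` follow from one model: a symbol of order `ν`, that is, functions
`B_k` of size `2^(ν k)` placed between two dilated Schwartz functions. The Besov condition on `b_α`
makes every `Π_{b_α}^α` an operator of this kind. The kernel at scale `k` is bounded by `2^((n+ν)k)
min(1, (2^k |x-y|)^(-N))`, and since `n + ν > 0` the sum over `k` is of size `|x-y|^(-(n+ν))`; a
derivative raises the order of the symbol by one, so all kernel estimates hold
(`Represents.isSingularInf`). As `ψ'` has Fourier support in an annulus, it is a sum of derivatives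
of any order `N`, and integration by parts in `x` gains `2^(-kN)`. This gives the convergence of the
distribution kernel, weak boundedness (`Represents.wbp`), and `O*(x^α) = 0`, because `N > |α|`
derivatives of `x^α η(x/R)` are of size `R^(|α|-N)` (`Represents.trans_annihilates`).

The function `ψ` has compact support, hence only finitely many prescribed vanishing moments, and
their number must be fixed before `ψ'` and the `b_α` exist. For this reason the lemmas on
functionals of symbols choose `P` before the symbol and the Schwartz functions. -/

namespace SingInt

open LineDeriv

/-! ### Monomials, derivatives and moments -/

/-- The `i`-th coordinate vector. -/
noncomputable abbrev coordVec {n : ℕ} (i : Fin n) : E n := EuclideanSpace.single i 1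

/-- The partial derivative `D ^ α` on Schwartz functions. -/
noncomputable def derivS {n : ℕ} (α : Fin n → ℕ) (f : 𝓢(E n, ℂ)) : 𝓢(E n, ℂ) :=
  (List.finRange n).foldr (fun i F => (fun g : 𝓢(E n, ℂ) => ∂_{coordVec i} g)^[α i] F) f

theorem partialD_coe {n : ℕ} (i : Fin n) (f : 𝓢(E n, ℂ)) :
    partialD i f = (∂_{coordVec i} f : 𝓢(E n, ℂ)) := rfl

theorem partialD_iterate_coe {n : ℕ} (i : Fin n) (m : ℕ) (f : 𝓢(E n, ℂ)) :
    (partialD i)^[m] f = ((fun g : 𝓢(E n, ℂ) => ∂_{coordVec i} g)^[m] f : 𝓢(E n, ℂ)) := by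
  induction m generalizing f with
  | zero => rfl
  | succ m ih => rw [Function.iterate_succ_apply, partialD_coe, ih, ← Function.iterate_succ_apply]

theorem multiD_coe {n : ℕ} (α : Fin n → ℕ) (f : 𝓢(E n, ℂ)) : multiD α f = derivS α f := by
  unfold multiD derivS
  induction List.finRange n with
  | nil => rfl
  | cons i l ih => simp only [List.foldr_cons, ih, partialD_iterate_coe]

/-- Multiplication by the monomial `x ^ α`. -/
noncomputable def monoMul {n : ℕ} (α : Fin n → ℕ) : 𝓢(E n, ℂ) →L[ℂ] 𝓢(E n, ℂ) :=
  smulLeftCLM ℂ (mono α)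

theorem monoMul_apply {n : ℕ} (α : Fin n → ℕ) (f : 𝓢(E n, ℂ)) (x : E n) :
    monoMul α f x = mono α x * f x := by
  simp [monoMul, smulLeftCLM_apply_apply (mono_hasTemperateGrowth α)]

/-- The moment `∫ x ^ α f`. -/
noncomputable def moment {n : ℕ} (α : Fin n → ℕ) (f : 𝓢(E n, ℂ)) : ℂ := ∫ x, mono α x * f x

theorem moment_eq {n : ℕ} (α : Fin n → ℕ) (f : 𝓢(E n, ℂ)) :
    moment α f = integralCLM ℂ volume (monoMul α f) := by
  simp [moment, monoMul_apply]

theorem integrable_mono_mul {n : ℕ} (α : Fin n → ℕ) (f : 𝓢(E n, ℂ)) :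
    Integrable fun x => mono α x * f x := by
  simpa [← monoMul_apply] using (monoMul α f).integrable (μ := volume)

theorem mono_add_index {n : ℕ} (α β : Fin n → ℕ) (x : E n) :
    mono (α + β) x = mono α x * mono β x := by
  simp [mono, pow_add, Finset.prod_mul_distrib]

theorem mono_zero {n : ℕ} (x : E n) : mono 0 x = 1 := by simp [mono]

theorem mono_smul {n : ℕ} (α : Fin n → ℕ) (c : ℝ) (x : E n) :
    mono α (c • x) = (c : ℂ) ^ order α * mono α x := by
  simp [mono, order, mul_pow, Finset.prod_mul_distrib, Finset.prod_pow_eq_pow_sum]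

theorem order_add {n : ℕ} (α β : Fin n → ℕ) : order (α + β) = order α + order β := by
  simp [order, Finset.sum_add_distrib]

theorem order_zero {n : ℕ} : order (0 : Fin n → ℕ) = 0 := by simp [order]

theorem order_single {n : ℕ} (i : Fin n) (m : ℕ) : order (Pi.single i m : Fin n → ℕ) = m := by
  simp [order]

theorem order_eq_zero {n : ℕ} {α : Fin n → ℕ} : order α = 0 ↔ α = 0 := by
  simp [order, funext_iff]

theorem order_mono {n : ℕ} {α β : Fin n → ℕ} (h : α ≤ β) : order α ≤ order β :=
  Finset.sum_le_sum fun i _ => h i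

theorem order_sub {n : ℕ} {α β : Fin n → ℕ} (h : α ≤ β) : order (β - α) + order α = order β := by
  rw [← order_add, tsub_add_cancel_of_le h]

/-- The multi-indices `γ ≤ α`. -/
def below {n : ℕ} (α : Fin n → ℕ) : Finset (Fin n → ℕ) :=
  Fintype.piFinset fun i => Finset.range (α i + 1)

theorem mem_below {n : ℕ} {α γ : Fin n → ℕ} : γ ∈ below α ↔ γ ≤ α := by
  simp [below, Pi.le_def]

/-- The multinomial coefficient `∏ i, (α i choose γ i)`. -/
def multiChoose {n : ℕ} (α γ : Fin n → ℕ) : ℕ := ∏ i, (α i).choose (γ i)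

theorem mono_add {n : ℕ} (α : Fin n → ℕ) (x y : E n) :
    mono α (x + y) = ∑ γ ∈ below α, (multiChoose α γ : ℂ) * (mono γ x * mono (α - γ) y) := by
  unfold mono below multiChoose
  simp only [PiLp.add_apply, Complex.ofReal_add, add_pow]
  rw [Finset.prod_univ_sum]
  refine Finset.sum_congr rfl fun γ _ => ?_
  push_cast
  simp only [Finset.prod_mul_distrib, Pi.sub_apply]
  ring

theorem mem_multiIndices {n M : ℕ} {α : Fin n → ℕ} : α ∈ multiIndices n M ↔ order α ≤ M := by
  simp only [multiIndices, Finset.mem_filter, Fintype.mem_piFinset, Finset.mem_range,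
    and_iff_right_iff_imp]
  intro h i
  exact Nat.lt_succ_of_le ((Finset.single_le_sum (f := α) (fun _ _ => Nat.zero_le _)
    (Finset.mem_univ i)).trans h)

theorem InSP.mono {n P Q : ℕ} {f : 𝓢(E n, ℂ)} (h : InSP P f) (hQ : Q ≤ P) : InSP Q f :=
  fun β hβ => h β (hβ.trans hQ)

theorem InDP.mono {n P Q : ℕ} {f : 𝓢(E n, ℂ)} (h : InDP P f) (hQ : Q ≤ P) : InDP Q f :=
  ⟨h.1, h.2.mono hQ⟩

theorem inSP_iff {n P : ℕ} {f : 𝓢(E n, ℂ)} :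
    InSP P f ↔ ∀ β : Fin n → ℕ, order β ≤ P → moment β f = 0 := Iff.rfl

theorem moment_sub {n : ℕ} (α : Fin n → ℕ) (f g : 𝓢(E n, ℂ)) :
    moment α (f - g) = moment α f - moment α g := by simp only [moment_eq, map_sub]

theorem moment_smul {n : ℕ} (α : Fin n → ℕ) (c : ℂ) (f : 𝓢(E n, ℂ)) :
    moment α (c • f) = c * moment α f := by simp only [moment_eq, map_smul, smul_eq_mul]

theorem moment_sum {n : ℕ} {ι : Type*} (s : Finset ι) (α : Fin n → ℕ) (f : ι → 𝓢(E n, ℂ)) :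
    moment α (∑ i ∈ s, f i) = ∑ i ∈ s, moment α (f i) := by simp only [moment_eq, map_sum]

theorem moment_monoMul {n : ℕ} (α γ : Fin n → ℕ) (f : 𝓢(E n, ℂ)) :
    moment α (monoMul γ f) = moment (α + γ) f := by
  simp only [moment, monoMul_apply, mono_add_index, mul_assoc]

theorem InSP.monoMul {n P Q : ℕ} {f : 𝓢(E n, ℂ)} (h : InSP P f) (γ : Fin n → ℕ)
    (hQ : Q + order γ ≤ P) : InSP Q (monoMul γ f) := by
  intro β hβ
  have := h (β + γ) (by rw [order_add]; omega)
  exact (moment_monoMul β γ f).trans this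

theorem InSInf.monoMul {n : ℕ} {f : 𝓢(E n, ℂ)} (h : InSInf f) (γ : Fin n → ℕ) :
    InSInf (monoMul γ f) := fun P => (h (P + order γ)).monoMul γ le_rfl

/-- Reflection `f (-x)`. -/
noncomputable abbrev reflect {n : ℕ} (f : 𝓢(E n, ℂ)) : 𝓢(E n, ℂ) := scale (-1) f

/-- Translation `f (x - a)`. -/
noncomputable abbrev translate {n : ℕ} (a : E n) (f : 𝓢(E n, ℂ)) : 𝓢(E n, ℂ) :=
  compSubConstCLM ℂ a f

theorem reflect_apply {n : ℕ} (f : 𝓢(E n, ℂ)) (x : E n) : reflect f x = f (-x) := by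
  rw [reflect, scale_apply (by norm_num)]; simp

theorem moment_scale {n : ℕ} (α : Fin n → ℕ) {c : ℝ} (hc : c ≠ 0) (f : 𝓢(E n, ℂ)) :
    moment α (scale c f) = ((c : ℂ) ^ order α)⁻¹ * ((|(c ^ n)⁻¹| : ℝ) : ℂ) * moment α f := by
  have h := Measure.integral_comp_smul (volume : Measure (E n)) (fun x => mono α x * f x) c
  simp only [finrank_euclideanSpace, Fintype.card_fin, mono_smul] at h
  have hc' : (c : ℂ) ^ order α ≠ 0 := pow_ne_zero _ (by exact_mod_cast hc)
  unfold moment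
  rw [mul_assoc, ← Complex.real_smul, ← h, ← integral_const_mul]
  refine integral_congr_ae (Eventually.of_forall fun x => ?_)
  simp only [scale_apply hc]
  field_simp

theorem InSP.scale {n P : ℕ} {f : 𝓢(E n, ℂ)} (h : InSP P f) {c : ℝ} (hc : c ≠ 0) :
    InSP P (scale c f) := fun β hβ => by
  have := moment_scale β hc f
  rw [inSP_iff.1 h β hβ, mul_zero] at this
  exact this

theorem InSP.smul {n P : ℕ} {f : 𝓢(E n, ℂ)} (h : InSP P f) (c : ℂ) : InSP P (c • f) :=
  fun β hβ => (moment_smul β c f).trans (by rw [inSP_iff.1 h β hβ, mul_zero])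

theorem InSP.sum {n P : ℕ} {ι : Type*} {s : Finset ι} {f : ι → 𝓢(E n, ℂ)}
    (h : ∀ i ∈ s, InSP P (f i)) : InSP P (∑ i ∈ s, f i) := fun β hβ =>
  (moment_sum s β f).trans (Finset.sum_eq_zero fun i hi => h i hi β hβ)

theorem InSP.dyadic {n P : ℕ} {f : 𝓢(E n, ℂ)} (h : InSP P f) (k : ℤ) : InSP P (dyadic k f) :=
  (h.scale (zpow_ne_zero k two_ne_zero)).smul _

theorem moment_translate {n : ℕ} (α : Fin n → ℕ) (a : E n) (f : 𝓢(E n, ℂ)) :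
    moment α (translate a f) =
      ∑ γ ∈ below α, (multiChoose α γ : ℂ) * mono (α - γ) a * moment γ f := by
  unfold moment
  simp only [← integral_const_mul]
  rw [← integral_finsetSum _ fun γ _ => (integrable_mono_mul γ f).const_mul _,
    ← integral_add_right_eq_self _ a]
  refine integral_congr_ae (Eventually.of_forall fun x => ?_)
  simp only [compSubConstCLM_apply, add_sub_cancel_right, mono_add, Finset.sum_mul]
  refine Finset.sum_congr rfl fun γ _ => ?_
  ring

theorem InSP.translate {n P : ℕ} {f : 𝓢(E n, ℂ)} (h : InSP P f) (a : E n) :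
    InSP P (translate a f) := fun β hβ =>
  (moment_translate β a f).trans (Finset.sum_eq_zero fun γ hγ => by
    rw [inSP_iff.1 h γ ((order_mono (mem_below.1 hγ)).trans hβ), mul_zero])

theorem differentiable_mono {n : ℕ} (α : Fin n → ℕ) : Differentiable ℝ (mono α : E n → ℂ) :=
  (mono_hasTemperateGrowth α).1.differentiable (by simp)

/-- Truncated subtraction of multi-indices is harmless here and below: when `α i = 0` the factor `α
i` kills the term. -/
theorem fderiv_mono {n : ℕ} (α : Fin n → ℕ) (i : Fin n) (x : E n) :
    fderiv ℝ (mono α) x (coordVec i) = α i * mono (α - Pi.single i 1) x := by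
  rw [← (differentiable_mono α x).lineDeriv_eq_fderiv, lineDeriv]
  have h : (fun t : ℝ => mono α (x + t • coordVec i)) = fun t : ℝ =>
      (((x i + t : ℝ) : ℂ)) ^ α i * ∏ j ∈ Finset.univ.erase i, ((x j : ℝ) : ℂ) ^ α j := by
    funext t
    unfold mono
    rw [← Finset.mul_prod_erase _ _ (Finset.mem_univ i)]
    congr 1
    · simp
    · refine Finset.prod_congr rfl fun j hj => ?_
      simp [(Finset.ne_of_mem_erase hj)]
  have h2 : mono (α - Pi.single i 1) x =
      ((x i : ℝ) : ℂ) ^ (α i - 1) * ∏ j ∈ Finset.univ.erase i, ((x j : ℝ) : ℂ) ^ α j := by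
    unfold mono
    rw [← Finset.mul_prod_erase _ _ (Finset.mem_univ i)]
    congr 1
    · simp
    · refine Finset.prod_congr rfl fun j hj => ?_
      simp [(Finset.ne_of_mem_erase hj)]
  rw [h, h2]
  have h1 : HasDerivAt (fun t : ℝ => ((x i + t : ℝ) : ℂ)) 1 0 := by
    simpa using ((hasDerivAt_id (0 : ℝ)).const_add (x i)).ofReal_comp
  have h3 := ((h1.pow (α i)).mul_const
    (∏ j ∈ Finset.univ.erase i, ((x j : ℝ) : ℂ) ^ α j)).deriv
  simp only [add_zero, mul_one] at h3
  rw [← mul_assoc]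
  exact h3

theorem moment_deriv {n : ℕ} (α : Fin n → ℕ) (i : Fin n) (f : 𝓢(E n, ℂ)) :
    moment α (∂_{coordVec i} f) = -(α i) * moment (α - Pi.single i 1) f := by
  unfold moment
  have h := integral_mul_fderiv_eq_neg_fderiv_mul_of_integrable (μ := (volume : Measure (E n)))
    (f := mono α) (g := f) (v := coordVec i) ?_ ?_ (integrable_mono_mul α f)
    (fun x _ => differentiable_mono α x) (fun x _ => f.differentiable x)
  · simp only [lineDerivOp_apply_eq_fderiv]
    rw [h, neg_mul, ← integral_const_mul]
    congr 2 with x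
    rw [fderiv_mono]; ring
  · simp only [fderiv_mono, mul_assoc]
    exact (integrable_mono_mul _ f).const_mul _
  · exact integrable_mono_mul α (∂_{coordVec i} f)

theorem moment_deriv_iterate {n : ℕ} (α : Fin n → ℕ) (i : Fin n) (m : ℕ) (f : 𝓢(E n, ℂ)) :
    moment α ((fun g : 𝓢(E n, ℂ) => ∂_{coordVec i} g)^[m] f) =
      (-1) ^ m * ((α i).descFactorial m : ℂ) * moment (α - Pi.single i m) f := by
  induction m generalizing f with
  | zero => simp
  | succ m ih =>
    rw [Function.iterate_succ_apply, ih, moment_deriv, Nat.descFactorial_succ]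
    have : α - Pi.single i m - Pi.single i 1 = α - Pi.single i (m + 1) := by
      rw [tsub_tsub, ← Pi.single_add]
    rw [this]
    simp only [Pi.sub_apply, Pi.single_eq_same, Nat.cast_mul]
    ring

theorem moment_derivS {n : ℕ} (α β : Fin n → ℕ) (f : 𝓢(E n, ℂ)) :
    moment α (derivS β f) =
      (-1) ^ order β * ((∏ i, (α i).descFactorial (β i) : ℕ) : ℂ) * moment (α - β) f := by
  -- The induction runs over duplicate-free lists with `α` free: treating coordinate `i` replaces
  -- `α` by `α - β i e_i`, which leaves the factors belonging to the other coordinates unchanged.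
  have key : ∀ (l : List (Fin n)) (_ : l.Nodup) (α : Fin n → ℕ),
      moment α (l.foldr (fun i F => (fun g : 𝓢(E n, ℂ) => ∂_{coordVec i} g)^[β i] F) f) =
        (-1) ^ (l.map β).sum * (((l.map fun i => (α i).descFactorial (β i)).prod : ℕ) : ℂ) *
          moment (α - (l.map fun i => (Pi.single i (β i) : Fin n → ℕ)).sum) f := by
    intro l hl
    induction l with
    | nil => intro α; simp
    | cons i l ih =>
      intro α
      rw [List.nodup_cons] at hl
      rw [List.foldr_cons, moment_deriv_iterate, ih hl.2]
      have : (l.map fun j => ((α - (Pi.single i (β i) : Fin n → ℕ)) j).descFactorial (β j)) =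
          l.map fun j => (α j).descFactorial (β j) := by
        refine List.map_congr_left fun j hj => ?_
        have hij : j ≠ i := fun h => hl.1 (h ▸ hj)
        simp [hij]
      rw [this]
      simp only [List.map_cons, List.sum_cons, List.prod_cons, pow_add, Nat.cast_mul, tsub_tsub]
      ring
  have h := key _ (List.nodup_finRange n) α
  have e1 : ((List.finRange n).map β).sum = order β := by
    simp [order, List.sum_ofFn, ← List.ofFn_eq_map]
  have e2 : ((List.finRange n).map fun i => (α i).descFactorial (β i)).prod =
      ∏ i, (α i).descFactorial (β i) := by
    simp [List.prod_ofFn, ← List.ofFn_eq_map]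
  have e3 : ((List.finRange n).map fun i => (Pi.single i (β i) : Fin n → ℕ)).sum = β := by
    rw [← List.ofFn_eq_map, List.sum_ofFn]
    exact Finset.univ_sum_single β
  rw [e1, e2, e3] at h
  exact h

/-- Integration by parts lowers the degree of the monomial by one, so each derivative gains one
order of vanishing moments. -/
theorem InSP.lineDeriv {n P : ℕ} {f : 𝓢(E n, ℂ)} (h : InSP P f) (i : Fin n) :
    InSP (P + 1) (∂_{coordVec i} f) := by
  intro β hβ
  refine (moment_deriv β i f).trans ?_
  rcases Nat.eq_zero_or_pos (β i) with h0 | h0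
  · simp [h0]
  · rw [inSP_iff.1 h, mul_zero]
    have : order (β - Pi.single i 1) + order (Pi.single i 1 : Fin n → ℕ) = order β := by
      refine order_sub fun j => ?_
      rcases eq_or_ne j i with rfl | hj
      · rw [Pi.single_eq_same]; exact h0
      · simp [hj]
    rw [order_single] at this
    omega

theorem inSP_zero_lineDeriv {n : ℕ} (f : 𝓢(E n, ℂ)) (i : Fin n) : InSP 0 (∂_{coordVec i} f) := by
  intro β hβ
  rw [Nat.le_zero, order_eq_zero] at hβ
  refine (moment_deriv β i f).trans ?_
  simp [hβ]

/-- If all moments of order `1, …, M` of `φ` vanish and `∫ φ = 1`, the moments of the derivatives of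
`φ` are those of the derivatives of the Dirac mass. -/
theorem moment_derivS_of_dual {n M : ℕ} {φ : 𝓢(E n, ℂ)}
    (hφ : ∀ γ : Fin n → ℕ, order γ ≤ M → moment γ φ = if γ = 0 then 1 else 0)
    (α β : Fin n → ℕ) (hα : order α ≤ M) :
    moment α (derivS β φ) =
      if α = β then (-1) ^ order β * ((∏ i, (β i).factorial : ℕ) : ℂ) else 0 := by
  rw [moment_derivS, hφ _ ((order_mono tsub_le_self).trans hα)]
  split_ifs with h1 h2 h2
  · subst h2; simp [Nat.descFactorial_self]
  -- A multi-index strictly below `β` in some coordinate makes the corresponding descending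
  -- factorial vanish.
  · have hle : α ≤ β := tsub_eq_zero_iff_le.1 h1
    obtain ⟨i, hi⟩ : ∃ i, α i < β i := by
      by_contra hcon
      exact h2 (le_antisymm hle fun i => not_lt.1 fun hi => hcon ⟨i, hi⟩)
    have : ∏ i, (α i).descFactorial (β i) = 0 :=
      Finset.prod_eq_zero (Finset.mem_univ i) (Nat.descFactorial_of_lt hi)
    simp [this]
  · exact absurd (by rw [h2]; exact tsub_self β) h1
  · simp

/-! ### Convolution and the Fourier transform -/

/-- The convolution of two Schwartz functions. -/
noncomputable abbrev cv {n : ℕ} (f g : 𝓢(E n, ℂ)) : 𝓢(E n, ℂ) :=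
  convolution (ContinuousLinearMap.mul ℂ ℂ) f g

theorem fourier_cv {n : ℕ} (f g : 𝓢(E n, ℂ)) (ξ : E n) : 𝓕 (cv f g) ξ = 𝓕 f ξ * 𝓕 g ξ := by
  rw [cv, fourier_convolution, pairing_apply_apply]; rfl

theorem ext_fourier {n : ℕ} {f g : 𝓢(E n, ℂ)} (h : ∀ ξ, 𝓕 f ξ = 𝓕 g ξ) : f = g := by
  have : 𝓕 f = 𝓕 g := SchwartzMap.ext h
  rw [← FourierTransform.fourierInv_fourier_eq (F := 𝓢(E n, ℂ)) f, this,
    FourierTransform.fourierInv_fourier_eq]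

theorem cv_comm {n : ℕ} (f g : 𝓢(E n, ℂ)) : cv f g = cv g f :=
  ext_fourier fun ξ => by rw [fourier_cv, fourier_cv, mul_comm]

theorem cv_apply {n : ℕ} (f g : 𝓢(E n, ℂ)) (x : E n) : cv f g x = ∫ t, f t * g (x - t) := by
  rw [cv, convolution_apply]; rfl

theorem cv_apply' {n : ℕ} (f g : 𝓢(E n, ℂ)) (x : E n) : cv f g x = ∫ t, f (x - t) * g t := by
  rw [cv_comm, cv_apply]; simp only [mul_comm]

theorem fourier_scale {n : ℕ} {c : ℝ} (hc : c ≠ 0) (f : 𝓢(E n, ℂ)) (ξ : E n) :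
    𝓕 (scale c f) ξ = ((|(c ^ n)⁻¹| : ℝ) : ℂ) * 𝓕 f (c⁻¹ • ξ) := by
  have h := Measure.integral_comp_smul (volume : Measure (E n))
    (fun v => Real.fourierChar (-inner ℝ v (c⁻¹ • ξ)) • f v) c
  simp only [finrank_euclideanSpace, Fintype.card_fin] at h
  rw [fourier_coe, fourier_coe, Real.fourier_eq, Real.fourier_eq, ← Complex.real_smul, ← h]
  refine integral_congr_ae (Eventually.of_forall fun x => ?_)
  simp only [scale_apply hc, inner_smul_left, inner_smul_right]
  congr 3
  simp [hc]

theorem fourier_dyadic {n : ℕ} (k : ℤ) (f : 𝓢(E n, ℂ)) (ξ : E n) :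
    𝓕 (dyadic k f) ξ = 𝓕 f ((2 : ℝ) ^ (-k) • ξ) := by
  have h2 : (0 : ℝ) < 2 ^ k := zpow_pos two_pos k
  have e : 𝓕 (dyadic k f) ξ = (((2 : ℝ) ^ (k * (n : ℤ)) : ℝ) : ℂ) * 𝓕 (scale ((2 : ℝ) ^ k) f) ξ := by
    rw [dyadic, FourierTransform.fourier_smul]; rfl
  rw [e, fourier_scale h2.ne', ← mul_assoc, ← Complex.ofReal_mul, abs_of_pos (by positivity),
    zpow_mul, zpow_natCast, mul_inv_cancel₀ (by positivity), zpow_neg]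
  simp

theorem fourier_reflect {n : ℕ} (f : 𝓢(E n, ℂ)) (ξ : E n) : 𝓕 (reflect f) ξ = 𝓕 f (-ξ) := by
  rw [reflect, fourier_scale (by norm_num)]
  have : |(((-1 : ℝ) ^ n)⁻¹)| = 1 := by simp
  rw [this, show ((-1 : ℝ)⁻¹) = -1 by norm_num]
  simp

theorem fourier_apply_zero {n : ℕ} (f : 𝓢(E n, ℂ)) : 𝓕 f 0 = ∫ x, f x := by
  rw [fourier_coe, Real.fourier_eq]; simp

theorem inner_coordVec {n : ℕ} (x : E n) (i : Fin n) : inner ℝ x (coordVec i) = x i := by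
  simp [EuclideanSpace.inner_single_right]

theorem fourier_lineDeriv_apply {n : ℕ} (f : 𝓢(E n, ℂ)) (i : Fin n) (ξ : E n) :
    𝓕 (∂_{coordVec i} f) ξ = (2 * Real.pi * Complex.I) * ((ξ i : ℝ) : ℂ) * 𝓕 f ξ := by
  have : (inner ℝ · (coordVec i) : E n → ℝ).HasTemperateGrowth := by fun_prop
  rw [fourier_lineDerivOp_eq, FunLike.coe_smul, Pi.smul_apply, smulLeftCLM_apply_apply this,
    inner_coordVec, smul_eq_mul, Complex.real_smul]
  ring

theorem lineDeriv_fourier {n : ℕ} (f : 𝓢(E n, ℂ)) (i : Fin n) :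
    ∂_{coordVec i} (𝓕 f) = (-(2 * Real.pi * Complex.I)) • 𝓕 (monoMul (Pi.single i 1) f) := by
  have : (inner ℝ · (coordVec i) : E n → ℝ).HasTemperateGrowth := by fun_prop
  rw [lineDerivOp_fourier_eq, FourierTransform.fourier_smul]
  congr 2
  ext x
  rw [smulLeftCLM_apply_apply this, monoMul_apply]
  have : mono (Pi.single i 1) x = ((x i : ℝ) : ℂ) := by
    unfold mono
    rw [Finset.prod_eq_single i] <;> simp +contextual
  rw [this, inner_coordVec]
  simp

/-! ### Vanishing moments -/

/-- A linear form is a combination of coordinates, so multiplying by it costs one vanishing moment.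
On the Fourier side this is one directional derivative. -/
theorem InSP.inner_smul {n P : ℕ} {f : 𝓢(E n, ℂ)} (h : InSP (P + 1) f) (m : E n) :
    InSP P (smulLeftCLM ℂ (inner ℝ · m : E n → ℝ) f) := by
  have ht : (inner ℝ · m : E n → ℝ).HasTemperateGrowth := by fun_prop
  have e : smulLeftCLM ℂ (inner ℝ · m : E n → ℝ) f =
      ∑ i, ((m i : ℝ) : ℂ) • SingInt.monoMul (Pi.single i 1) f := by
    ext x
    rw [smulLeftCLM_apply_apply ht]
    simp only [FunLike.coe_sum, Finset.sum_apply, FunLike.coe_smul, Pi.smul_apply, monoMul_apply]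
    have : ∀ i, SingInt.mono (Pi.single i 1) x = ((x i : ℝ) : ℂ) := by
      intro i
      unfold SingInt.mono
      rw [Finset.prod_eq_single i] <;> simp +contextual
    simp only [this, PiLp.inner_apply, Complex.real_smul, smul_eq_mul, Complex.ofReal_sum,
      Finset.sum_mul]
    refine Finset.sum_congr rfl fun i _ => ?_
    simp
    ring
  rw [e]
  exact InSP.sum fun i _ => (h.monoMul _ (by rw [order_single])).smul _

theorem InSP.iteratedLineDeriv_fourier {n P : ℕ} {f : 𝓢(E n, ℂ)} (h : InSP P f) {j : ℕ}
    (hj : j ≤ P) (m : Fin j → E n) : (∂^{m} (𝓕 f) : 𝓢(E n, ℂ)) 0 = 0 := by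
  induction j generalizing P f with
  | zero =>
    rw [iteratedLineDerivOp_fin_zero, fourier_apply_zero]
    have := h 0 (by simp [order_zero])
    simpa [mono_zero] using this
  | succ j ih =>
    obtain ⟨P, rfl⟩ : ∃ P', P = P' + 1 := ⟨P - 1, by omega⟩
    rw [iteratedLineDerivOp_succ_right, lineDerivOp_fourier_eq]
    exact ih ((h.inner_smul _).smul _) (by omega) _

/-- A smooth function vanishes at the origin to the order `P`. -/
def VanishesAtZero {n : ℕ} (P : ℕ) (A : E n → ℂ) : Prop :=
  ∀ j ≤ P, iteratedFDeriv ℝ j A 0 = 0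

theorem InSP.vanishesAtZero {n P : ℕ} {f : 𝓢(E n, ℂ)} (h : InSP P f) :
    VanishesAtZero P (𝓕 f : 𝓢(E n, ℂ)) := by
  intro j hj
  ext m
  rw [← iteratedLineDerivOp_eq_iteratedFDeriv, h.iteratedLineDeriv_fourier hj]
  rfl

/-- Taylor's estimate by repeated use of the mean value inequality: each of the `d` steps trades one
more derivative for one factor `‖ξ‖`. -/
theorem VanishesAtZero.norm_le {n P : ℕ} {A : E n → ℂ} (hA : ContDiff ℝ ∞ A)
    (h : VanishesAtZero P A) {C : ℝ} (hC : ∀ j ≤ P + 1, ∀ ξ, ‖iteratedFDeriv ℝ j A ξ‖ ≤ C)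
    (d i : ℕ) (hdi : i + d ≤ P + 1) (ξ : E n) : ‖iteratedFDeriv ℝ i A ξ‖ ≤ C * ‖ξ‖ ^ d := by
  induction d generalizing i ξ with
  | zero => simpa using hC i hdi ξ
  | succ d ih =>
    have hd : Differentiable ℝ (iteratedFDeriv ℝ i A) :=
      hA.differentiable_iteratedFDeriv (by exact_mod_cast WithTop.coe_lt_top _)
    have hCn : 0 ≤ C := (norm_nonneg _).trans (hC 0 (by omega) 0)
    have := (convex_closedBall (0 : E n) ‖ξ‖).norm_image_sub_le_of_norm_fderiv_le (𝕜 := ℝ)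
      (f := iteratedFDeriv ℝ i A) (C := C * ‖ξ‖ ^ d) (x := 0) (y := ξ) (fun x _ => hd x) ?_
      (by simp) (by simp)
    · rw [h i (by omega), sub_zero, sub_zero] at this
      rw [pow_succ, ← mul_assoc]
      exact this
    · intro x hx
      rw [norm_fderiv_iteratedFDeriv]
      refine (ih (i + 1) (by omega) x).trans ?_
      gcongr
      simpa using hx

/-! ### Dilated multipliers -/

/-- A continuous gauge on Schwartz space: a nonnegative continuous function vanishing at `0`. -/
structure IsGauge {V : Type*} [NormedAddCommGroup V] [NormedSpace ℝ V] (q : 𝓢(V, ℂ) → ℝ) :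
    Prop where
  cont : Continuous q
  zero : q 0 = 0
  nonneg : ∀ f, 0 ≤ q f

namespace IsGauge

variable {V : Type*} [NormedAddCommGroup V] [NormedSpace ℝ V]

theorem seminorm (k m : ℕ) : IsGauge (fun f : 𝓢(V, ℂ) => SchwartzMap.seminorm ℂ k m f) :=
  ⟨(schwartz_withSeminorms ℂ V ℂ).continuous_seminorm (k, m), map_zero _, fun f => apply_nonneg _ f⟩

theorem add {q r : 𝓢(V, ℂ) → ℝ} (hq : IsGauge q) (hr : IsGauge r) :
    IsGauge fun f => q f + r f :=
  ⟨hq.cont.add hr.cont, by simp [hq.zero, hr.zero], fun f => add_nonneg (hq.nonneg f) (hr.nonneg f)⟩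

theorem const_mul {q : 𝓢(V, ℂ) → ℝ} (hq : IsGauge q) {c : ℝ} (hc : 0 ≤ c) :
    IsGauge fun f => c * q f :=
  ⟨hq.cont.const_mul c, by simp [hq.zero], fun f => mul_nonneg hc (hq.nonneg f)⟩

theorem sum {ι : Type*} {s : Finset ι} {q : ι → 𝓢(V, ℂ) → ℝ} (hq : ∀ i ∈ s, IsGauge (q i)) :
    IsGauge fun f => ∑ i ∈ s, q i f :=
  ⟨continuous_finsetSum _ fun i hi => (hq i hi).cont,
    Finset.sum_eq_zero fun i hi => (hq i hi).zero,
    fun f => Finset.sum_nonneg fun i hi => (hq i hi).nonneg f⟩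

theorem comp {W : Type*} [NormedAddCommGroup W] [NormedSpace ℝ W] {q : 𝓢(V, ℂ) → ℝ}
    (hq : IsGauge q) {L : 𝓢(W, ℂ) → 𝓢(V, ℂ)} (hL : Continuous L) (h0 : L 0 = 0) :
    IsGauge fun f => q (L f) :=
  ⟨hq.cont.comp hL, by rw [h0, hq.zero], fun f => hq.nonneg _⟩

/-- A linear functional dominated by a gauge is continuous. -/
theorem continuous_of_le {q : 𝓢(V, ℂ) → ℝ} (hq : IsGauge q) (A : 𝓢(V, ℂ) →ₗ[ℂ] ℂ)
    (hA : ∀ f, ‖A f‖ ≤ q f) : Continuous A := by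
  refine continuous_of_continuousAt_zero A.toAddMonoidHom ?_
  have h0 : Tendsto q (𝓝 0) (𝓝 0) := by simpa [hq.zero] using hq.cont.tendsto 0
  have : Tendsto A (𝓝 0) (𝓝 0) := squeeze_zero_norm hA h0
  simpa [ContinuousAt] using this

end IsGauge

section Multipliers

variable {n : ℕ}

theorem norm_iteratedFDeriv_dilate_mul_le {A : E n → ℂ} (hA : ContDiff ℝ ∞ A) {G H : 𝓢(E n, ℂ)}
    {c : ℝ} (hc : 0 < c) (hH : ∀ ξ, H ξ = A (c • ξ) * G ξ) (N : ℕ) (ξ : E n) :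
    ‖iteratedFDeriv ℝ N H ξ‖ ≤ ∑ i ∈ Finset.range (N + 1), (N.choose i : ℝ) *
      (c ^ i * ‖iteratedFDeriv ℝ i A (c • ξ)‖) * ‖iteratedFDeriv ℝ (N - i) G ξ‖ := by
  have hAc : ContDiff ℝ ∞ (fun ξ => A (c • ξ)) := hA.comp (contDiff_const_smul c)
  have h := norm_iteratedFDeriv_mul_le (𝕜 := ℝ) hAc (G.smooth ⊤) ξ (n := N)
    (by exact_mod_cast le_top)
  have e : (H : E n → ℂ) = fun ξ => A (c • ξ) * G ξ := funext hH
  rw [e]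
  refine h.trans (le_of_eq (Finset.sum_congr rfl fun i _ => ?_))
  congr 2
  have := congrFun (iteratedFDeriv_comp_const_smul (𝕜 := ℝ) (i := i) c
    (hA.of_le (by exact_mod_cast le_top))) ξ
  rw [this, norm_smul, norm_pow, Real.norm_of_nonneg hc.le]

/-- For `c ≤ 1` the chain rule factors `c^i` are at most `1`, and `‖c ξ‖^Q = c^Q ‖ξ‖^Q`; the growth
`‖ξ‖^Q` is absorbed in the seminorm of `G`. -/
theorem seminorm_dilate_mul_le_of_le_one {A : E n → ℂ} (hA : ContDiff ℝ ∞ A) {K N Q : ℕ} {C : ℝ}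
    (hC : ∀ i ≤ N, ∀ η, ‖iteratedFDeriv ℝ i A η‖ ≤ C * ‖η‖ ^ Q) {G H : 𝓢(E n, ℂ)} {c : ℝ}
    (hc : 0 < c) (hc1 : c ≤ 1) (hH : ∀ ξ, H ξ = A (c • ξ) * G ξ) (hC0 : 0 ≤ C) :
    SchwartzMap.seminorm ℂ K N H ≤ (∑ i ∈ Finset.range (N + 1), (N.choose i : ℝ) * C *
      SchwartzMap.seminorm ℂ (K + Q) (N - i) G) * c ^ Q := by
  refine SchwartzMap.seminorm_le_bound ℂ K N H (by positivity) fun ξ => ?_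
  refine (mul_le_mul_of_nonneg_left (norm_iteratedFDeriv_dilate_mul_le hA hc hH N ξ)
    (by positivity)).trans ?_
  rw [Finset.mul_sum, Finset.sum_mul]
  refine Finset.sum_le_sum fun i hi => ?_
  have hi' : i ≤ N := Nat.lt_succ_iff.1 (Finset.mem_range.1 hi)
  have h1 := hC i hi' (c • ξ)
  have h2 := SchwartzMap.le_seminorm ℂ (K + Q) (N - i) G ξ
  have h3 : c ^ i ≤ 1 := pow_le_one₀ hc.le hc1
  calc ‖ξ‖ ^ K * ((N.choose i : ℝ) * (c ^ i * ‖iteratedFDeriv ℝ i A (c • ξ)‖) *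
        ‖iteratedFDeriv ℝ (N - i) G ξ‖)
      ≤ ‖ξ‖ ^ K * ((N.choose i : ℝ) * (1 * (C * ‖c • ξ‖ ^ Q)) *
        ‖iteratedFDeriv ℝ (N - i) G ξ‖) := by gcongr
    _ = (N.choose i : ℝ) * C * (‖ξ‖ ^ (K + Q) * ‖iteratedFDeriv ℝ (N - i) G ξ‖) * c ^ Q := by
        rw [norm_smul, Real.norm_of_nonneg hc.le, mul_pow, pow_add]; ring
    _ ≤ _ := by gcongr

/-- For `c ≥ 1` the chain rule costs at most `c^N`. The gain comes from the decay of `A`, since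
`‖ξ‖^(K+Q) = c^(-(K+Q)) ‖c ξ‖^(K+Q)`; the factors `‖ξ‖^Q` are supplied by the flatness of `G`. -/
theorem seminorm_dilate_mul_le_of_one_le {A : 𝓢(E n, ℂ)} {K N Q : ℕ} {CA CG : ℝ}
    (hCA : ∀ i ≤ N, SchwartzMap.seminorm ℂ (K + Q) i A ≤ CA) {G H : 𝓢(E n, ℂ)}
    (hCG : ∀ i ≤ N, ∀ ξ, ‖iteratedFDeriv ℝ i G ξ‖ ≤ CG * ‖ξ‖ ^ Q) {c : ℝ}
    (hc1 : 1 ≤ c) (hH : ∀ ξ, H ξ = A (c • ξ) * G ξ) (hCG0 : 0 ≤ CG) :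
    SchwartzMap.seminorm ℂ K N H ≤ 2 ^ N * CA * CG * (c ^ N * (c ^ Q)⁻¹) := by
  have hc : 0 < c := by linarith
  have hCA0 : 0 ≤ CA := (apply_nonneg _ _).trans (hCA 0 (Nat.zero_le _))
  refine SchwartzMap.seminorm_le_bound ℂ K N H (by positivity) fun ξ => ?_
  refine (mul_le_mul_of_nonneg_left (norm_iteratedFDeriv_dilate_mul_le (A.smooth ⊤) hc hH N ξ)
    (by positivity)).trans ?_
  have h2N : (2 : ℝ) ^ N = ∑ i ∈ Finset.range (N + 1), (N.choose i : ℝ) := by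
    exact_mod_cast (Nat.sum_range_choose N).symm
  rw [Finset.mul_sum, h2N, Finset.sum_mul, Finset.sum_mul, Finset.sum_mul]
  refine Finset.sum_le_sum fun i hi => ?_
  have hi' : i ≤ N := Nat.lt_succ_iff.1 (Finset.mem_range.1 hi)
  have h1 := (SchwartzMap.le_seminorm ℂ (K + Q) i A (c • ξ)).trans (hCA i hi')
  have h2 := hCG (N - i) (Nat.sub_le _ _) ξ
  have h3 : c ^ i ≤ c ^ N := pow_le_pow_right₀ hc1 hi'
  have h4 : 1 ≤ c ^ K := one_le_pow₀ hc1
  calc ‖ξ‖ ^ K * ((N.choose i : ℝ) * (c ^ i * ‖iteratedFDeriv ℝ i A (c • ξ)‖) *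
        ‖iteratedFDeriv ℝ (N - i) G ξ‖)
      ≤ ‖ξ‖ ^ K * ((N.choose i : ℝ) * (c ^ N * ‖iteratedFDeriv ℝ i A (c • ξ)‖) *
        (CG * ‖ξ‖ ^ Q)) := by gcongr
    _ = (N.choose i : ℝ) * (1 * (‖ξ‖ ^ (K + Q) * ‖iteratedFDeriv ℝ i A (c • ξ)‖)) * CG * c ^ N := by
        rw [pow_add]; ring
    _ ≤ (N.choose i : ℝ) * (c ^ K * (‖ξ‖ ^ (K + Q) * ‖iteratedFDeriv ℝ i A (c • ξ)‖)) * CG *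
        c ^ N := by gcongr
    _ = (N.choose i : ℝ) * (‖c • ξ‖ ^ (K + Q) * ‖iteratedFDeriv ℝ i A (c • ξ)‖) * CG *
        (c ^ N * (c ^ Q)⁻¹) := by
        rw [norm_smul, Real.norm_of_nonneg hc.le, mul_pow, pow_add c]
        field_simp
    _ ≤ _ := by gcongr

/-- Multiplication by `A (c ξ)` with `A` flat at the origin is small as `c → 0`. -/
theorem exists_gauge_dilate_mul_of_le_one (s : Finset (ℕ × ℕ)) {A : E n → ℂ} (hA : ContDiff ℝ ∞ A)
    (hb : ∀ j, ∃ C, ∀ η, ‖iteratedFDeriv ℝ j A η‖ ≤ C) (hv : ∀ P, VanishesAtZero P A) (Q : ℕ) :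
    ∃ q : 𝓢(E n, ℂ) → ℝ, IsGauge q ∧ ∀ G H : 𝓢(E n, ℂ), ∀ c : ℝ, 0 < c → c ≤ 1 →
      (∀ ξ, H ξ = A (c • ξ) * G ξ) → s.sup (schwartzSeminormFamily ℂ (E n) ℂ) H ≤ q G * c ^ Q := by
  choose C hC using hb
  have hC0 : ∀ j, 0 ≤ C j := fun j => (norm_nonneg _).trans (hC j 0)
  let D : ℕ × ℕ → ℝ := fun p => ∑ j ∈ Finset.range (p.2 + Q + 1), C j
  have hD : ∀ p, ∀ i ≤ p.2, ∀ η, ‖iteratedFDeriv ℝ i A η‖ ≤ D p * ‖η‖ ^ Q := by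
    intro p i hi η
    rcases Q with _ | Q
    · simp only [pow_zero, mul_one]
      exact (hC i η).trans (Finset.single_le_sum (f := C) (fun j _ => hC0 j)
        (Finset.mem_range.2 (by omega)))
    · refine (hv (p.2 + Q)).norm_le hA (fun j hj ξ => ?_) _ i (by omega) η
      exact (hC j ξ).trans (Finset.single_le_sum (f := C) (fun j _ => hC0 j)
        (Finset.mem_range.2 (by omega)))
  have hD0 : ∀ p, 0 ≤ D p := fun p => Finset.sum_nonneg fun j _ => hC0 j
  let r : ℕ × ℕ → 𝓢(E n, ℂ) → ℝ := fun p G => ∑ i ∈ Finset.range (p.2 + 1),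
    (p.2.choose i : ℝ) * D p * SchwartzMap.seminorm ℂ (p.1 + Q) (p.2 - i) G
  have hr : ∀ p, IsGauge (r p) := fun p => IsGauge.sum fun i _ =>
    (IsGauge.seminorm _ _).const_mul (mul_nonneg (by positivity) (hD0 p))
  refine ⟨fun G => ∑ p ∈ s, r p G, IsGauge.sum fun p _ => hr p, fun G H c hc hc1 hH => ?_⟩
  refine Seminorm.finset_sup_apply_le (mul_nonneg (Finset.sum_nonneg fun p _ => (hr p).nonneg G)
    (by positivity)) fun p hp => ?_
  refine (seminorm_dilate_mul_le_of_le_one hA (hD p) hc hc1 hH (hD0 p)).trans ?_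
  gcongr
  exact Finset.single_le_sum (f := fun p => r p G) (fun p _ => (hr p).nonneg G) hp

/-- Multiplication by `A (c ξ)` of a function flat at the origin is small as `c → ∞`. -/
theorem exists_gauge_dilate_mul_of_one_le (s : Finset (ℕ × ℕ)) (Q : ℕ) :
    ∃ P : ℕ, ∀ A : 𝓢(E n, ℂ), ∃ q : 𝓢(E n, ℂ) → ℝ, IsGauge q ∧ ∀ G H : 𝓢(E n, ℂ), VanishesAtZero P G →
      ∀ c : ℝ, 1 ≤ c → (∀ ξ, H ξ = A (c • ξ) * G ξ) →
      s.sup (schwartzSeminormFamily ℂ (E n) ℂ) H ≤ q G * (c ^ Q)⁻¹ := by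
  let m := s.sup Prod.snd
  -- Up to `m` derivatives of `G` have to be bounded by `‖ξ‖^(m+Q)`. The extra power `m` pays for
  -- the loss `c^N`, `N ≤ m`, in the chain rule.
  let P := m + (m + Q)
  refine ⟨P, fun A => ?_⟩
  let D : ℕ × ℕ → ℝ := fun p => ∑ i ∈ Finset.range (p.2 + 1),
    SchwartzMap.seminorm ℂ (p.1 + (m + Q)) i A
  have hD0 : ∀ p, 0 ≤ D p := fun p => Finset.sum_nonneg fun j _ => apply_nonneg _ _
  let r : 𝓢(E n, ℂ) → ℝ := fun G => ∑ j ∈ Finset.range (P + 2), SchwartzMap.seminorm ℂ 0 j G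
  have hr : IsGauge r := IsGauge.sum fun i _ => IsGauge.seminorm _ _
  refine ⟨fun G => ∑ p ∈ s, (2 ^ p.2 * D p) * r G, IsGauge.sum fun p _ =>
    hr.const_mul (mul_nonneg (by positivity) (hD0 p)), fun G H hG c hc1 hH => ?_⟩
  have hc : 0 < c := by linarith
  have hterm : ∀ p, 0 ≤ (2 ^ p.2 * D p) * r G := fun p =>
    mul_nonneg (mul_nonneg (by positivity) (hD0 p)) (hr.nonneg G)
  refine Seminorm.finset_sup_apply_le (mul_nonneg (Finset.sum_nonneg fun p _ => hterm p)
    (by positivity)) fun p hp => ?_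
  have hpm : p.2 ≤ m := Finset.le_sup (f := Prod.snd) hp
  have h := seminorm_dilate_mul_le_of_one_le (K := p.1) (N := p.2) (Q := m + Q) (CA := D p)
    (CG := r G) (A := A) (fun i hi => Finset.single_le_sum
      (f := fun i => SchwartzMap.seminorm ℂ (p.1 + (m + Q)) i A) (fun j _ => apply_nonneg _ _)
      (Finset.mem_range.2 (by omega))) (G := G) (H := H) (fun i hi ξ => ?_) hc1 hH (hr.nonneg G)
  · refine h.trans ?_
    have e : c ^ p.2 * (c ^ (m + Q))⁻¹ ≤ (c ^ Q)⁻¹ := by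
      rw [pow_add, mul_inv, ← mul_assoc]
      refine mul_le_of_le_one_left (by positivity) ?_
      rw [← div_eq_mul_inv, div_le_one (by positivity)]
      exact pow_le_pow_right₀ hc1 hpm
    have hle : (2 ^ p.2 * D p) * r G ≤ ∑ p ∈ s, (2 ^ p.2 * D p) * r G :=
      Finset.single_le_sum (f := fun p : ℕ × ℕ => (2 ^ p.2 * D p) * r G) (fun p _ => hterm p) hp
    exact mul_le_mul hle e (by positivity) (Finset.sum_nonneg fun p _ => hterm p)
  · refine hG.norm_le (G.smooth ⊤) (fun j hj ξ => ?_) _ i (by omega) ξ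
    exact (SchwartzMap.norm_iteratedFDeriv_le_seminorm ℂ G j ξ).trans (Finset.single_le_sum
      (f := fun j => SchwartzMap.seminorm ℂ 0 j G) (fun j _ => apply_nonneg _ _)
      (Finset.mem_range.2 (by omega)))

end Multipliers

/-! ### The `L¹` norm -/

/-- The `L¹` norm of a Schwartz function. -/
noncomputable def normL1 {V : Type*} [NormedAddCommGroup V] [NormedSpace ℝ V] [MeasureSpace V]
    (f : 𝓢(V, ℂ)) : ℝ := ∫ x, ‖f x‖

theorem normL1_nonneg {V : Type*} [NormedAddCommGroup V] [NormedSpace ℝ V] [MeasureSpace V]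
    (f : 𝓢(V, ℂ)) : 0 ≤ normL1 f := integral_nonneg fun _ => norm_nonneg _

theorem exists_normL1_le_seminorm (V : Type*) [NormedAddCommGroup V] [NormedSpace ℝ V]
    [MeasureSpace V] [(volume : Measure V).HasTemperateGrowth] :
    ∃ (C : ℝ) (r : ℕ), 0 ≤ C ∧ ∀ f : 𝓢(V, ℂ), normL1 f ≤
      C * (SchwartzMap.seminorm ℂ 0 0 f + SchwartzMap.seminorm ℂ r 0 f) := by
  refine ⟨2 ^ (volume : Measure V).integrablePower *
    (∫ x : V, (1 + ‖x‖) ^ (-((volume : Measure V).integrablePower : ℝ))),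
    0 + (volume : Measure V).integrablePower, ?_, fun f => ?_⟩
  rotate_left
  · have h := integral_pow_mul_iteratedFDeriv_le ℂ (volume : Measure V) f 0 0
    simp only [pow_zero, one_mul, norm_iteratedFDeriv_zero] at h
    exact h
  · exact mul_nonneg (by positivity) (integral_nonneg fun x => by positivity)

theorem exists_gauge_normL1_le (V : Type*) [NormedAddCommGroup V] [NormedSpace ℝ V]
    [MeasureSpace V] [(volume : Measure V).HasTemperateGrowth] :
    ∃ q : 𝓢(V, ℂ) → ℝ, IsGauge q ∧ ∀ f, normL1 f ≤ q f := by
  obtain ⟨C, r, hC, h⟩ := exists_normL1_le_seminorm V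
  exact ⟨_, ((IsGauge.seminorm 0 0).add (IsGauge.seminorm r 0)).const_mul hC, h⟩

/-- Passing to seminorms of the Fourier transform turns convolution with a dilate into
multiplication by a dilated symbol, where the bounds above apply. -/
theorem exists_normL1_le {n : ℕ} : ∃ (s : Finset (ℕ × ℕ)) (C : ℝ), 0 ≤ C ∧ ∀ f : 𝓢(E n, ℂ),
    normL1 f ≤ C * s.sup (schwartzSeminormFamily ℂ (E n) ℂ) (𝓕 f) := by
  obtain ⟨C, r, hC, h⟩ := exists_normL1_le_seminorm (E n)
  let L : 𝓢(E n, ℂ) →L[ℂ] 𝓢(E n, ℂ) := FourierTransform.fourierInvCLM ℂ 𝓢(E n, ℂ)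
  let p : Seminorm ℂ 𝓢(E n, ℂ) :=
    (SchwartzMap.seminorm ℂ 0 0 + SchwartzMap.seminorm ℂ r 0).comp L.toLinearMap
  have hp : Continuous p :=
    (((IsGauge.seminorm 0 0).add (IsGauge.seminorm r 0)).cont).comp L.continuous
  obtain ⟨s, D, -, hD⟩ := Seminorm.bound_of_continuous (schwartz_withSeminorms ℂ (E n) ℂ) p hp
  refine ⟨s, C * D, by positivity, fun f => (h f).trans ?_⟩
  rw [mul_assoc]
  refine mul_le_mul_of_nonneg_left ?_ hC
  have h1 := hD (𝓕 f)
  have h2 : L (𝓕 f) = f := by simp [L]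
  change SchwartzMap.seminorm ℂ 0 0 (L (𝓕 f)) + SchwartzMap.seminorm ℂ r 0 (L (𝓕 f)) ≤ _ at h1
  rw [h2] at h1
  exact h1

/-- If `g` has vanishing moments, `w_k * g` is small as `k → -∞`. -/
theorem exists_gauge_normL1_cv_of_nonpos (n Q : ℕ) :
    ∃ P : ℕ, ∀ w : 𝓢(E n, ℂ), ∃ q : 𝓢(E n, ℂ) → ℝ, IsGauge q ∧
      ∀ g : 𝓢(E n, ℂ), InSP P g → ∀ k : ℤ, k ≤ 0 → normL1 (cv (dyadic k w) g) ≤ q g * (2 : ℝ) ^ (Q * k) := by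
  obtain ⟨s, C, hC0, hC⟩ := exists_normL1_le (n := n)
  obtain ⟨P, hP⟩ := exists_gauge_dilate_mul_of_one_le (n := n) s Q
  refine ⟨P, fun w => ?_⟩
  obtain ⟨q, hq, h⟩ := hP (𝓕 w)
  refine ⟨fun g => C * q (𝓕 g), (hq.comp (L := fun g => 𝓕 g)
    (FourierTransform.fourierCLM ℂ 𝓢(E n, ℂ)).continuous
    (FourierTransform.fourierCLM ℂ 𝓢(E n, ℂ)).map_zero).const_mul hC0, fun g hg k hk => ?_⟩
  refine (hC _).trans ?_
  rw [mul_assoc]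
  refine mul_le_mul_of_nonneg_left ?_ hC0
  have := h (𝓕 g) (𝓕 (cv (dyadic k w) g)) hg.vanishesAtZero ((2 : ℝ) ^ (-k))
    (one_le_zpow₀ one_le_two (by omega)) (fun ξ => by rw [fourier_cv, fourier_dyadic])
  have e : (((2 : ℝ) ^ (-k)) ^ Q)⁻¹ = (2 : ℝ) ^ (Q * k) := by
    rw [← zpow_natCast, ← zpow_mul, ← zpow_neg]
    congr 1
    ring
  rwa [e] at this

/-- If all moments of `w` vanish, `w_k * g` is small as `k → ∞`. -/
theorem exists_gauge_normL1_cv_of_nonneg {n : ℕ} {w : 𝓢(E n, ℂ)} (hw : InSInf w) (Q : ℕ) :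
    ∃ q : 𝓢(E n, ℂ) → ℝ, IsGauge q ∧ ∀ g : 𝓢(E n, ℂ), ∀ k : ℤ, 0 ≤ k →
      normL1 (cv (dyadic k w) g) ≤ q g * (2 : ℝ) ^ (-(Q * k)) := by
  obtain ⟨s, C, hC0, hC⟩ := exists_normL1_le (n := n)
  obtain ⟨q, hq, h⟩ := exists_gauge_dilate_mul_of_le_one s ((𝓕 w).smooth ⊤)
    (fun j => ⟨_, SchwartzMap.norm_iteratedFDeriv_le_seminorm ℂ (𝓕 w) j⟩)
    (fun P => (hw P).vanishesAtZero) Q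
  refine ⟨fun g => C * q (𝓕 g), (hq.comp (L := fun g => 𝓕 g)
    (FourierTransform.fourierCLM ℂ 𝓢(E n, ℂ)).continuous
    (FourierTransform.fourierCLM ℂ 𝓢(E n, ℂ)).map_zero).const_mul hC0, fun g k hk => ?_⟩
  refine (hC _).trans ?_
  rw [mul_assoc]
  refine mul_le_mul_of_nonneg_left ?_ hC0
  have := h (𝓕 g) (𝓕 (cv (dyadic k w) g)) ((2 : ℝ) ^ (-k)) (by positivity)
    (zpow_le_one_of_nonpos₀ one_le_two (by omega)) (fun ξ => by rw [fourier_cv, fourier_dyadic])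
  have e : ((2 : ℝ) ^ (-k)) ^ Q = (2 : ℝ) ^ (-(Q * k)) := by
    rw [← zpow_natCast, ← zpow_mul]
    congr 1
    ring
  rwa [e] at this

/-- The two-sided bound for `w_k * g`. -/
theorem exists_gauge_normL1_cv (n Q : ℕ) :
    ∃ P : ℕ, ∀ w : 𝓢(E n, ℂ), InSInf w → ∃ q : 𝓢(E n, ℂ) → ℝ, IsGauge q ∧
      ∀ g : 𝓢(E n, ℂ), InSP P g → ∀ k : ℤ, normL1 (cv (dyadic k w) g) ≤ q g * (2 : ℝ) ^ (-(Q * |k|)) := by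
  obtain ⟨P, hP⟩ := exists_gauge_normL1_cv_of_nonpos n Q
  refine ⟨P, fun w hw => ?_⟩
  obtain ⟨q, hq, h⟩ := hP w
  obtain ⟨q', hq', h'⟩ := exists_gauge_normL1_cv_of_nonneg hw Q
  refine ⟨fun g => q g + q' g, hq.add hq', fun g hg k => ?_⟩
  have h2 : (0 : ℝ) < (2 : ℝ) ^ (-(Q * |k|)) := by positivity
  rw [add_mul]
  rcases le_total k 0 with hk | hk
  · have := h g hg k hk
    rw [abs_of_nonpos hk, mul_neg, neg_neg] at *
    have := mul_nonneg (hq'.nonneg g) h2.le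
    linarith
  · have := h' g k hk
    rw [abs_of_nonneg hk] at *
    have := mul_nonneg (hq.nonneg g) h2.le
    linarith

variable {n : ℕ}

/-! ### Functions with Fourier transform supported off the origin -/

/-- Only the fact that the constant is nonzero matters, so its value is not recorded. -/
theorem derivS_fourier (β : Fin n → ℕ) (f : 𝓢(E n, ℂ)) :
    ∃ c : ℂ, c ≠ 0 ∧ derivS β (𝓕 f) = c • 𝓕 (monoMul β f) := by
  have hc : -(2 * Real.pi * Complex.I) ≠ (0 : ℂ) := by
    simp [Complex.I_ne_zero, Real.pi_ne_zero]
  have step : ∀ (i : Fin n) (m : ℕ) (c : ℂ) (g : 𝓢(E n, ℂ)),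
      (fun g : 𝓢(E n, ℂ) => ∂_{coordVec i} g)^[m] (c • 𝓕 g) =
        ((-(2 * Real.pi * Complex.I)) ^ m * c) • 𝓕 (monoMul (Pi.single i m) g) := by
    intro i m
    induction m with
    | zero =>
      intro c g
      have : monoMul (Pi.single i 0) g = g := by
        ext x; rw [monoMul_apply, Pi.single_zero, mono_zero, one_mul]
      rw [this]; simp
    | succ m ih =>
      intro c g
      rw [Function.iterate_succ_apply, lineDerivOp_smul, lineDeriv_fourier, smul_smul, ih]
      congr 1
      · ring
      · congr 1
        ext x
        rw [monoMul_apply, monoMul_apply, monoMul_apply, ← mul_assoc, ← mono_add_index,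
          ← Pi.single_add]
  have key : ∀ l : List (Fin n), ∃ c : ℂ, c ≠ 0 ∧
      l.foldr (fun i F => (fun g : 𝓢(E n, ℂ) => ∂_{coordVec i} g)^[β i] F) (𝓕 f) =
        c • 𝓕 (monoMul ((l.map fun i => (Pi.single i (β i) : Fin n → ℕ)).sum) f) := by
    intro l
    induction l with
    | nil =>
      refine ⟨1, one_ne_zero, ?_⟩
      have : monoMul 0 f = f := by ext x; rw [monoMul_apply, mono_zero, one_mul]
      simp [this]
    | cons i l ih =>
      obtain ⟨c, hc0, h⟩ := ih
      refine ⟨_, mul_ne_zero (pow_ne_zero (β i) hc) hc0, ?_⟩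
      rw [List.foldr_cons, h, step]
      congr 2
      ext x
      rw [monoMul_apply, monoMul_apply, monoMul_apply, ← mul_assoc, ← mono_add_index,
        List.map_cons, List.sum_cons]
  obtain ⟨c, hc0, h⟩ := key (List.finRange n)
  have e3 : ((List.finRange n).map fun i => (Pi.single i (β i) : Fin n → ℕ)).sum = β := by
    rw [← List.ofFn_eq_map, List.sum_ofFn]
    exact Finset.univ_sum_single β
  rw [e3] at h
  exact ⟨c, hc0, h⟩

theorem tsupport_derivS_subset (β : Fin n → ℕ) (f : 𝓢(E n, ℂ)) :
    tsupport (derivS β f) ⊆ tsupport f := by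
  have step : ∀ (i : Fin n) (m : ℕ) (g : 𝓢(E n, ℂ)),
      tsupport ((fun g : 𝓢(E n, ℂ) => ∂_{coordVec i} g)^[m] g) ⊆ tsupport g := by
    intro i m
    induction m with
    | zero => intro g; rfl
    | succ m ih =>
      intro g
      rw [Function.iterate_succ_apply]
      exact (ih _).trans (tsupport_lineDerivOp_subset _ _)
  unfold derivS
  induction List.finRange n with
  | nil => rfl
  | cons i l ih => exact (step _ _ _).trans ih

/-- The moments of `f` are, up to nonzero constants, the derivatives of `𝓕 f` at the origin. -/
theorem inSInf_of_fourier_support {f : 𝓢(E n, ℂ)} (h : (0 : E n) ∉ tsupport (𝓕 f : 𝓢(E n, ℂ))) :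
    InSInf f := by
  intro P β _
  obtain ⟨c, hc, hβ⟩ := derivS_fourier β f
  have h0 : derivS β (𝓕 f) 0 = 0 :=
    image_eq_zero_of_notMem_tsupport fun hmem => h (tsupport_derivS_subset β _ hmem)
  rw [hβ, FunLike.coe_smul, Pi.smul_apply, fourier_apply_zero, smul_eq_mul, mul_eq_zero] at h0
  have := h0.resolve_left hc
  simpa only [monoMul_apply] using this

/-- The transform of `x_i f` is a multiple of the derivative of a function constant near `0`, so it
vanishes near `0` and all moments of `x_i f` are zero. -/
theorem moment_of_fourier_eq_one {f : 𝓢(E n, ℂ)} (h : ∀ᶠ ξ in 𝓝 (0 : E n), 𝓕 f ξ = 1)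
    (γ : Fin n → ℕ) : moment γ f = if γ = 0 then 1 else 0 := by
  split_ifs with h0
  · subst h0
    have := h.self_of_nhds
    rw [fourier_apply_zero] at this
    simpa [moment, mono_zero] using this
  · obtain ⟨i, hi⟩ : ∃ i, γ i ≠ 0 := by
      by_contra hcon
      exact h0 (funext fun i => not_not.1 fun hi => hcon ⟨i, hi⟩)
    have hs : InSInf (monoMul (Pi.single i 1) f) := by
      refine inSInf_of_fourier_support ?_
      have hz : ∀ᶠ ξ in 𝓝 (0 : E n), 𝓕 (monoMul (Pi.single i 1) f) ξ = 0 := by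
        have h2 : ∀ᶠ ξ in 𝓝 (0 : E n), (∂_{coordVec i} (𝓕 f) : 𝓢(E n, ℂ)) ξ = 0 := by
          filter_upwards [h.eventually_nhds] with ξ hξ
          rw [lineDerivOp_apply_eq_fderiv]
          have : (𝓕 f : 𝓢(E n, ℂ)) =ᶠ[𝓝 ξ] fun _ => (1 : ℂ) := hξ
          rw [this.fderiv_eq]
          simp
        filter_upwards [h2] with ξ hξ
        rw [lineDeriv_fourier, FunLike.coe_smul, Pi.smul_apply, smul_eq_mul, mul_eq_zero] at hξ
        refine hξ.resolve_left ?_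
        simp [Complex.I_ne_zero, Real.pi_ne_zero]
      rw [notMem_tsupport_iff_eventuallyEq]
      exact hz
    have e : (γ - Pi.single i 1) + Pi.single i 1 = γ := by
      refine tsub_add_cancel_of_le fun j => ?_
      rcases eq_or_ne j i with rfl | hj
      · rw [Pi.single_eq_same]; exact Nat.one_le_iff_ne_zero.2 hi
      · simp [hj]
    rw [← e, ← moment_monoMul]
    exact hs _ _ le_rfl

/-- The quotient is smooth on the support of `g`, where `h` does not vanish, and it is locally zero
elsewhere, whatever `h` does there. -/
theorem exists_schwartz_div (g : 𝓢(E n, ℂ)) (hg : HasCompactSupport g) {h : E n → ℂ}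
    (hh : ContDiff ℝ ∞ h) (hne : ∀ ξ ∈ tsupport g, h ξ ≠ 0) :
    ∃ q : 𝓢(E n, ℂ), (∀ ξ, q ξ = g ξ / h ξ) ∧ HasCompactSupport q ∧ tsupport q ⊆ tsupport g := by
  have hsupp : Function.support (fun ξ => g ξ / h ξ) ⊆ Function.support g := fun ξ hξ h0 =>
    hξ (by simp only [h0, zero_div])
  have hc : HasCompactSupport (fun ξ => g ξ / h ξ) := hg.mono hsupp
  have hs : ContDiff ℝ ∞ (fun ξ => g ξ / h ξ) := by
    refine contDiff_iff_contDiffAt.2 fun ξ => ?_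
    by_cases hξ : ξ ∈ tsupport g
    · simp only [div_eq_mul_inv]
      exact (g.smooth ⊤).contDiffAt.mul (hh.contDiffAt.inv (hne ξ hξ))
    · have : (fun ξ => g ξ / h ξ) =ᶠ[𝓝 ξ] fun _ => 0 := by
        filter_upwards [notMem_tsupport_iff_eventuallyEq.1 hξ] with ζ hζ
        simp [hζ]
      exact contDiffAt_const.congr_of_eventuallyEq this
  refine ⟨hc.toSchwartzMap hs, fun ξ => rfl, hc, closure_mono hsupp⟩

/-! ### The dyadic partition of unity -/

/-- A smooth radial cutoff. -/
noncomputable def lowCutoffBump (n : ℕ) : ContDiffBump (0 : E n) := ⟨5 / 4, 8 / 5, by norm_num, by norm_num⟩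

/-- A smooth even cutoff: `1` on `|ξ| ≤ 5/4` and `0` for `|ξ| ≥ 8/5`. -/
noncomputable def lowCutoff (n : ℕ) : 𝓢(E n, ℂ) :=
  HasCompactSupport.toSchwartzMap (f := fun ξ => ((lowCutoffBump n ξ : ℝ) : ℂ))
    ((lowCutoffBump n).hasCompactSupport.comp_left (g := fun r : ℝ => (r : ℂ)) (by simp))
    (Complex.ofRealCLM.contDiff.comp (lowCutoffBump n).contDiff)

theorem lowCutoff_apply (ξ : E n) : lowCutoff n ξ = ((lowCutoffBump n ξ : ℝ) : ℂ) := rfl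

theorem lowCutoff_eq_one {ξ : E n} (h : ‖ξ‖ ≤ 5 / 4) : lowCutoff n ξ = 1 := by
  rw [lowCutoff_apply, ContDiffBump.one_of_mem_closedBall]
  · simp
  · simpa [lowCutoffBump] using h

theorem lowCutoff_eq_zero {ξ : E n} (h : 8 / 5 ≤ ‖ξ‖) : lowCutoff n ξ = 0 := by
  rw [lowCutoff_apply, ContDiffBump.zero_of_le_dist]
  · simp
  · simpa [lowCutoffBump] using h

theorem lowCutoff_neg (ξ : E n) : lowCutoff n (-ξ) = lowCutoff n ξ := by
  rw [lowCutoff_apply, lowCutoff_apply, ContDiffBump.neg]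

/-- The generator of the dyadic partition of unity. -/
noncomputable def annulusBump (n : ℕ) : 𝓢(E n, ℂ) := lowCutoff n - scale 2 (lowCutoff n)

theorem annulusBump_apply (ξ : E n) :
    annulusBump n ξ = lowCutoff n ξ - lowCutoff n ((2 : ℝ) • ξ) := by
  rw [annulusBump, FunLike.coe_sub, Pi.sub_apply, scale_apply two_ne_zero]

theorem annulusBump_neg (ξ : E n) : annulusBump n (-ξ) = annulusBump n ξ := by
  rw [annulusBump_apply, annulusBump_apply, smul_neg, lowCutoff_neg, lowCutoff_neg]

theorem tsupport_annulusBump :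
    tsupport (annulusBump n) ⊆ {ξ | 5 / 8 ≤ ‖ξ‖ ∧ ‖ξ‖ ≤ 8 / 5} := by
  refine closure_minimal (fun ξ hξ => ?_)
    ((isClosed_le continuous_const continuous_norm).inter
      (isClosed_le continuous_norm continuous_const))
  by_contra hcon
  refine hξ ?_
  rw [annulusBump_apply]
  have h2 : ‖(2 : ℝ) • ξ‖ = 2 * ‖ξ‖ := by rw [norm_smul]; simp
  by_cases h : 5 / 8 ≤ ‖ξ‖
  · have h' : 8 / 5 ≤ ‖ξ‖ := by
      by_contra h'
      exact hcon ⟨h, (not_le.1 h').le⟩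
    rw [lowCutoff_eq_zero h', lowCutoff_eq_zero (by rw [h2]; linarith), sub_zero]
  · rw [not_le] at h
    rw [lowCutoff_eq_one (by linarith), lowCutoff_eq_one (by rw [h2]; linarith), sub_self]

theorem hasCompactSupport_annulusBump : HasCompactSupport (annulusBump n) :=
  HasCompactSupport.of_support_subset_isCompact (isCompact_closedBall (0 : E n) (8 / 5))
    fun ξ hξ => by simpa using (tsupport_annulusBump (subset_tsupport _ hξ)).2

/-- The pair `a, a'` resolves the identity: `∑_k a_k * a'_k * f = f`. -/
structure Resolves (a a' : 𝓢(E n, ℂ)) : Prop where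
  mul_fourier : ∀ ξ, 𝓕 a ξ * 𝓕 a' ξ = annulusBump n ξ
  compact : HasCompactSupport (𝓕 a' : 𝓢(E n, ℂ))
  support : tsupport (𝓕 a' : 𝓢(E n, ℂ)) ⊆ {ξ | 5 / 8 ≤ ‖ξ‖ ∧ ‖ξ‖ ≤ 8 / 5}

theorem Resolves.inSInf {a a' : 𝓢(E n, ℂ)} (h : Resolves a a') : InSInf a' :=
  inSInf_of_fourier_support fun h0 => by
    have := (h.support h0).1
    rw [norm_zero] at this
    linarith

/-- The partner is the inverse transform of `annulusBump` divided by `𝓕 a`. -/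
theorem exists_resolves (a : 𝓢(E n, ℂ))
    (ha : ∀ ξ : E n, 5 / 8 ≤ ‖ξ‖ → ‖ξ‖ ≤ 8 / 5 → 𝓕 a ξ ≠ 0) : ∃ a', Resolves a a' := by
  obtain ⟨q, hq, hqc, hqs⟩ := exists_schwartz_div (annulusBump n) hasCompactSupport_annulusBump
    ((𝓕 a).smooth ⊤) fun ξ hξ => ha ξ (tsupport_annulusBump hξ).1 (tsupport_annulusBump hξ).2
  have e : 𝓕 (𝓕⁻ q : 𝓢(E n, ℂ)) = q := FourierTransform.fourier_fourierInv_eq q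
  refine ⟨𝓕⁻ q, fun ξ => ?_, by rw [e]; exact hqc, by rw [e]; exact hqs.trans tsupport_annulusBump⟩
  rw [e, hq]
  by_cases hξ : ξ ∈ tsupport (annulusBump n)
  · rw [mul_div_cancel₀]
    exact ha ξ (tsupport_annulusBump hξ).1 (tsupport_annulusBump hξ).2
  · rw [image_eq_zero_of_notMem_tsupport hξ]; simp

/-- The cutoff radii `5/4` and `8/5` were chosen so that the annulus `5/8 ≤ ‖ξ‖ ≤ 8/5` lies inside
`3/5 < ‖ξ‖ < 5/3`, where the transform of `χ` is bounded below. -/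
theorem IsLittlewoodPaley.exists_resolves {χ : 𝓢(E n, ℂ)} (hχ : IsLittlewoodPaley χ) :
    ∃ χ', Resolves χ χ' := by
  obtain ⟨-, -, c, hc, h⟩ := hχ
  refine SingInt.exists_resolves χ fun ξ h1 h2 h0 => ?_
  have := (h ξ (by linarith) (by linarith)).2
  rw [h0, Complex.zero_re] at this
  linarith

/-- A function in `𝓢_∞` with Fourier support in an annulus is a sum of high order derivatives. -/
theorem Resolves.exists_primitive {a a' : 𝓢(E n, ℂ)} (h : Resolves a a') (N : ℕ) :
    ∃ Θ : Fin n → 𝓢(E n, ℂ),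
      a' = ∑ i, (fun g : 𝓢(E n, ℂ) => ∂_{coordVec i} g)^[N] (Θ i) := by
  -- On the Fourier side `𝓕 a' = ∑_i ξ_i^N (ξ_i^N 𝓕 a' / D)`. The outer factor `ξ_i^N` is a multiple
  -- of the multiplier of the `N`-th derivative in direction `i`, and `D` vanishes only at the
  -- origin.
  let D : E n → ℂ := fun ξ => ∑ i, ((ξ i : ℝ) : ℂ) ^ (2 * N)
  have hcoord : ∀ i : Fin n, ContDiff ℝ ∞ (fun ξ : E n => ((ξ i : ℝ) : ℂ)) := fun i =>
    (Complex.ofRealCLM.comp (EuclideanSpace.proj (𝕜 := ℝ) i)).contDiff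
  have hD : ContDiff ℝ ∞ D := ContDiff.sum fun i _ => (hcoord i).pow _
  have hD0 : ∀ ξ : E n, 5 / 8 ≤ ‖ξ‖ → D ξ ≠ 0 := by
    intro ξ hξ h0
    have h1 : D ξ = ((∑ i, (ξ i ^ 2) ^ N : ℝ) : ℂ) := by
      simp only [D]; push_cast; simp only [pow_mul]
    rw [h1, Complex.ofReal_eq_zero, Finset.sum_eq_zero_iff_of_nonneg fun i _ => by positivity] at h0
    have : ξ = 0 := by
      ext i
      have := h0 i (Finset.mem_univ i)
      simp only [pow_eq_zero_iff', ne_eq, OfNat.ofNat_ne_zero, not_false_eq_true, and_true] at this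
      exact this.1
    rw [this, norm_zero] at hξ
    linarith
  obtain ⟨q, hq, -, -⟩ := exists_schwartz_div (𝓕 a') h.compact hD
    fun ξ hξ => hD0 ξ (h.support hξ).1
  let c : ℂ := ((2 * Real.pi * Complex.I) ^ N)⁻¹
  have hI : (2 * Real.pi * Complex.I) ^ N ≠ 0 :=
    pow_ne_zero _ (by simp [Complex.I_ne_zero, Real.pi_ne_zero])
  have hit : ∀ (i : Fin n) (m : ℕ) (g : 𝓢(E n, ℂ)) (ξ : E n),
      𝓕 ((fun g : 𝓢(E n, ℂ) => ∂_{coordVec i} g)^[m] g) ξ =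
        ((2 * Real.pi * Complex.I) * ((ξ i : ℝ) : ℂ)) ^ m * 𝓕 g ξ := by
    intro i m g ξ
    induction m generalizing g with
    | zero => simp
    | succ m ih => rw [Function.iterate_succ_apply, ih, fourier_lineDeriv_apply]; ring
  refine ⟨fun i => 𝓕⁻ (c • monoMul (Pi.single i N) q), ext_fourier fun ξ => ?_⟩
  have hsum : 𝓕 (∑ i, (fun g : 𝓢(E n, ℂ) => ∂_{coordVec i} g)^[N]
      (𝓕⁻ (c • monoMul (Pi.single i N) q) : 𝓢(E n, ℂ))) ξ =
      ∑ i, 𝓕 ((fun g : 𝓢(E n, ℂ) => ∂_{coordVec i} g)^[N]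
        (𝓕⁻ (c • monoMul (Pi.single i N) q) : 𝓢(E n, ℂ))) ξ := by
    have := congrArg (fun f : 𝓢(E n, ℂ) => f ξ)
      (map_sum (FourierTransform.fourierCLM ℂ 𝓢(E n, ℂ)) (fun i =>
        (fun g : 𝓢(E n, ℂ) => ∂_{coordVec i} g)^[N]
          (𝓕⁻ (c • monoMul (Pi.single i N) q) : 𝓢(E n, ℂ))) Finset.univ)
    simp only [FunLike.coe_sum, Finset.sum_apply] at this
    exact this
  rw [hsum]
  have hmono : ∀ i, mono (Pi.single i N) ξ = ((ξ i : ℝ) : ℂ) ^ N := by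
    intro i
    unfold mono
    rw [Finset.prod_eq_single i] <;> simp +contextual
  have hterm : ∀ i, 𝓕 ((fun g : 𝓢(E n, ℂ) => ∂_{coordVec i} g)^[N]
        (𝓕⁻ (c • monoMul (Pi.single i N) q) : 𝓢(E n, ℂ))) ξ = ((ξ i : ℝ) : ℂ) ^ (2 * N) * q ξ := by
    intro i
    rw [hit, FourierTransform.fourier_fourierInv_eq, FunLike.coe_smul, Pi.smul_apply,
      monoMul_apply, hmono, mul_pow, smul_eq_mul]
    simp only [c]
    rw [pow_mul' _ 2 N, sq]
    field_simp
  simp only [hterm, ← Finset.sum_mul]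
  change 𝓕 a' ξ = D ξ * q ξ
  rw [hq]
  by_cases hξ : ξ ∈ tsupport (𝓕 a' : 𝓢(E n, ℂ))
  · rw [mul_div_cancel₀]
    exact hD0 ξ (h.support hξ).1
  · rw [image_eq_zero_of_notMem_tsupport hξ]; simp

/-! ### The analysing function -/

/-- A nonnegative bump of integral `1` near the origin has Fourier transform without small zeros. -/
theorem exists_compactSupport_fourier_ne_zero :
    ∃ θ : 𝓢(E n, ℂ), HasCompactSupport θ ∧ ∀ ξ : E n, ‖ξ‖ ≤ 2 → 𝓕 θ ξ ≠ 0 := by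
  -- With this radius, `‖x‖ < r` and `‖ξ‖ ≤ 2` give `|exp(-2πi x·ξ) - 1| ≤ 2π · 2r = 1/2`. A zero of
  -- the transform would then force `∫ B ≤ (1/2) ∫ B`.
  let r : ℝ := (8 * Real.pi)⁻¹
  have hr : 0 < r := by positivity
  let B : ContDiffBump (0 : E n) := ⟨r / 2, r, by positivity, by linarith⟩
  let θ : 𝓢(E n, ℂ) := HasCompactSupport.toSchwartzMap (f := fun ξ => ((B ξ : ℝ) : ℂ))
    (B.hasCompactSupport.comp_left (g := fun r : ℝ => (r : ℂ)) (by simp))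
    (Complex.ofRealCLM.contDiff.comp B.contDiff)
  refine ⟨θ, B.hasCompactSupport.comp_left (g := fun r : ℝ => (r : ℂ)) (by simp), fun ξ hξ h0 => ?_⟩
  have hθ : ∀ x, θ x = ((B x : ℝ) : ℂ) := fun x => rfl
  have hI : 0 < ∫ x, B x := B.integral_pos
  have h1 : ∫ x, θ x = ((∫ x, B x : ℝ) : ℂ) := by
    simp only [hθ]; exact integral_ofReal
  rw [fourier_coe, Real.fourier_eq] at h0
  have hint : Integrable (fun x => Real.fourierChar (-inner ℝ x ξ) • θ x) :=
    (Real.fourierIntegral_convergent_iff ξ).2 θ.integrable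
  have h2 : ‖∫ x, θ x‖ ≤ ∫ x, (1 / 2) * B x := by
    rw [← sub_zero (∫ x, θ x), ← h0, ← integral_sub θ.integrable hint]
    refine (norm_integral_le_integral_norm _).trans ?_
    refine integral_mono (θ.integrable.sub hint).norm (B.integrable.const_mul _) fun x => ?_
    by_cases hx : ‖x‖ < r
    · have e : θ x - Real.fourierChar (-inner ℝ x ξ) • θ x =
          -((Real.fourierChar (-inner ℝ x ξ) : ℂ) - 1) * ((B x : ℝ) : ℂ) := by
        rw [hθ, Circle.smul_def, smul_eq_mul]; ring
      simp only [e, norm_mul, norm_neg, Complex.norm_real, Real.norm_of_nonneg B.nonneg]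
      refine mul_le_mul_of_nonneg_right ?_ B.nonneg
      rw [Real.fourierChar_apply]
      have h3 : ((2 * Real.pi * -inner ℝ x ξ : ℝ) : ℂ) * Complex.I =
        Complex.I * ((2 * Real.pi * -inner ℝ x ξ : ℝ) : ℂ) := mul_comm _ _
      rw [h3]
      refine (Real.norm_exp_I_mul_ofReal_sub_one_le).trans ?_
      rw [norm_mul, norm_mul, norm_neg, Real.norm_of_nonneg Real.pi_pos.le]
      have h4 : ‖inner ℝ x ξ‖ ≤ r * 2 := (norm_inner_le_norm x ξ).trans (by gcongr)
      calc ‖(2 : ℝ)‖ * Real.pi * ‖inner ℝ x ξ‖ ≤ 2 * Real.pi * (r * 2) := by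
            rw [Real.norm_of_nonneg two_pos.le]; gcongr
        _ = 1 / 2 := by simp only [r]; field_simp; norm_num
    · have : B x = 0 := B.zero_of_le_dist (by simpa using not_lt.1 hx)
      simp [hθ, this]
  rw [h1, integral_const_mul, Complex.norm_real, Real.norm_of_nonneg hI.le] at h2
  linarith

/-- The Laplacian keeps compact support, adds vanishing moments and multiplies the Fourier transform
by a constant times `‖ξ‖²`, which has no zero on the annulus. It is applied `L + 1` times to a bump
whose transform has no zeros for `‖ξ‖ ≤ 2`. -/
theorem exists_analysing_function (L : ℕ) :
    ∃ ψ : 𝓢(E n, ℂ), InDP L ψ ∧ ∀ ξ : E n, 5 / 8 ≤ ‖ξ‖ → ‖ξ‖ ≤ 8 / 5 → 𝓕 ψ ξ ≠ 0 := by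
  have hlap : ∀ (f : 𝓢(E n, ℂ)) (ξ : E n),
      𝓕 (∑ i : Fin n, ∂_{coordVec i} (∂_{coordVec i} f) : 𝓢(E n, ℂ)) ξ =
        (2 * Real.pi * Complex.I) ^ 2 * ((‖ξ‖ ^ 2 : ℝ) : ℂ) * 𝓕 f ξ := by
    intro f ξ
    have := congrArg (fun f : 𝓢(E n, ℂ) => f ξ)
      (map_sum (FourierTransform.fourierCLM ℂ 𝓢(E n, ℂ)) (fun i : Fin n =>
        (∂_{coordVec i} (∂_{coordVec i} f) : 𝓢(E n, ℂ))) Finset.univ)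
    simp only [FunLike.coe_sum, Finset.sum_apply] at this
    refine this.trans ?_
    rw [EuclideanSpace.real_norm_sq_eq, Complex.ofReal_sum, Finset.mul_sum, Finset.sum_mul]
    refine Finset.sum_congr rfl fun i _ => ?_
    change 𝓕 (∂_{coordVec i} (∂_{coordVec i} f) : 𝓢(E n, ℂ)) ξ = _
    rw [fourier_lineDeriv_apply, fourier_lineDeriv_apply]
    push_cast
    ring
  have hcs : ∀ f : 𝓢(E n, ℂ), HasCompactSupport f →
      HasCompactSupport (∑ i : Fin n, ∂_{coordVec i} (∂_{coordVec i} f) : 𝓢(E n, ℂ)) := by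
    intro f hf
    refine HasCompactSupport.of_support_subset_isCompact hf fun x hx => ?_
    by_contra hcon
    refine hx ?_
    rw [FunLike.coe_sum, Finset.sum_apply]
    refine Finset.sum_eq_zero fun i _ => image_eq_zero_of_notMem_tsupport fun hmem => hcon ?_
    exact tsupport_lineDerivOp_subset _ _ (tsupport_lineDerivOp_subset _ _ hmem)
  have hne : ∀ f : 𝓢(E n, ℂ), (∀ ξ : E n, 5 / 8 ≤ ‖ξ‖ → ‖ξ‖ ≤ 8 / 5 → 𝓕 f ξ ≠ 0) →
      ∀ ξ : E n, 5 / 8 ≤ ‖ξ‖ → ‖ξ‖ ≤ 8 / 5 →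
        𝓕 (∑ i : Fin n, ∂_{coordVec i} (∂_{coordVec i} f) : 𝓢(E n, ℂ)) ξ ≠ 0 := by
    intro f hf ξ h1 h2
    rw [hlap]
    have hpos : ‖ξ‖ ^ 2 ≠ 0 := by positivity
    refine mul_ne_zero (mul_ne_zero ?_ ?_) (hf ξ h1 h2)
    · exact pow_ne_zero _ (by simp [Complex.I_ne_zero, Real.pi_ne_zero])
    · exact_mod_cast hpos
  induction L with
  | zero =>
    obtain ⟨θ, hθ, h⟩ := exists_compactSupport_fourier_ne_zero (n := n)
    refine ⟨∑ i : Fin n, ∂_{coordVec i} (∂_{coordVec i} θ), ⟨hcs θ hθ, ?_⟩,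
      hne θ fun ξ _ h2 => h ξ (by linarith)⟩
    exact InSP.sum fun i _ => inSP_zero_lineDeriv _ i
  | succ L ih =>
    obtain ⟨ψ, hψ, h⟩ := ih
    refine ⟨∑ i : Fin n, ∂_{coordVec i} (∂_{coordVec i} ψ), ⟨hcs ψ hψ.1, ?_⟩, hne ψ h⟩
    exact InSP.sum fun i _ => ((hψ.2.lineDeriv i).lineDeriv i).mono (by omega)

/-- A Schwartz function with integral `1` and no other moments. -/
theorem exists_dual_function (n : ℕ) : ∃ φ : 𝓢(E n, ℂ),
    ∀ γ : Fin n → ℕ, moment γ φ = if γ = 0 then 1 else 0 := by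
  refine ⟨𝓕⁻ (lowCutoff n), fun γ => moment_of_fourier_eq_one ?_ γ⟩
  rw [FourierTransform.fourier_fourierInv_eq]
  filter_upwards [Metric.closedBall_mem_nhds (0 : E n) (by norm_num : (0 : ℝ) < 5 / 4)] with ξ hξ
  exact lowCutoff_eq_one (by simpa using hξ)

/-! ### Summation over dyadic scales -/

theorem summable_two_rpow_neg_abs {ε : ℝ} (hε : 0 < ε) :
    Summable fun k : ℤ => (2 : ℝ) ^ (-(ε * |(k : ℝ)|)) := by
  have h : Summable fun m : ℕ => ((2 : ℝ) ^ (-ε)) ^ m :=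
    summable_geometric_of_lt_one (by positivity) (Real.rpow_lt_one_of_one_lt_of_neg one_lt_two
      (by linarith))
  have e : ∀ m : ℕ, ((2 : ℝ) ^ (-ε)) ^ m = (2 : ℝ) ^ (-(ε * |(m : ℝ)|)) := fun m => by
    rw [← Real.rpow_natCast, ← Real.rpow_mul two_pos.le, abs_of_nonneg (Nat.cast_nonneg m), neg_mul]
  simp only [e] at h
  refine Summable.of_nat_of_neg ?_ ?_
  · simpa using h
  · simpa using h

theorem summable_two_zpow_neg_abs : Summable fun k : ℤ => (2 : ℝ) ^ (-|k|) := by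
  refine (summable_two_rpow_neg_abs one_pos).congr fun k => ?_
  rw [← Real.rpow_intCast]
  congr 1
  push_cast
  ring

/-! ### The reproducing formula -/

/-- The `k`-th block `a_k * a'_k * f`. -/
noncomputable def block (a a' : 𝓢(E n, ℂ)) (k : ℤ) (f : 𝓢(E n, ℂ)) : 𝓢(E n, ℂ) :=
  cv (dyadic k a) (cv (dyadic k a') f)

theorem Resolves.fourier_block {a a' : 𝓢(E n, ℂ)} (h : Resolves a a') (k : ℤ) (f : 𝓢(E n, ℂ))
    (ξ : E n) : 𝓕 (block a a' k f) ξ = annulusBump n ((2 : ℝ) ^ (-k) • ξ) * 𝓕 f ξ := by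
  rw [block, fourier_cv, fourier_cv, fourier_dyadic, fourier_dyadic, ← mul_assoc, h.mul_fourier]

theorem sum_Ioc_telescope {G : Type*} [AddCommGroup G] (R : ℤ → G) (m : ℕ) :
    ∑ k ∈ Finset.Ioc (-(m : ℤ)) m, (R k - R (k - 1)) = R m - R (-m) := by
  induction m with
  | zero => simp
  | succ m ih =>
    have e : Finset.Ioc (-((m + 1 : ℕ) : ℤ)) ((m + 1 : ℕ) : ℤ) =
        insert ((m : ℤ) + 1) (insert (-(m : ℤ)) (Finset.Ioc (-(m : ℤ)) m)) := by
      ext k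
      simp only [Finset.mem_Ioc, Finset.mem_insert]
      push_cast
      omega
    rw [e, Finset.sum_insert (by simp), Finset.sum_insert (by simp), ih]
    push_cast
    have e1 : (m : ℤ) + 1 - 1 = m := by ring
    have e2 : -(m : ℤ) - 1 = -((m : ℤ) + 1) := by ring
    rw [e1, e2]
    abel

theorem annulusBump_dyadic (k : ℤ) (ξ : E n) : annulusBump n ((2 : ℝ) ^ (-k) • ξ) =
    lowCutoff n ((2 : ℝ) ^ (-k) • ξ) - lowCutoff n ((2 : ℝ) ^ (-(k - 1)) • ξ) := by
  rw [annulusBump_apply, smul_smul]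
  congr 3
  rw [show -(k - 1) = 1 + -k by ring, zpow_add₀ two_ne_zero, zpow_one]

theorem vanishesAtZero_annulusBump (P : ℕ) : VanishesAtZero P (annulusBump n) := by
  intro j _
  have h0 : (0 : E n) ∉ tsupport (annulusBump n) := fun h => by
    have := (tsupport_annulusBump h).1
    rw [norm_zero] at this
    linarith
  have : (annulusBump n : E n → ℂ) =ᶠ[𝓝 0] 0 := notMem_tsupport_iff_eventuallyEq.1 h0
  rw [(this.iteratedFDeriv ℝ j).self_of_nhds]
  simp

theorem vanishesAtZero_one_sub_lowCutoff (P : ℕ) :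
    VanishesAtZero P (fun ξ => 1 - lowCutoff n ξ) := by
  intro j _
  have : (fun ξ => 1 - lowCutoff n ξ) =ᶠ[𝓝 (0 : E n)] 0 := by
    filter_upwards [Metric.closedBall_mem_nhds (0 : E n) (by norm_num : (0 : ℝ) < 5 / 4)] with ξ hξ
    rw [lowCutoff_eq_one (by simpa using hξ)]; simp
  rw [(this.iteratedFDeriv ℝ j).self_of_nhds]
  simp

theorem bounded_iteratedFDeriv_one_sub (A : 𝓢(E n, ℂ)) (j : ℕ) :
    ∃ C, ∀ η, ‖iteratedFDeriv ℝ j (fun ξ => 1 - A ξ) η‖ ≤ C := by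
  refine ⟨1 + SchwartzMap.seminorm ℂ 0 j A, fun η => ?_⟩
  have h1 := SchwartzMap.norm_iteratedFDeriv_le_seminorm ℂ A j η
  have e : iteratedFDeriv ℝ j (fun ξ => 1 - A ξ) η =
      iteratedFDeriv ℝ j (fun _ : E n => (1 : ℂ)) η - iteratedFDeriv ℝ j A η :=
    iteratedFDeriv_sub_apply contDiff_const.contDiffAt
      ((A.smooth ⊤).contDiffAt.of_le (by exact_mod_cast le_top))
  rw [e]
  refine (norm_sub_le _ _).trans (add_le_add ?_ h1)
  rcases j with _ | j
  · simp
  · rw [iteratedFDeriv_const_of_ne (by omega)]; simp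

/-- Summability of the blocks in the given seminorms makes the convergence unconditional; the limit
is then identified along symmetric intervals, where the sum of the multipliers telescopes. The
number of moments required of `f` depends on the seminorms only. -/
theorem Resolves.tendsto_seminorm {a a' : 𝓢(E n, ℂ)} (h : Resolves a a') (s : Finset (ℕ × ℕ)) :
    ∃ P : ℕ, ∀ f : 𝓢(E n, ℂ), InSP P f →
      Tendsto (fun F : Finset ℤ => s.sup (schwartzSeminormFamily ℂ (E n) ℂ)
        (𝓕 (f - ∑ k ∈ F, block a a' k f))) atTop (𝓝 0) := by
  obtain ⟨P1, hP1⟩ := exists_gauge_dilate_mul_of_one_le (n := n) s 1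
  obtain ⟨q1, hq1, h1⟩ := hP1 (annulusBump n)
  obtain ⟨q2, hq2, h2⟩ := exists_gauge_dilate_mul_of_le_one s ((annulusBump n).smooth ⊤)
    (fun j => ⟨_, SchwartzMap.norm_iteratedFDeriv_le_seminorm ℂ (annulusBump n) j⟩)
    vanishesAtZero_annulusBump 1
  obtain ⟨P3, hP3⟩ := exists_gauge_dilate_mul_of_one_le (n := n) s 1
  obtain ⟨q3, hq3, h3⟩ := hP3 (lowCutoff n)
  obtain ⟨q4, hq4, h4⟩ := exists_gauge_dilate_mul_of_le_one s (A := fun ξ => 1 - lowCutoff n ξ)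
    (contDiff_const.sub ((lowCutoff n).smooth ⊤)) (bounded_iteratedFDeriv_one_sub _)
    vanishesAtZero_one_sub_lowCutoff 1
  refine ⟨max P1 P3, fun f hf => ?_⟩
  set p := s.sup (schwartzSeminormFamily ℂ (E n) ℂ) with hp
  set G := 𝓕 f with hG
  have hv1 : VanishesAtZero P1 G := (hf.mono (le_max_left _ _)).vanishesAtZero
  have hv3 : VanishesAtZero P3 G := (hf.mono (le_max_right _ _)).vanishesAtZero
  let u : ℤ → ℝ := fun k => p (𝓕 (block a a' k f))
  have hu0 : ∀ k, 0 ≤ u k := fun k => apply_nonneg _ _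
  -- For `k ≤ 0` the decay comes from the flatness of `𝓕 f` at the origin, for `k ≥ 0` from that of
  -- `annulusBump`.
  have hu : Summable u := by
    refine Summable.of_nonneg_of_le hu0 (fun k => ?_)
      (summable_two_zpow_neg_abs.mul_left (q1 G + q2 G))
    have hpos : (0 : ℝ) < 2 ^ (-|k|) := by positivity
    rcases le_total k 0 with hk | hk
    · have := h1 G (𝓕 (block a a' k f)) hv1 ((2 : ℝ) ^ (-k)) (one_le_zpow₀ one_le_two (by omega))
        (fun ξ => h.fourier_block k f ξ)
      rw [pow_one, ← zpow_neg, neg_neg] at this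
      rw [abs_of_nonpos hk, neg_neg] at *
      nlinarith [mul_nonneg (hq2.nonneg G) hpos.le]
    · have := h2 G (𝓕 (block a a' k f)) ((2 : ℝ) ^ (-k)) (by positivity)
        (zpow_le_one_of_nonpos₀ one_le_two (by omega)) (fun ξ => h.fourier_block k f ξ)
      rw [pow_one] at this
      rw [abs_of_nonneg hk] at *
      nlinarith [mul_nonneg (hq1.nonneg G) hpos.le]
  have hF : ∀ F : Finset ℤ, 𝓕 (f - ∑ k ∈ F, block a a' k f) = G - ∑ k ∈ F, 𝓕 (block a a' k f) := by
    intro F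
    have := map_sub (FourierTransform.fourierCLM ℂ 𝓢(E n, ℂ)) f (∑ k ∈ F, block a a' k f)
    rw [map_sum] at this
    exact this
  have hm : Tendsto (fun m : ℕ => p (𝓕 (f - ∑ k ∈ Finset.Ioc (-(m : ℤ)) m, block a a' k f)))
      atTop (𝓝 0) := by
    have hlim : Tendsto (fun m : ℕ => (q3 G + q4 G) * (1 / 2 : ℝ) ^ m) atTop (𝓝 0) := by
      simpa using (tendsto_pow_atTop_nhds_zero_of_lt_one (by norm_num : (0 : ℝ) ≤ 1 / 2)
        (by norm_num)).const_mul (q3 G + q4 G)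
    refine squeeze_zero (fun m => apply_nonneg _ _) (fun m => ?_) hlim
    have hhalf : (1 / 2 : ℝ) ^ m = 2 ^ (-(m : ℤ)) := by
      rw [zpow_neg, zpow_natCast, one_div, inv_pow]
    -- The two remainders of the telescoping sum: `H2` is localized at frequencies of size at most
    -- about `2^(-m)`, where `G` is flat, and `H1` at frequencies of size at least about `2^m`.
    let H2 : 𝓢(E n, ℂ) := pairing (ContinuousLinearMap.mul ℂ ℂ)
      (scale ((2 : ℝ) ^ (m : ℤ)) (lowCutoff n)) G
    let H1 : 𝓢(E n, ℂ) := G - pairing (ContinuousLinearMap.mul ℂ ℂ)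
      (scale ((2 : ℝ) ^ (-(m : ℤ))) (lowCutoff n)) G
    have e2 : ∀ ξ, H2 ξ = lowCutoff n ((2 : ℝ) ^ (m : ℤ) • ξ) * G ξ := fun ξ => by
      simp only [H2, pairing_apply_apply, ContinuousLinearMap.mul_apply']
      rw [scale_apply (by positivity)]
    have e1 : ∀ ξ, H1 ξ = (1 - lowCutoff n ((2 : ℝ) ^ (-(m : ℤ)) • ξ)) * G ξ := fun ξ => by
      simp only [H1, FunLike.coe_sub, Pi.sub_apply, pairing_apply_apply,
        ContinuousLinearMap.mul_apply']
      rw [scale_apply (by positivity)]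
      ring
    have e : 𝓕 (f - ∑ k ∈ Finset.Ioc (-(m : ℤ)) m, block a a' k f) = H1 + H2 := by
      rw [hF]
      ext ξ
      rw [FunLike.coe_sub, FunLike.coe_add, Pi.sub_apply, Pi.add_apply, e1, e2,
        FunLike.coe_sum, Finset.sum_apply]
      simp only [h.fourier_block]
      rw [← Finset.sum_mul]
      have := sum_Ioc_telescope (fun k : ℤ => lowCutoff n ((2 : ℝ) ^ (-k) • ξ)) m
      simp only [← annulusBump_dyadic, neg_neg] at this
      rw [this]
      ring
    rw [e, hhalf]
    refine (map_add_le_add p H1 H2).trans ?_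
    have b2 := h3 G H2 hv3 ((2 : ℝ) ^ (m : ℤ)) (one_le_zpow₀ one_le_two (by omega)) e2
    have b1 := h4 G H1 ((2 : ℝ) ^ (-(m : ℤ))) (by positivity)
      (zpow_le_one_of_nonpos₀ one_le_two (by omega)) e1
    rw [pow_one, ← zpow_neg] at b2
    rw [pow_one] at b1
    rw [add_mul]
    linarith
  rw [Metric.tendsto_atTop]
  intro ε hε
  obtain ⟨F0, hF0⟩ := summable_iff_vanishing_norm.1 hu (ε / 2) (by linarith)
  obtain ⟨m0, hm0⟩ := (Metric.tendsto_atTop.1 hm) (ε / 2) (by linarith)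
  obtain ⟨m, hm1, hm2⟩ : ∃ m : ℕ, m0 ≤ m ∧ F0 ⊆ Finset.Ioc (-(m : ℤ)) m := by
    refine ⟨max m0 (F0.sup fun k => k.natAbs + 1), le_max_left _ _, fun k hk => ?_⟩
    have : k.natAbs + 1 ≤ F0.sup fun k => k.natAbs + 1 :=
      Finset.le_sup (f := fun k : ℤ => k.natAbs + 1) hk
    rw [Finset.mem_Ioc]
    omega
  refine ⟨Finset.Ioc (-(m : ℤ)) m, fun F hFm => ?_⟩
  have hFm' : Finset.Ioc (-(m : ℤ)) m ⊆ F := hFm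
  rw [Real.dist_eq, sub_zero, abs_of_nonneg (apply_nonneg _ _)]
  have e : 𝓕 (f - ∑ k ∈ F, block a a' k f) =
      𝓕 (f - ∑ k ∈ Finset.Ioc (-(m : ℤ)) m, block a a' k f) -
        ∑ k ∈ F \ Finset.Ioc (-(m : ℤ)) m, 𝓕 (block a a' k f) := by
    rw [hF, hF, ← Finset.sum_sdiff hFm']
    abel
  rw [e]
  have b1 := hm0 m hm1
  rw [Real.dist_eq, sub_zero, abs_of_nonneg (apply_nonneg _ _)] at b1
  have b2 := hF0 (F \ Finset.Ioc (-(m : ℤ)) m)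
    (Finset.disjoint_of_subset_right hm2 Finset.sdiff_disjoint)
  rw [Real.norm_of_nonneg (Finset.sum_nonneg fun k _ => hu0 k)] at b2
  have b3 : p (∑ k ∈ F \ Finset.Ioc (-(m : ℤ)) m, 𝓕 (block a a' k f)) ≤
      ∑ k ∈ F \ Finset.Ioc (-(m : ℤ)) m, u k :=
    Finset.le_sum_of_subadditive p (map_zero p).le (map_add_le_add p) _ _
  have b4 := map_sub_le_add p (𝓕 (f - ∑ k ∈ Finset.Ioc (-(m : ℤ)) m, block a a' k f))
    (∑ k ∈ F \ Finset.Ioc (-(m : ℤ)) m, 𝓕 (block a a' k f))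
  linarith

theorem Resolves.hasSum {a a' : 𝓢(E n, ℂ)} (h : Resolves a a') {f : 𝓢(E n, ℂ)} (hf : InSInf f) :
    HasSum (fun k : ℤ => block a a' k f) f := by
  have h1 : Tendsto (fun F : Finset ℤ => 𝓕 (f - ∑ k ∈ F, block a a' k f)) atTop (𝓝 0) := by
    rw [(schwartz_withSeminorms ℂ (E n) ℂ).tendsto_nhds]
    intro i ε hε
    obtain ⟨P, hP⟩ := h.tendsto_seminorm {i}
    have := hP f (hf P)
    simp only [Finset.sup_singleton] at this
    filter_upwards [(Metric.tendsto_nhds.1 this) ε hε] with F hF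
    rw [Real.dist_eq, sub_zero, abs_of_nonneg (apply_nonneg _ _)] at hF
    simpa using hF
  have h2 : Tendsto (fun F : Finset ℤ => f - ∑ k ∈ F, block a a' k f) atTop (𝓝 0) := by
    have := ((FourierTransform.fourierInvCLM ℂ 𝓢(E n, ℂ)).continuous.tendsto 0).comp h1
    simpa [Function.comp_def] using this
  have h3 := h2.const_sub f
  simpa [HasSum] using h3

/-! ### Tempered distributions have finite order -/

theorem exists_bound_distribution {V : Type*} [NormedAddCommGroup V] [NormedSpace ℝ V]
    (b : 𝓢'(V, ℂ)) : ∃ (s : Finset (ℕ × ℕ)) (C : ℝ), 0 ≤ C ∧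
      ∀ f, ‖b f‖ ≤ C * s.sup (schwartzSeminormFamily ℂ V ℂ) f := by
  let p : Seminorm ℂ 𝓢(V, ℂ) :=
    (normSeminorm ℂ ℂ).comp (b : 𝓢(V, ℂ) →ₗ[ℂ] ℂ)
  have hp : Continuous p := continuous_norm.comp b.continuous
  obtain ⟨s, D, -, hD⟩ := Seminorm.bound_of_continuous (schwartz_withSeminorms ℂ V ℂ) p hp
  exact ⟨s, D, D.2, fun f => hD f⟩

/-- The reproducing formula, tested against a tempered distribution. -/
theorem Resolves.exists_hasSum_distribution {a a' : 𝓢(E n, ℂ)} (h : Resolves a a')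
    (b : 𝓢'(E n, ℂ)) :
    ∃ P : ℕ, ∀ f : 𝓢(E n, ℂ), InSP P f → HasSum (fun k : ℤ => b (block a a' k f)) (b f) := by
  -- Since `b f = (𝓕⁻ b)(𝓕 f)`, the finite order of `𝓕⁻ b` bounds `b` by seminorms of the Fourier
  -- transform, for which convergence is known.
  obtain ⟨s, C, hC0, hC⟩ := exists_bound_distribution (𝓕⁻ b)
  obtain ⟨P, hP⟩ := h.tendsto_seminorm s
  refine ⟨P, fun f hf => ?_⟩
  have h1 := (hP f hf).const_mul C
  rw [mul_zero] at h1
  have h2 : Tendsto (fun F : Finset ℤ => b (f - ∑ k ∈ F, block a a' k f)) atTop (𝓝 0) := by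
    refine squeeze_zero_norm (fun F => ?_) h1
    have := hC (𝓕 (f - ∑ k ∈ F, block a a' k f))
    rw [TemperedDistribution.fourierInv_apply, FourierTransform.fourierInv_fourier_eq] at this
    exact this
  have h3 := h2.const_sub (b f)
  simpa [HasSum, map_sub, map_sum] using h3

/-! ### Translations and distributions -/

theorem iteratedFDeriv_translate (a : E n) (f : 𝓢(E n, ℂ)) (N : ℕ) (x : E n) :
    iteratedFDeriv ℝ N (translate a f) x = iteratedFDeriv ℝ N f (x - a) := by
  have : (translate a f : E n → ℂ) = fun x => f (x - a) := funext fun x => rfl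
  rw [this, iteratedFDeriv_comp_sub]

theorem norm_pow_le_one_add_mul (x a : E n) (K : ℕ) :
    ‖x‖ ^ K ≤ (1 + ‖a‖) ^ K * (1 + ‖x - a‖) ^ K := by
  rw [← mul_pow]
  refine pow_le_pow_left₀ (norm_nonneg _) ?_ K
  have := norm_sub_norm_le x a
  nlinarith [norm_nonneg a, norm_nonneg (x - a)]

theorem seminorm_translate_le (f : 𝓢(E n, ℂ)) (K N : ℕ) : ∃ C, 0 ≤ C ∧ ∀ a : E n,
    SchwartzMap.seminorm ℂ K N (translate a f) ≤ C * (1 + ‖a‖) ^ K := by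
  refine ⟨2 ^ K * ((Finset.Iic (K, N)).sup fun m => SchwartzMap.seminorm ℂ m.1 m.2) f,
    mul_nonneg (by positivity) (apply_nonneg _ _), fun a => ?_⟩
  refine SchwartzMap.seminorm_le_bound ℂ K N _ (mul_nonneg (mul_nonneg (by positivity)
    (apply_nonneg _ _)) (by positivity)) fun x => ?_
  rw [iteratedFDeriv_translate]
  have h := SchwartzMap.one_add_le_sup_seminorm_apply (𝕜 := ℂ) (m := (K, N)) le_rfl le_rfl f (x - a)
  calc ‖x‖ ^ K * ‖iteratedFDeriv ℝ N f (x - a)‖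
      ≤ ((1 + ‖a‖) ^ K * (1 + ‖x - a‖) ^ K) * ‖iteratedFDeriv ℝ N f (x - a)‖ := by
        gcongr; exact norm_pow_le_one_add_mul x a K
    _ = ((1 + ‖x - a‖) ^ K * ‖iteratedFDeriv ℝ N f (x - a)‖) * (1 + ‖a‖) ^ K := by ring
    _ ≤ _ := by gcongr

/-- Mean value inequality in the translation parameter, along the segment from `b` to `a`; the
derivative in `c` is again a translate, with one more derivative on `f`. -/
theorem seminorm_translate_sub_le (f : 𝓢(E n, ℂ)) (K N : ℕ) : ∃ C, 0 ≤ C ∧ ∀ a b : E n,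
    SchwartzMap.seminorm ℂ K N (translate a f - translate b f) ≤
      C * (1 + (‖a‖ + ‖b‖)) ^ K * ‖a - b‖ := by
  obtain ⟨C, hC, h⟩ := seminorm_translate_le f K (N + 1)
  refine ⟨C, hC, fun a b => ?_⟩
  refine SchwartzMap.seminorm_le_bound ℂ K N _ (by positivity) fun x => ?_
  have e : iteratedFDeriv ℝ N (translate a f - translate b f : 𝓢(E n, ℂ)) x =
      iteratedFDeriv ℝ N f (x - a) - iteratedFDeriv ℝ N f (x - b) := by
    have h1 : ((translate a f - translate b f : 𝓢(E n, ℂ)) : E n → ℂ) =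
      fun x => translate a f x - translate b f x := by ext x; simp
    rw [h1, ← iteratedFDeriv_translate, ← iteratedFDeriv_translate]
    exact iteratedFDeriv_sub_apply
      (((translate a f).smooth ⊤).contDiffAt.of_le (by exact_mod_cast le_top))
      (((translate b f).smooth ⊤).contDiffAt.of_le (by exact_mod_cast le_top))
  rw [e]
  have hd : Differentiable ℝ (fun c : E n => ‖x‖ ^ K • iteratedFDeriv ℝ N f (x - c)) := by
    have h1 : Differentiable ℝ (iteratedFDeriv ℝ N f) :=
      (f.smooth ⊤).differentiable_iteratedFDeriv (by exact_mod_cast WithTop.coe_lt_top _)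
    have h2 : Differentiable ℝ (fun c : E n => iteratedFDeriv ℝ N f (x - c)) :=
      h1.comp (differentiable_id.const_sub x)
    exact h2.fun_const_smul _
  have := (convex_segment b a).norm_image_sub_le_of_norm_fderiv_le (𝕜 := ℝ)
    (f := fun c : E n => ‖x‖ ^ K • iteratedFDeriv ℝ N f (x - c))
    (C := C * (1 + (‖a‖ + ‖b‖)) ^ K) (x := b) (y := a) (fun c _ => hd c) ?_
    (left_mem_segment ℝ b a) (right_mem_segment ℝ b a)
  · rw [← smul_sub, norm_smul, norm_pow, norm_norm] at this
    exact this
  · intro c hc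
    have hfd : DifferentiableAt ℝ (iteratedFDeriv ℝ N f) (x - c) :=
      (f.smooth ⊤).differentiable_iteratedFDeriv (m := N)
        (by exact_mod_cast WithTop.coe_lt_top _) _
    have hfc : DifferentiableAt ℝ (fun c : E n => iteratedFDeriv ℝ N f (x - c)) c :=
      hfd.comp c ((differentiable_id.const_sub x) c)
    have e2 : fderiv ℝ (fun c : E n => ‖x‖ ^ K • iteratedFDeriv ℝ N f (x - c)) c =
        ‖x‖ ^ K • -fderiv ℝ (iteratedFDeriv ℝ N f) (x - c) := by
      rw [fderiv_fun_const_smul hfc]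
      congr 1
      have h3 := (hfd.hasFDerivAt.comp c ((hasFDerivAt_id (𝕜 := ℝ) c).const_sub x)).fderiv
      refine h3.trans ?_
      ext v
      simp
    rw [e2, norm_smul, norm_neg, norm_pow, norm_norm, norm_fderiv_iteratedFDeriv,
      ← iteratedFDeriv_translate]
    refine (SchwartzMap.le_seminorm ℂ K (N + 1) (translate c f) x).trans ((h c).trans ?_)
    have hcn : ‖c‖ ≤ ‖a‖ + ‖b‖ := by
      obtain ⟨s, t, hs, ht, hst, rfl⟩ := hc
      refine (norm_add_le _ _).trans ?_
      rw [norm_smul, norm_smul, Real.norm_of_nonneg hs, Real.norm_of_nonneg ht]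
      nlinarith [norm_nonneg a, norm_nonneg b]
    gcongr

theorem exists_sup_seminorm_translate_le (f : 𝓢(E n, ℂ)) (s : Finset (ℕ × ℕ)) :
    ∃ (C : ℝ) (m : ℕ), 0 ≤ C ∧ ∀ a : E n,
      s.sup (schwartzSeminormFamily ℂ (E n) ℂ) (translate a f) ≤ C * (1 + ‖a‖) ^ m := by
  choose C hC0 hC using fun p : ℕ × ℕ => seminorm_translate_le f p.1 p.2
  refine ⟨∑ p ∈ s, C p, s.sup Prod.fst, Finset.sum_nonneg fun p _ => hC0 p, fun a => ?_⟩
  have hs : 0 ≤ ∑ p ∈ s, C p := Finset.sum_nonneg fun p _ => hC0 p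
  refine Seminorm.finset_sup_apply_le (by positivity) fun p hp => (hC p a).trans ?_
  have h1 : C p ≤ ∑ p ∈ s, C p := Finset.single_le_sum (fun p _ => hC0 p) hp
  have h2 : (1 + ‖a‖) ^ p.1 ≤ (1 + ‖a‖) ^ s.sup Prod.fst :=
    pow_le_pow_right₀ (by linarith [norm_nonneg a]) (Finset.le_sup (f := Prod.fst) hp)
  gcongr

theorem continuous_translate (f : 𝓢(E n, ℂ)) : Continuous fun a : E n => translate a f := by
  rw [continuous_iff_continuousAt]
  intro b
  rw [ContinuousAt, (schwartz_withSeminorms ℂ (E n) ℂ).tendsto_nhds]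
  intro i ε hε
  obtain ⟨C, hC, h⟩ := seminorm_translate_sub_le f i.1 i.2
  have hlim : Tendsto (fun a : E n => C * (1 + (‖a‖ + ‖b‖)) ^ i.1 * ‖a - b‖) (𝓝 b) (𝓝 0) := by
    have : Continuous fun a : E n => C * (1 + (‖a‖ + ‖b‖)) ^ i.1 * ‖a - b‖ := by fun_prop
    simpa using this.tendsto b
  filter_upwards [hlim.eventually (gt_mem_nhds hε)] with a ha
  exact (h a b).trans_lt ha

theorem continuous_distribution_translate (b : 𝓢'(E n, ℂ)) (f : 𝓢(E n, ℂ)) :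
    Continuous fun a : E n => b (translate a f) := b.continuous.comp (continuous_translate f)

theorem lineDeriv_cv (f g : 𝓢(E n, ℂ)) (m : E n) : ∂_{m} (cv f g) = cv (∂_{m} f) g := by
  refine ext_fourier fun ξ => ?_
  have : (inner ℝ · m : E n → ℝ).HasTemperateGrowth := by fun_prop
  rw [fourier_cv, fourier_lineDerivOp_eq, fourier_lineDerivOp_eq, FunLike.coe_smul,
    FunLike.coe_smul, Pi.smul_apply, Pi.smul_apply, smulLeftCLM_apply_apply this,
    smulLeftCLM_apply_apply this, fourier_cv]
  simp only [smul_eq_mul, Complex.real_smul]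
  ring

theorem iteratedLineDeriv_cv (f g : 𝓢(E n, ℂ)) {N : ℕ} (m : Fin N → E n) :
    ∂^{m} (cv f g) = cv (∂^{m} f) g := by
  induction N generalizing f with
  | zero => simp
  | succ N ih => rw [iteratedLineDerivOp_succ_right, lineDeriv_cv, ih, iteratedLineDerivOp_succ_right]

theorem iteratedFDeriv_cv_apply (f g : 𝓢(E n, ℂ)) {N : ℕ} (m : Fin N → E n) (x : E n) :
    iteratedFDeriv ℝ N (cv f g) x m = ∫ z, iteratedFDeriv ℝ N f (x - z) m * g z := by
  rw [← iteratedLineDerivOp_eq_iteratedFDeriv, iteratedLineDeriv_cv, cv_apply']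
  simp only [iteratedLineDerivOp_eq_iteratedFDeriv]

theorem one_add_pow_le {t : ℝ} (ht : 0 ≤ t) (m : ℕ) : (1 + t) ^ m ≤ 2 ^ m * (1 + t ^ m) := by
  refine (add_pow_le zero_le_one ht m).trans ?_
  rw [one_pow]
  gcongr
  · norm_num
  · omega

theorem norm_iteratedFDeriv_le_sum_coord (f : 𝓢(E n, ℂ)) (N : ℕ) (x : E n) :
    ‖iteratedFDeriv ℝ N f x‖ ≤
      ∑ v : Fin N → Fin n, ‖(∂^{fun j => coordVec (v j)} f : 𝓢(E n, ℂ)) x‖ := by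
  refine ContinuousMultilinearMap.opNorm_le_bound (Finset.sum_nonneg fun _ _ => norm_nonneg _)
    fun m => ?_
  have hm : m = fun j => ∑ i : Fin n, m j i • coordVec i := by
    funext j
    ext i
    simp [Finset.sum_apply, Pi.single_apply]
  have e : iteratedFDeriv ℝ N f x m = ∑ v : Fin N → Fin n,
      (∏ j, m j (v j)) • iteratedFDeriv ℝ N f x fun j => coordVec (v j) := by
    conv_lhs => rw [hm]
    rw [ContinuousMultilinearMap.map_sum]
    exact Finset.sum_congr rfl fun v _ => ContinuousMultilinearMap.map_smul_univ _ _ _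
  rw [e, Finset.sum_mul]
  refine (norm_sum_le _ _).trans (Finset.sum_le_sum fun v _ => ?_)
  rw [norm_smul, iteratedLineDerivOp_eq_iteratedFDeriv, norm_prod, mul_comm]
  gcongr with j
  exact PiLp.norm_apply_le (m j) (v j)

/-! ### Tempered distributions as functionals on a Banach space of weighted derivatives -/

open scoped BoundedContinuousFunction

/-- The weighted derivative `|x| ^ K ∂_v f`, as a bounded continuous function. -/
noncomputable def weightedDeriv (K N : ℕ) (v : Fin N → Fin n) : 𝓢(E n, ℂ) →ₗ[ℂ] (E n →ᵇ ℂ) where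
  toFun f := BoundedContinuousFunction.ofNormedAddCommGroup
    (fun x => ((‖x‖ ^ K : ℝ) : ℂ) * (∂^{fun j => coordVec (v j)} f : 𝓢(E n, ℂ)) x)
    (by fun_prop) (SchwartzMap.seminorm ℂ K 0 (∂^{fun j => coordVec (v j)} f)) (fun x => by
        rw [norm_mul, Complex.norm_real, norm_pow, norm_norm]
        exact SchwartzMap.norm_pow_mul_le_seminorm ℂ _ K x)
  map_add' f g := by
    ext x
    simp only [BoundedContinuousFunction.coe_ofNormedAddCommGroup, iteratedLineDerivOp_add,
      BoundedContinuousFunction.coe_add, Pi.add_apply, FunLike.coe_add, mul_add]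
  map_smul' c f := by
    ext x
    simp only [BoundedContinuousFunction.coe_ofNormedAddCommGroup, iteratedLineDerivOp_smul,
      BoundedContinuousFunction.coe_smul, FunLike.coe_smul, Pi.smul_apply, smul_eq_mul,
      RingHom.id_apply]
    ring

theorem weightedDeriv_apply (K N : ℕ) (v : Fin N → Fin n) (f : 𝓢(E n, ℂ)) (x : E n) :
    weightedDeriv K N v f x =
      ((‖x‖ ^ K : ℝ) : ℂ) * (∂^{fun j => coordVec (v j)} f : 𝓢(E n, ℂ)) x := rfl

theorem norm_weightedDeriv_le (K N : ℕ) (v : Fin N → Fin n) (f : 𝓢(E n, ℂ)) :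
    ‖weightedDeriv K N v f‖ ≤ SchwartzMap.seminorm ℂ K N f :=
  (BoundedContinuousFunction.norm_le (apply_nonneg _ _)).2 fun x => by
    rw [weightedDeriv_apply, norm_mul, Complex.norm_real, norm_pow, norm_norm,
      iteratedLineDerivOp_eq_iteratedFDeriv]
    refine le_trans ?_ (SchwartzMap.le_seminorm ℂ K N f x)
    gcongr
    refine (ContinuousMultilinearMap.le_opNorm _ _).trans ?_
    simp

/-- The target of all the weighted derivatives with indices in `s`. -/
abbrev WeightedSpace (n : ℕ) (s : Finset (ℕ × ℕ)) : Type :=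
  ((i : s) × (Fin i.1.2 → Fin n)) → (E n →ᵇ ℂ)

/-- All the weighted derivatives with indices in `s`. -/
noncomputable def weightedDerivs (s : Finset (ℕ × ℕ)) : 𝓢(E n, ℂ) →ₗ[ℂ] WeightedSpace n s :=
  LinearMap.pi fun i => weightedDeriv i.1.1.1 i.1.1.2 i.2

theorem norm_weightedDerivs_le (s : Finset (ℕ × ℕ)) (f : 𝓢(E n, ℂ)) :
    ‖weightedDerivs s f‖ ≤ s.sup (schwartzSeminormFamily ℂ (E n) ℂ) f := by
  rw [pi_norm_le_iff_of_nonneg (apply_nonneg _ _)]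
  intro i
  refine (norm_weightedDeriv_le _ _ _ f).trans ?_
  exact Seminorm.le_finset_sup_apply (p := schwartzSeminormFamily ℂ (E n) ℂ) i.1.2

theorem exists_sup_seminorm_le_norm_weightedDerivs (n : ℕ) (s : Finset (ℕ × ℕ)) :
    ∃ D : ℝ, 0 ≤ D ∧ ∀ f : 𝓢(E n, ℂ),
      s.sup (schwartzSeminormFamily ℂ (E n) ℂ) f ≤ D * ‖weightedDerivs s f‖ := by
  refine ⟨∑ p ∈ s, (n : ℝ) ^ p.2, by positivity, fun f => ?_⟩
  refine Seminorm.finset_sup_apply_le (mul_nonneg (by positivity) (norm_nonneg _)) fun p hp => ?_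
  have h1 : (n : ℝ) ^ p.2 ≤ ∑ p ∈ s, (n : ℝ) ^ p.2 :=
    Finset.single_le_sum (f := fun p : ℕ × ℕ => (n : ℝ) ^ p.2) (fun p _ => by positivity) hp
  refine le_trans ?_ (mul_le_mul_of_nonneg_right h1 (norm_nonneg _))
  refine SchwartzMap.seminorm_le_bound ℂ p.1 p.2 f (mul_nonneg (by positivity) (norm_nonneg _))
    fun x => ?_
  refine (mul_le_mul_of_nonneg_left (norm_iteratedFDeriv_le_sum_coord f p.2 x)
    (by positivity)).trans ?_
  rw [Finset.mul_sum]
  have hcard : (n : ℝ) ^ p.2 = ∑ _v : Fin p.2 → Fin n, (1 : ℝ) := by simp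
  rw [hcard, Finset.sum_mul]
  refine Finset.sum_le_sum fun v _ => ?_
  have h2 := (weightedDeriv p.1 p.2 v f).norm_coe_le_norm x
  rw [weightedDeriv_apply, norm_mul, Complex.norm_real, norm_pow, norm_norm] at h2
  rw [one_mul]
  exact h2.trans (norm_le_pi_norm (weightedDerivs s f) ⟨⟨p, hp⟩, v⟩)

theorem continuous_weightedDerivs (s : Finset (ℕ × ℕ)) :
    Continuous (weightedDerivs s : 𝓢(E n, ℂ) → WeightedSpace n s) := by
  refine WithSeminorms.continuous_normedSpace_rng (WeightedSpace n s)
    (schwartz_withSeminorms ℂ (E n) ℂ) (weightedDerivs s) ⟨s, 1, fun f => ?_⟩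
  rw [one_smul]
  exact norm_weightedDerivs_le s f

/-- A tempered distribution is a bounded functional of finitely many weighted derivatives. -/
theorem exists_functional_weightedDerivs (b : 𝓢'(E n, ℂ)) :
    ∃ (s : Finset (ℕ × ℕ)) (l : StrongDual ℂ (WeightedSpace n s)),
      ∀ f, l (weightedDerivs s f) = b f := by
  obtain ⟨s, C, hC0, hC⟩ := exists_bound_distribution b
  obtain ⟨D, hD0, hD⟩ := exists_sup_seminorm_le_norm_weightedDerivs n s
  let W : 𝓢(E n, ℂ) →ₗ[ℂ] WeightedSpace n s := weightedDerivs s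
  have hb : ∀ f, ‖b f‖ ≤ C * D * ‖W f‖ := fun f =>
    (hC f).trans (by rw [mul_assoc]; exact mul_le_mul_of_nonneg_left (hD f) hC0)
  -- The bound shows that `b` factors through `W`. The functional induced on the range of `W` is
  -- bounded and is extended by Hahn-Banach.
  have hker : LinearMap.ker W ≤ LinearMap.ker (b : 𝓢(E n, ℂ) →ₗ[ℂ] ℂ) := fun f hf => by
    have h0 : W f = 0 := hf
    have h1 : ‖W f‖ = 0 := by rw [h0]; exact norm_zero
    have := hb f
    rw [h1, mul_zero] at this
    exact norm_le_zero_iff.1 this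
  let e := LinearMap.quotKerEquivRange W
  let g : LinearMap.range W →ₗ[ℂ] ℂ :=
    ((LinearMap.ker W).liftQ (b : 𝓢(E n, ℂ) →ₗ[ℂ] ℂ) hker) ∘ₗ e.symm.toLinearMap
  have hg : ∀ f, g ⟨W f, LinearMap.mem_range_self W f⟩ = b f := by
    intro f
    have e1 : e.symm ⟨W f, LinearMap.mem_range_self W f⟩ = (LinearMap.ker W).mkQ f := by
      rw [LinearEquiv.symm_apply_eq]
      ext1
      simp [e]
    change ((LinearMap.ker W).liftQ (b : 𝓢(E n, ℂ) →ₗ[ℂ] ℂ) hker) (e.symm _) = _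
    rw [e1]
    rfl
  have hgb : ∀ v, ‖g v‖ ≤ C * D * ‖v‖ := by
    rintro ⟨v, f, rfl⟩
    rw [hg]
    exact hb f
  obtain ⟨l, hl, -⟩ := exists_extension_norm_eq (LinearMap.range W) (g.mkContinuous (C * D) hgb)
  refine ⟨s, l, fun f => ?_⟩
  have := hl ⟨W f, LinearMap.mem_range_self W f⟩
  exact this.trans (hg f)

/-- A tempered distribution may be taken under the integral defining a convolution. -/
theorem distribution_cv (b : 𝓢'(E n, ℂ)) (u h : 𝓢(E n, ℂ)) :
    b (cv u h) = ∫ z, h z * b (translate z u) := by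
  -- The convolution is a superposition of translates of `u`. The Bochner integral is formed in the
  -- Banach space `WeightedSpace`, where the bounded functional `l` commutes with it.
  obtain ⟨s, l, hl⟩ := exists_functional_weightedDerivs b
  obtain ⟨D, m, hD0, hD⟩ := exists_sup_seminorm_translate_le u s
  let F : E n → WeightedSpace n s := fun z => h z • weightedDerivs s (translate z u)
  have hWc : Continuous fun z : E n => weightedDerivs s (translate z u) :=
    (continuous_weightedDerivs s).comp (continuous_translate u)
  -- Spaces of bounded continuous functions need not be separable; strong measurability comes from
  -- the second countability of the domain.
  have : SecondCountableTopologyEither (E n) (WeightedSpace n s) :=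
    secondCountableTopologyEither_of_left _ _
  have hF : Integrable F := by
    have hint : Integrable fun z : E n => D * 2 ^ m * (‖h z‖ + ‖z‖ ^ m * ‖h z‖) :=
      ((h.integrable.norm).add (h.integrable_pow_mul volume m)).const_mul _
    refine hint.mono' (h.continuous.smul hWc).aestronglyMeasurable
      (Eventually.of_forall fun z => ?_)
    have h1 : ‖weightedDerivs s (translate z u)‖ ≤ D * (1 + ‖z‖) ^ m :=
      (norm_weightedDerivs_le s _).trans (hD z)
    have h2 : (1 + ‖z‖) ^ m ≤ 2 ^ m * (1 + ‖z‖ ^ m) :=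
      one_add_pow_le (norm_nonneg z) m
    rw [norm_smul]
    calc ‖h z‖ * ‖weightedDerivs s (translate z u)‖ ≤ ‖h z‖ * (D * (2 ^ m * (1 + ‖z‖ ^ m))) := by
          gcongr; exact h1.trans (by gcongr)
      _ = _ := by ring
  -- Evaluation at a point in each component is continuous, which reduces the identity to the
  -- pointwise formula for derivatives of a convolution.
  have key : weightedDerivs s (cv u h) = ∫ z, F z := by
    funext i
    ext x
    let ev : WeightedSpace n s →L[ℂ] ℂ :=
      (BoundedContinuousFunction.evalCLM ℂ x) ∘L (ContinuousLinearMap.proj i)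
    have h1 : ev (∫ z, F z) = ∫ z, ev (F z) := (ev.integral_comp_comm hF).symm
    change ev (weightedDerivs s (cv u h)) = ev (∫ z, F z)
    rw [h1]
    change ((‖x‖ ^ i.1.1.1 : ℝ) : ℂ) * (∂^{fun j => coordVec (i.2 j)} (cv u h) : 𝓢(E n, ℂ)) x =
      ∫ z, h z * (((‖x‖ ^ i.1.1.1 : ℝ) : ℂ) *
        (∂^{fun j => coordVec (i.2 j)} (translate z u) : 𝓢(E n, ℂ)) x)
    simp only [iteratedLineDerivOp_eq_iteratedFDeriv, iteratedFDeriv_translate,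
      iteratedFDeriv_cv_apply]
    rw [← integral_const_mul]
    congr 1 with z
    ring
  have h2 : l (∫ z, F z) = ∫ z, l (F z) := (l.integral_comp_comm hF).symm
  rw [← hl, key, h2]
  congr 1 with z
  rw [map_smul, hl, smul_eq_mul]

/-! ### Kernels of products sandwiched between convolutions -/

/-- The kernel of `f ↦ u * (B (v * f))`. -/
noncomputable def sandwich (B : E n → ℂ) (u v : 𝓢(E n, ℂ)) (p : E n × E n) : ℂ :=
  ∫ z, u (p.1 - z) * B z * v (z - p.2)

theorem norm_le_seminorm_zero (v : 𝓢(E n, ℂ)) (x : E n) : ‖v x‖ ≤ SchwartzMap.seminorm ℂ 0 0 v :=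
  SchwartzMap.norm_le_seminorm ℂ v x

/-- The absolute moment `∫ ‖x‖ ^ N ‖u x‖`. -/
noncomputable def absMoment (N : ℕ) (u : 𝓢(E n, ℂ)) : ℝ := ∫ x, ‖x‖ ^ N * ‖u x‖

theorem absMoment_nonneg (N : ℕ) (u : 𝓢(E n, ℂ)) : 0 ≤ absMoment N u :=
  integral_nonneg fun _ => by positivity

theorem absMoment_zero (u : 𝓢(E n, ℂ)) : absMoment 0 u = normL1 u := by
  simp [absMoment, normL1]

theorem integral_dyadic_change (k : ℤ) {F : Type*} [NormedAddCommGroup F] [NormedSpace ℝ F]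
    (g : E n → F) : ∫ x, (2 : ℝ) ^ (k * (n : ℤ)) • g ((2 : ℝ) ^ k • x) = ∫ x, g x := by
  have h2 : (0 : ℝ) < 2 ^ k := by positivity
  rw [integral_smul, Measure.integral_comp_smul, finrank_euclideanSpace, Fintype.card_fin,
    smul_smul, abs_of_pos (by positivity), zpow_mul, zpow_natCast,
    mul_inv_cancel₀ (pow_ne_zero _ h2.ne'), one_smul]

theorem absMoment_dyadic (N : ℕ) (k : ℤ) (u : 𝓢(E n, ℂ)) :
    absMoment N (dyadic k u) = ((2 : ℝ) ^ k)⁻¹ ^ N * absMoment N u := by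
  have h2 : (0 : ℝ) < 2 ^ k := by positivity
  rw [absMoment, absMoment, ← integral_const_mul,
    ← integral_dyadic_change k (fun x : E n => ((2 : ℝ) ^ k)⁻¹ ^ N * (‖x‖ ^ N * ‖u x‖))]
  congr 1 with x
  rw [dyadic_apply, norm_mul, Complex.norm_real, Real.norm_of_nonneg (by positivity), norm_smul,
    Real.norm_of_nonneg h2.le, smul_eq_mul, mul_pow]
  have : ((2 : ℝ) ^ k)⁻¹ ^ N * (2 ^ k) ^ N = 1 := by
    rw [← mul_pow, inv_mul_cancel₀ h2.ne', one_pow]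
  linear_combination (-(2 : ℝ) ^ (k * (n : ℤ)) * ‖x‖ ^ N * ‖u ((2 : ℝ) ^ k • x)‖) * this

theorem normL1_dyadic (k : ℤ) (u : 𝓢(E n, ℂ)) : normL1 (dyadic k u) = normL1 u := by
  simpa [absMoment_zero] using absMoment_dyadic 0 k u

theorem seminorm_zero_dyadic_le (k : ℤ) (u : 𝓢(E n, ℂ)) :
    SchwartzMap.seminorm ℂ 0 0 (dyadic k u) ≤ 2 ^ (k * (n : ℤ)) * SchwartzMap.seminorm ℂ 0 0 u := by
  refine SchwartzMap.seminorm_le_bound ℂ 0 0 _ (by positivity) fun x => ?_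
  rw [pow_zero, one_mul, norm_iteratedFDeriv_zero, dyadic_apply, norm_mul, Complex.norm_real,
    Real.norm_of_nonneg (by positivity)]
  gcongr
  exact norm_le_seminorm_zero u _

/-! ### Size and decay of sandwich kernels -/

section bounds

variable {B : E n → ℂ} {D : ℝ}

theorem continuous_sandwich_integrand (hB : Continuous B) (u v : 𝓢(E n, ℂ)) (p : E n × E n) :
    Continuous fun z => u (p.1 - z) * B z * v (z - p.2) := by
  have := u.continuous
  have := v.continuous
  fun_prop

theorem norm_sandwich_integrand_le (hD : ∀ z, ‖B z‖ ≤ D) (u v : 𝓢(E n, ℂ)) (p : E n × E n)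
    (z : E n) : ‖u (p.1 - z) * B z * v (z - p.2)‖ ≤ D * (‖u (p.1 - z)‖ * ‖v (z - p.2)‖) := by
  rw [norm_mul, norm_mul]
  calc _ ≤ ‖u (p.1 - z)‖ * D * ‖v (z - p.2)‖ := by gcongr; exact hD z
    _ = _ := by ring

theorem integrable_sandwich (hB : Continuous B) (hD : ∀ z, ‖B z‖ ≤ D) (u v : 𝓢(E n, ℂ))
    (p : E n × E n) : Integrable fun z => u (p.1 - z) * B z * v (z - p.2) := by
  have hD0 : 0 ≤ D := (norm_nonneg _).trans (hD 0)
  have h1 : Integrable fun z => D * (‖u (p.1 - z)‖ * SchwartzMap.seminorm ℂ 0 0 v) :=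
    (((u.integrable.comp_sub_left p.1).norm).mul_const _).const_mul D
  refine h1.mono' (continuous_sandwich_integrand hB u v p).aestronglyMeasurable
    (Eventually.of_forall fun z => (norm_sandwich_integrand_le hD u v p z).trans ?_)
  gcongr
  exact norm_le_seminorm_zero v _

theorem norm_sandwich_le (hD : ∀ z, ‖B z‖ ≤ D) (u v : 𝓢(E n, ℂ)) (p : E n × E n) :
    ‖sandwich B u v p‖ ≤ D * (normL1 u * SchwartzMap.seminorm ℂ 0 0 v) := by
  have hD0 : 0 ≤ D := (norm_nonneg _).trans (hD 0)
  have h1 : Integrable fun z => D * (‖u (p.1 - z)‖ * SchwartzMap.seminorm ℂ 0 0 v) :=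
    (((u.integrable.comp_sub_left p.1).norm).mul_const _).const_mul D
  refine (norm_integral_le_of_norm_le h1 (Eventually.of_forall fun z =>
    (norm_sandwich_integrand_le hD u v p z).trans ?_)).trans_eq ?_
  · gcongr
    exact norm_le_seminorm_zero v _
  · rw [integral_const_mul, integral_mul_const, integral_sub_left_eq_self (fun z => ‖u z‖)]
    rfl

/-- One of `x - z` and `z - y` is at least half as long as `x - y`, so the weight `‖x - y‖^N` is
distributed over the two outer factors and absorbed by their absolute moments. -/
theorem norm_sandwich_decay_le (hD : ∀ z, ‖B z‖ ≤ D) (u v : 𝓢(E n, ℂ)) (N : ℕ) (p : E n × E n) :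
    ‖p.1 - p.2‖ ^ N * ‖sandwich B u v p‖ ≤ D * (2 ^ N * (absMoment N u *
      SchwartzMap.seminorm ℂ 0 0 v + SchwartzMap.seminorm ℂ 0 0 u * absMoment N v)) := by
  have hD0 : 0 ≤ D := (norm_nonneg _).trans (hD 0)
  have iu : Integrable fun z => ‖p.1 - z‖ ^ N * ‖u (p.1 - z)‖ :=
    (u.integrable_pow_mul volume N).comp_sub_left p.1
  have iv : Integrable fun z => ‖z - p.2‖ ^ N * ‖v (z - p.2)‖ :=
    (v.integrable_pow_mul volume N).comp_sub_right p.2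
  have h1 : Integrable fun z => D * (2 ^ N * (‖p.1 - z‖ ^ N * ‖u (p.1 - z)‖ *
      SchwartzMap.seminorm ℂ 0 0 v + SchwartzMap.seminorm ℂ 0 0 u *
        (‖z - p.2‖ ^ N * ‖v (z - p.2)‖))) :=
    (((iu.mul_const _).add (iv.const_mul _)).const_mul _).const_mul _
  have e : ‖p.1 - p.2‖ ^ N * ‖sandwich B u v p‖ =
      ‖∫ z, ((‖p.1 - p.2‖ ^ N : ℝ) : ℂ) * (u (p.1 - z) * B z * v (z - p.2))‖ := by
    rw [integral_const_mul, norm_mul, Complex.norm_real, Real.norm_of_nonneg (by positivity)]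
    rfl
  rw [e]
  refine (norm_integral_le_of_norm_le h1 (Eventually.of_forall fun z => ?_)).trans_eq ?_
  · rw [norm_mul, Complex.norm_real, Real.norm_of_nonneg (by positivity)]
    have t : ‖p.1 - p.2‖ ^ N ≤ 2 ^ N * (‖p.1 - z‖ ^ N + ‖z - p.2‖ ^ N) := by
      have t1 : ‖p.1 - p.2‖ ≤ ‖p.1 - z‖ + ‖z - p.2‖ := norm_sub_le_norm_sub_add_norm_sub _ _ _
      calc ‖p.1 - p.2‖ ^ N ≤ (2 * max ‖p.1 - z‖ ‖z - p.2‖) ^ N := by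
            gcongr
            linarith [le_max_left ‖p.1 - z‖ ‖z - p.2‖, le_max_right ‖p.1 - z‖ ‖z - p.2‖]
        _ ≤ _ := by
            rw [mul_pow]
            gcongr
            rcases max_cases ‖p.1 - z‖ ‖z - p.2‖ with ⟨h, -⟩ | ⟨h, -⟩ <;> rw [h]
            · exact le_add_of_nonneg_right (by positivity)
            · exact le_add_of_nonneg_left (by positivity)
    calc _ ≤ (2 ^ N * (‖p.1 - z‖ ^ N + ‖z - p.2‖ ^ N)) *
          (D * (‖u (p.1 - z)‖ * ‖v (z - p.2)‖)) := by
          gcongr; exact norm_sandwich_integrand_le hD u v p z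
      _ = D * (2 ^ N * (‖p.1 - z‖ ^ N * ‖u (p.1 - z)‖ * ‖v (z - p.2)‖ +
          ‖u (p.1 - z)‖ * (‖z - p.2‖ ^ N * ‖v (z - p.2)‖))) := by ring
      _ ≤ _ := by
          gcongr
          · exact norm_le_seminorm_zero v _
          · exact norm_le_seminorm_zero u _
  · rw [integral_const_mul, integral_const_mul, integral_add (iu.mul_const _) (iv.const_mul _),
      integral_mul_const, integral_const_mul,
      integral_sub_left_eq_self (fun z => ‖z‖ ^ N * ‖u z‖),
      integral_sub_right_eq_self (fun z => ‖z‖ ^ N * ‖v z‖)]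
    rfl

/-- Size and decay of the kernels at scale `2 ^ (-k)`. -/
theorem exists_norm_sandwich_dyadic_le (u v : 𝓢(E n, ℂ)) (N : ℕ) : ∃ C : ℝ, 0 ≤ C ∧
    ∀ (B : E n → ℂ) (D : ℝ), (∀ z, ‖B z‖ ≤ D) → ∀ (k : ℤ) (p : E n × E n),
      ‖sandwich B (dyadic k u) (dyadic k v) p‖ ≤ C * D * 2 ^ (k * (n : ℤ)) ∧
      (2 ^ k * ‖p.1 - p.2‖) ^ N * ‖sandwich B (dyadic k u) (dyadic k v) p‖ ≤
        C * D * 2 ^ (k * (n : ℤ)) := by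
  set a := normL1 u * SchwartzMap.seminorm ℂ 0 0 v
  set b := 2 ^ N * (absMoment N u * SchwartzMap.seminorm ℂ 0 0 v +
    SchwartzMap.seminorm ℂ 0 0 u * absMoment N v)
  have ha : 0 ≤ a := mul_nonneg (normL1_nonneg u) (apply_nonneg _ _)
  have hb : 0 ≤ b := by
    have := absMoment_nonneg N u
    have := absMoment_nonneg N v
    positivity
  refine ⟨a + b, by positivity, fun B D hD k p => ⟨?_, ?_⟩⟩
  · have hD0 : 0 ≤ D := (norm_nonneg _).trans (hD 0)
    refine (norm_sandwich_le hD _ _ p).trans ?_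
    rw [normL1_dyadic]
    calc D * (normL1 u * SchwartzMap.seminorm ℂ 0 0 (dyadic k v)) ≤
        D * (normL1 u * (2 ^ (k * (n : ℤ)) * SchwartzMap.seminorm ℂ 0 0 v)) := by
          have := normL1_nonneg u
          gcongr
          exact seminorm_zero_dyadic_le k v
      _ = a * D * 2 ^ (k * (n : ℤ)) := by ring
      _ ≤ _ := by gcongr; linarith
  · have hD0 : 0 ≤ D := (norm_nonneg _).trans (hD 0)
    have h2 : (0 : ℝ) < 2 ^ k := by positivity
    have iu := absMoment_nonneg N u
    have iv := absMoment_nonneg N v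
    have e : ((2 : ℝ) ^ k) ^ N * ((2 : ℝ) ^ k)⁻¹ ^ N = 1 := by
      rw [← mul_pow, mul_inv_cancel₀ h2.ne', one_pow]
    rw [mul_pow, mul_assoc]
    calc _ ≤ ((2 : ℝ) ^ k) ^ N * (D * (2 ^ N * (absMoment N (dyadic k u) *
          SchwartzMap.seminorm ℂ 0 0 (dyadic k v) + SchwartzMap.seminorm ℂ 0 0 (dyadic k u) *
            absMoment N (dyadic k v)))) := by
          exact mul_le_mul_of_nonneg_left (norm_sandwich_decay_le hD _ _ N p) (by positivity)
      _ ≤ ((2 : ℝ) ^ k) ^ N * (D * (2 ^ N * ((((2 : ℝ) ^ k)⁻¹ ^ N * absMoment N u) *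
          (2 ^ (k * (n : ℤ)) * SchwartzMap.seminorm ℂ 0 0 v) +
          (2 ^ (k * (n : ℤ)) * SchwartzMap.seminorm ℂ 0 0 u) *
            (((2 : ℝ) ^ k)⁻¹ ^ N * absMoment N v)))) := by
          rw [absMoment_dyadic, absMoment_dyadic]
          gcongr
          · exact seminorm_zero_dyadic_le k v
          · exact seminorm_zero_dyadic_le k u
      _ = b * D * 2 ^ (k * (n : ℤ)) := by
          linear_combination (b * D * 2 ^ (k * (n : ℤ))) * e
      _ ≤ _ := by gcongr; linarith

end bounds

/-! ### Linearity -/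

theorem sandwich_smul_left (B : E n → ℂ) (c : ℂ) (u v : 𝓢(E n, ℂ)) (p : E n × E n) :
    sandwich B (c • u) v p = c * sandwich B u v p := by
  simp only [sandwich, _root_.smul_apply, smul_eq_mul]
  rw [← integral_const_mul]
  congr 1 with z
  ring

theorem sandwich_smul_right (B : E n → ℂ) (c : ℂ) (u v : 𝓢(E n, ℂ)) (p : E n × E n) :
    sandwich B u (c • v) p = c * sandwich B u v p := by
  simp only [sandwich, _root_.smul_apply, smul_eq_mul]
  rw [← integral_const_mul]
  congr 1 with z
  ring

theorem sandwich_const_mul (B : E n → ℂ) (c : ℂ) (u v : 𝓢(E n, ℂ)) (p : E n × E n) :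
    sandwich (fun z => c * B z) u v p = c * sandwich B u v p := by
  simp only [sandwich]
  rw [← integral_const_mul]
  congr 1 with z
  ring

theorem sandwich_sum_left {B : E n → ℂ} {D : ℝ} (hB : Continuous B) (hD : ∀ z, ‖B z‖ ≤ D)
    {ι : Type*} (s : Finset ι) (u : ι → 𝓢(E n, ℂ)) (v : 𝓢(E n, ℂ)) (p : E n × E n) :
    sandwich B (∑ i ∈ s, u i) v p = ∑ i ∈ s, sandwich B (u i) v p := by
  simp only [sandwich, _root_.sum_apply, Finset.sum_mul]
  exact integral_finsetSum _ fun i _ => integrable_sandwich hB hD (u i) v p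

theorem lineDeriv_dyadic (k : ℤ) (i : Fin n) (u : 𝓢(E n, ℂ)) :
    ∂_{coordVec i} (dyadic k u) = (((2 : ℝ) ^ k : ℝ) : ℂ) • dyadic k (∂_{coordVec i} u) := by
  ext x
  rw [_root_.smul_apply, dyadic_apply, SchwartzMap.lineDerivOp_apply_eq_fderiv,
    SchwartzMap.lineDerivOp_apply_eq_fderiv]
  have e : (dyadic k u : E n → ℂ) = fun x => (((2 : ℝ) ^ (k * (n : ℤ)) : ℝ) : ℂ) *
      u ((2 : ℝ) ^ k • x) := by
    funext x; exact dyadic_apply k u x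
  have hd : HasFDerivAt (fun x : E n => u ((2 : ℝ) ^ k • x))
      ((fderiv ℝ u ((2 : ℝ) ^ k • x)).comp ((2 : ℝ) ^ k • ContinuousLinearMap.id ℝ (E n))) x :=
    (u.differentiableAt (x := (2 : ℝ) ^ k • x)).hasFDerivAt.comp x
      ((2 : ℝ) ^ k • ContinuousLinearMap.id ℝ (E n)).hasFDerivAt
  rw [e, (hd.const_mul _).fderiv]
  simp
  ring

/-! ### Differentiability -/

/-- The `i`-th coordinate of the first factor of `ℝⁿ × ℝⁿ`. -/
noncomputable def fstCoord (i : Fin n) : E n × E n →L[ℝ] ℂ :=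
  Complex.ofRealCLM ∘L (EuclideanSpace.proj (𝕜 := ℝ) i : E n →L[ℝ] ℝ) ∘L
    ContinuousLinearMap.fst ℝ (E n) (E n)

/-- The `i`-th coordinate of the second factor of `ℝⁿ × ℝⁿ`. -/
noncomputable def sndCoord (i : Fin n) : E n × E n →L[ℝ] ℂ :=
  Complex.ofRealCLM ∘L (EuclideanSpace.proj (𝕜 := ℝ) i : E n →L[ℝ] ℝ) ∘L
    ContinuousLinearMap.snd ℝ (E n) (E n)

theorem fstCoord_apply (i : Fin n) (w : E n × E n) : fstCoord i w = ((w.1 i : ℝ) : ℂ) := rfl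

theorem sndCoord_apply (i : Fin n) (w : E n × E n) : sndCoord i w = ((w.2 i : ℝ) : ℂ) := rfl

theorem norm_fstCoord_le (i : Fin n) : ‖(fstCoord i : E n × E n →L[ℝ] ℂ)‖ ≤ 1 := by
  refine ContinuousLinearMap.opNorm_le_bound _ zero_le_one fun w => ?_
  rw [fstCoord_apply, Complex.norm_real, one_mul]
  exact (PiLp.norm_apply_le w.1 i).trans (norm_fst_le w)

theorem norm_sndCoord_le (i : Fin n) : ‖(sndCoord i : E n × E n →L[ℝ] ℂ)‖ ≤ 1 := by
  refine ContinuousLinearMap.opNorm_le_bound _ zero_le_one fun w => ?_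
  rw [sndCoord_apply, Complex.norm_real, one_mul]
  exact (PiLp.norm_apply_le w.2 i).trans (norm_snd_le w)

theorem fderiv_eq_sum_coord (u : 𝓢(E n, ℂ)) (x w : E n) :
    fderiv ℝ u x w = ∑ i, ((w i : ℝ) : ℂ) * (∂_{coordVec i} u : 𝓢(E n, ℂ)) x := by
  have hw : w = ∑ i, w i • (coordVec i : E n) := by
    ext j
    simp [Finset.sum_apply, Pi.single_apply]
  conv_lhs => rw [hw]
  rw [map_sum]
  refine Finset.sum_congr rfl fun i _ => ?_
  rw [map_smul, SchwartzMap.lineDerivOp_apply_eq_fderiv, Complex.real_smul]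

/-- A Schwartz function is dominated near each point by one integrable function. -/
theorem exists_integrable_majorant (u : 𝓢(E n, ℂ)) : ∃ G : E n → ℝ, Integrable G ∧
    ∀ x y : E n, ‖x - y‖ ≤ 1 → ‖u y‖ ≤ G x := by
  -- The exponent `n + 1` is the least integer for which `(1 + ‖x‖)^(-m)` is integrable on `ℝⁿ`.
  let m : ℕ := n + 1
  obtain ⟨C, hC⟩ : ∃ C : ℝ, ∀ y, (1 + ‖y‖) ^ m * ‖u y‖ ≤ C := by
    refine ⟨2 ^ m * (Finset.Iic (m, 0)).sup (fun m => SchwartzMap.seminorm ℂ m.1 m.2) u,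
      fun y => ?_⟩
    have := SchwartzMap.one_add_le_sup_seminorm_apply (𝕜 := ℂ) (m := (m, 0)) (k := m) (n := 0)
      le_rfl le_rfl u y
    rwa [norm_iteratedFDeriv_zero] at this
  refine ⟨fun x => C * 2 ^ m * (1 + ‖x‖) ^ (-(m : ℝ)),
    (integrable_one_add_norm (by simp [m])).const_mul _, fun x y hxy => ?_⟩
  have h1 : 1 + ‖x‖ ≤ 2 * (1 + ‖y‖) := by
    have := norm_le_norm_add_norm_sub' x y
    linarith [norm_nonneg y]
  have hx : 0 < (1 + ‖x‖) ^ m := by positivity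
  beta_reduce
  rw [Real.rpow_neg (by positivity), Real.rpow_natCast, ← div_eq_mul_inv, le_div_iff₀ hx]
  calc ‖u y‖ * (1 + ‖x‖) ^ m ≤ ‖u y‖ * (2 * (1 + ‖y‖)) ^ m := by gcongr
    _ = 2 ^ m * ((1 + ‖y‖) ^ m * ‖u y‖) := by rw [mul_pow]; ring
    _ ≤ 2 ^ m * C := by gcongr; exact hC y
    _ = C * 2 ^ m := mul_comm _ _

/-- The derivative of a sandwich kernel. -/
noncomputable def sandwichDeriv (B : E n → ℂ) (u v : 𝓢(E n, ℂ)) (p : E n × E n) :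
    E n × E n →L[ℝ] ℂ :=
  ∑ i, (sandwich B (∂_{coordVec i} u) v p • fstCoord i -
    sandwich B u (∂_{coordVec i} v) p • sndCoord i)

/-- Differentiation under the integral sign: derivatives in `x` fall on `u`, derivatives in `y` fall
on `v` with a minus sign, and `B`, which is only continuous, is never differentiated. Domination
over a unit ball uses integrable majorants of `u` and its derivatives and sup bounds for `v`. -/
theorem hasFDerivAt_sandwich {B : E n → ℂ} {D : ℝ} (hB : Continuous B) (hD : ∀ z, ‖B z‖ ≤ D)
    (u v : 𝓢(E n, ℂ)) (p : E n × E n) :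
    HasFDerivAt (sandwich B u v) (sandwichDeriv B u v p) p := by
  have hD0 : 0 ≤ D := (norm_nonneg _).trans (hD 0)
  let F' : E n × E n → E n → E n × E n →L[ℝ] ℂ := fun q z =>
    ∑ i, (((∂_{coordVec i} u : 𝓢(E n, ℂ)) (q.1 - z) * B z * v (z - q.2)) • fstCoord i -
      (u (q.1 - z) * B z * (∂_{coordVec i} v : 𝓢(E n, ℂ)) (z - q.2)) • sndCoord i)
  obtain ⟨G, hGi, hG⟩ := exists_integrable_majorant u
  choose G' hGi' hG' using fun i : Fin n => exists_integrable_majorant (∂_{coordVec i} u : 𝓢(E n, ℂ))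
  let S := SchwartzMap.seminorm ℂ 0 0 v
  let S' : Fin n → ℝ := fun i => SchwartzMap.seminorm ℂ 0 0 (∂_{coordVec i} v : 𝓢(E n, ℂ))
  have key := hasFDerivAt_integral_of_dominated_of_fderiv_le (𝕜 := ℝ) (μ := volume)
    (F := fun q z => u (q.1 - z) * B z * v (z - q.2)) (F' := F') (x₀ := p)
    (s := Metric.ball p 1)
    (bound := fun z => ∑ i, (D * (G' i (p.1 - z) * S) + D * (G (p.1 - z) * S' i)))
    (Metric.ball_mem_nhds p one_pos)
    (Eventually.of_forall fun q => (continuous_sandwich_integrand hB u v q).aestronglyMeasurable)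
    (integrable_sandwich hB hD u v p) ?_ ?_ ?_ ?_
  · have e : ∫ z, F' p z = sandwichDeriv B u v p := by
      rw [integral_finsetSum]
      · refine Finset.sum_congr rfl fun i _ => ?_
        rw [integral_sub, integral_smul_const, integral_smul_const]
        · rfl
        · exact (integrable_sandwich hB hD _ v p).smul_const _
        · exact (integrable_sandwich hB hD u _ p).smul_const _
      · intro i _
        exact ((integrable_sandwich hB hD _ v p).smul_const _).sub
          ((integrable_sandwich hB hD u _ p).smul_const _)
    rw [← e]
    exact key
  · refine Continuous.aestronglyMeasurable ?_
    refine continuous_finsetSum _ fun i _ => ?_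
    exact ((continuous_sandwich_integrand hB _ v p).smul continuous_const).sub
      ((continuous_sandwich_integrand hB u _ p).smul continuous_const)
  · refine Eventually.of_forall fun z q hq => ?_
    have hq1 : ‖p.1 - z - (q.1 - z)‖ ≤ 1 := by
      have : ‖(q - p).1‖ ≤ ‖q - p‖ := norm_fst_le _
      rw [Metric.mem_ball, dist_eq_norm] at hq
      rw [sub_sub_sub_cancel_right, norm_sub_rev]
      exact (this.trans hq.le)
    refine (norm_sum_le _ _).trans (Finset.sum_le_sum fun i _ => (norm_sub_le _ _).trans ?_)
    rw [norm_smul, norm_smul]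
    refine add_le_add ?_ ?_
    · refine (mul_le_of_le_one_right (norm_nonneg _) (norm_fstCoord_le i)).trans
        ((norm_sandwich_integrand_le hD _ v q z).trans ?_)
      gcongr
      · exact (norm_nonneg _).trans (hG' i _ _ hq1)
      · exact hG' i _ _ hq1
      · exact norm_le_seminorm_zero v _
    · refine (mul_le_of_le_one_right (norm_nonneg _) (norm_sndCoord_le i)).trans
        ((norm_sandwich_integrand_le hD u _ q z).trans ?_)
      gcongr
      · exact (norm_nonneg _).trans (hG _ _ hq1)
      · exact hG _ _ hq1
      · exact norm_le_seminorm_zero _ _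
  · refine integrable_finsetSum _ fun i _ => ?_
    exact ((((hGi' i).comp_sub_left p.1).mul_const _).const_mul _).add
      (((hGi.comp_sub_left p.1).mul_const _).const_mul _)
  · refine Eventually.of_forall fun z q _ => ?_
    have h1 : HasFDerivAt (fun q : E n × E n => u (q.1 - z))
        ((fderiv ℝ u (q.1 - z)).comp (ContinuousLinearMap.fst ℝ (E n) (E n))) q :=
      (u.differentiableAt (x := q.1 - z)).hasFDerivAt.comp q (hasFDerivAt_fst.sub_const z)
    have h2 : HasFDerivAt (fun q : E n × E n => v (z - q.2))
        ((fderiv ℝ v (z - q.2)).comp (-ContinuousLinearMap.snd ℝ (E n) (E n))) q :=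
      (v.differentiableAt (x := z - q.2)).hasFDerivAt.comp q (hasFDerivAt_snd.const_sub z)
    have h3 := (h1.mul_const (B z)).mul h2
    refine h3.congr_fderiv ?_
    refine ContinuousLinearMap.ext fun w => ?_
    simp only [F', _root_.add_apply, _root_.smul_apply,
      ContinuousLinearMap.comp_apply, _root_.sum_apply, _root_.sub_apply,
      fstCoord_apply, sndCoord_apply, _root_.neg_apply, smul_eq_mul, map_neg,
      ContinuousLinearMap.coe_fst', ContinuousLinearMap.coe_snd', fderiv_eq_sum_coord]
    simp only [Finset.mul_sum, ← Finset.sum_neg_distrib, ← Finset.sum_add_distrib]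
    refine Finset.sum_congr rfl fun i _ => ?_
    ring

instance : (volume : Measure (E n × E n)).IsAddHaarMeasure :=
  Measure.prod.instIsAddHaarMeasure (volume : Measure (E n)) (volume : Measure (E n))

/-! ### Pairing sandwich kernels with Schwartz functions -/

/-- The pairing of a sandwich kernel with a Schwartz function. -/
noncomputable def layer (B : E n → ℂ) (u v : 𝓢(E n, ℂ)) (F : 𝓢(E n × E n, ℂ)) : ℂ :=
  ∫ p, sandwich B u v p * F p

section layer

variable {B : E n → ℂ} {D : ℝ}

theorem continuous_sandwich (hB : Continuous B) (hD : ∀ z, ‖B z‖ ≤ D) (u v : 𝓢(E n, ℂ)) :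
    Continuous (sandwich B u v) :=
  continuous_iff_continuousAt.2 fun p => (hasFDerivAt_sandwich hB hD u v p).continuousAt

theorem integrable_sandwich_mul (hB : Continuous B) (hD : ∀ z, ‖B z‖ ≤ D) (u v : 𝓢(E n, ℂ))
    (F : 𝓢(E n × E n, ℂ)) : Integrable fun p => sandwich B u v p * F p :=
  F.integrable.bdd_mul (continuous_sandwich hB hD u v).aestronglyMeasurable
    (Eventually.of_forall fun p => norm_sandwich_le hD u v p)

theorem layer_add (hB : Continuous B) (hD : ∀ z, ‖B z‖ ≤ D) (u v : 𝓢(E n, ℂ))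
    (F G : 𝓢(E n × E n, ℂ)) : layer B u v (F + G) = layer B u v F + layer B u v G := by
  rw [layer, layer, layer, ← integral_add (integrable_sandwich_mul hB hD u v F)
    (integrable_sandwich_mul hB hD u v G)]
  congr 1 with p
  rw [_root_.add_apply, mul_add]

theorem layer_smul (B : E n → ℂ) (u v : 𝓢(E n, ℂ)) (c : ℂ) (F : 𝓢(E n × E n, ℂ)) :
    layer B u v (c • F) = c * layer B u v F := by
  rw [layer, layer, ← integral_const_mul]
  congr 1 with p
  rw [_root_.smul_apply, smul_eq_mul]
  ring

theorem layer_smul_left (B : E n → ℂ) (c : ℂ) (u v : 𝓢(E n, ℂ)) (F : 𝓢(E n × E n, ℂ)) :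
    layer B (c • u) v F = c * layer B u v F := by
  simp only [layer, sandwich_smul_left, mul_assoc, integral_const_mul]

theorem layer_sum_left (hB : Continuous B) (hD : ∀ z, ‖B z‖ ≤ D) {ι : Type*} (s : Finset ι)
    (u : ι → 𝓢(E n, ℂ)) (v : 𝓢(E n, ℂ)) (F : 𝓢(E n × E n, ℂ)) :
    layer B (∑ i ∈ s, u i) v F = ∑ i ∈ s, layer B (u i) v F := by
  simp only [layer, sandwich_sum_left hB hD, Finset.sum_mul]
  exact integral_finsetSum _ fun i _ => integrable_sandwich_mul hB hD (u i) v F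

theorem norm_layer_le {A : ℝ} {u v : 𝓢(E n, ℂ)} (hA : ∀ p, ‖sandwich B u v p‖ ≤ A)
    (F : 𝓢(E n × E n, ℂ)) : ‖layer B u v F‖ ≤ A * normL1 F := by
  rw [normL1, ← integral_const_mul]
  refine norm_integral_le_of_norm_le (F.integrable.norm.const_mul _)
    (Eventually.of_forall fun p => ?_)
  rw [norm_mul]
  gcongr
  exact hA p

/-- Integration by parts in the first variable. It is the mechanism that moves the oscillation of
`u` onto the test function. -/
theorem layer_lineDeriv_left (hB : Continuous B) (hD : ∀ z, ‖B z‖ ≤ D) (i : Fin n)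
    (u v : 𝓢(E n, ℂ)) (F : 𝓢(E n × E n, ℂ)) :
    layer B (∂_{coordVec i} u) v F = -layer B u v (∂_{((coordVec i : E n), (0 : E n))} F) := by
  have e : ∀ p, fderiv ℝ (sandwich B u v) p ((coordVec i : E n), (0 : E n)) =
      sandwich B (∂_{coordVec i} u) v p := by
    intro p
    rw [(hasFDerivAt_sandwich hB hD u v p).fderiv, sandwichDeriv]
    simp [fstCoord_apply, sndCoord_apply, apply_ite Complex.ofReal]
  have e' : ∀ p, (∂_{((coordVec i : E n), (0 : E n))} F : 𝓢(E n × E n, ℂ)) p =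
      fderiv ℝ F p ((coordVec i : E n), (0 : E n)) := fun p => rfl
  have h := integral_mul_fderiv_eq_neg_fderiv_mul_of_integrable (μ := (volume : Measure (E n × E n)))
    (f := sandwich B u v) (g := F) (v := ((coordVec i : E n), (0 : E n))) ?_ ?_
    (integrable_sandwich_mul hB hD u v F)
    (fun p _ => (hasFDerivAt_sandwich hB hD u v p).differentiableAt)
    (fun p _ => F.differentiableAt)
  · rw [layer, layer]
    simp only [e'] 
    rw [h, neg_neg]
    simp only [e]
  · simp only [e]
    exact integrable_sandwich_mul hB hD _ v F
  · simp only [← e']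
    exact integrable_sandwich_mul hB hD u v _

theorem layer_lineDeriv_iterate_left (hB : Continuous B) (hD : ∀ z, ‖B z‖ ≤ D) (i : Fin n) (N : ℕ)
    (u v : 𝓢(E n, ℂ)) (F : 𝓢(E n × E n, ℂ)) :
    layer B ((fun g : 𝓢(E n, ℂ) => ∂_{coordVec i} g)^[N] u) v F = (-1) ^ N *
      layer B u v ((fun G : 𝓢(E n × E n, ℂ) => ∂_{((coordVec i : E n), (0 : E n))} G)^[N] F) := by
  induction N generalizing u with
  | zero => simp
  | succ N ih =>
    rw [Function.iterate_succ_apply, ih, layer_lineDeriv_left hB hD,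
      Function.iterate_succ_apply' _ N F]
    ring

/-- Fubini's theorem with the intermediate variable `z` integrated last. The factors containing `x`
and `y` then separate into two convolutions. -/
theorem layer_tensor (hB : Continuous B) (hD : ∀ z, ‖B z‖ ≤ D) (u v g f : 𝓢(E n, ℂ)) :
    layer B u v (tensor g f) = ∫ z, B z * (cv (reflect u) g z * cv v f z) := by
  have hD0 : 0 ≤ D := (norm_nonneg _).trans (hD 0)
  have hm : Continuous (Function.uncurry fun (p : E n × E n) (z : E n) =>
      u (p.1 - z) * B z * v (z - p.2) * (g p.1 * f p.2)) := by
    have := u.continuous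
    have := v.continuous
    have := g.continuous
    have := f.continuous
    unfold Function.uncurry
    fun_prop
  have hint : Integrable (Function.uncurry fun (p : E n × E n) (z : E n) =>
      u (p.1 - z) * B z * v (z - p.2) * (g p.1 * f p.2))
      ((volume : Measure (E n × E n)).prod (volume : Measure (E n))) := by
    rw [integrable_prod_iff hm.aestronglyMeasurable]
    refine ⟨Eventually.of_forall fun p => ?_, ?_⟩
    · have := (integrable_sandwich hB hD u v p).mul_const (g p.1 * f p.2)
      simpa only [Function.uncurry] using this
    have h0 : Integrable (fun p : E n × E n => D * (normL1 u * SchwartzMap.seminorm ℂ 0 0 v) *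
        ‖tensor g f p‖) (volume.prod volume) :=
      ((tensor g f).integrable (μ := volume)).norm.const_mul _
    refine h0.mono' (hm.norm.stronglyMeasurable.integral_prod_right (ν := volume)).aestronglyMeasurable
      (Eventually.of_forall fun p => ?_)
    have h1 : Integrable fun z => D * (‖u (p.1 - z)‖ * SchwartzMap.seminorm ℂ 0 0 v) :=
      (((u.integrable.comp_sub_left p.1).norm).mul_const _).const_mul D
    have e : ∀ z, ‖(Function.uncurry fun (p : E n × E n) (z : E n) =>
        u (p.1 - z) * B z * v (z - p.2) * (g p.1 * f p.2)) (p, z)‖ =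
        ‖u (p.1 - z) * B z * v (z - p.2)‖ * ‖tensor g f p‖ := fun z => norm_mul _ _
    rw [integral_congr_ae (Eventually.of_forall e), integral_mul_const,
      Real.norm_of_nonneg (mul_nonneg (integral_nonneg fun _ => norm_nonneg _) (norm_nonneg _))]
    refine mul_le_mul_of_nonneg_right ?_ (norm_nonneg _)
    refine (integral_mono (integrable_sandwich hB hD u v p).norm h1 fun z =>
      (norm_sandwich_integrand_le hD u v p z).trans ?_).trans_eq ?_
    · gcongr
      exact norm_le_seminorm_zero v _
    · rw [integral_const_mul, integral_mul_const, integral_sub_left_eq_self (fun z => ‖u z‖)]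
      rfl
  have h1 : layer B u v (tensor g f) = ∫ p : E n × E n, ∫ z,
      u (p.1 - z) * B z * v (z - p.2) * (g p.1 * f p.2) := by
    simp only [layer, sandwich, tensor_apply, integral_mul_const]
  rw [h1, integral_integral_swap hint]
  congr 1 with z
  rw [cv_apply', cv_apply', ← integral_prod_mul, ← integral_const_mul]
  refine integral_congr_ae (Eventually.of_forall fun p => ?_)
  simp only [reflect_apply, neg_sub]
  ring

end layer

/-! ### Sums over scales -/

/-- The weight `2 ^ (a k) min (1, (2 ^ k t) ^ (-N))`. -/
noncomputable def scaleWeight (a : ℝ) (N : ℕ) (t : ℝ) (k : ℤ) : ℝ :=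
  2 ^ (a * k) * min 1 (((2 : ℝ) ^ k * t) ^ N)⁻¹

theorem scaleWeight_nonneg (a : ℝ) (N : ℕ) {t : ℝ} (ht : 0 ≤ t) (k : ℤ) :
    0 ≤ scaleWeight a N t k := by unfold scaleWeight; positivity

theorem two_rpow_intCast (k : ℤ) : (2 : ℝ) ^ (k : ℝ) = 2 ^ k := Real.rpow_intCast 2 k

/-- For `k ≥ 0` the decaying branch of the minimum leaves `2^((a-N)k)`; for `k ≤ 0` the trivial
branch leaves `2^(ak)`. -/
theorem scaleWeight_one_le {a : ℝ} {N : ℕ} (k : ℤ) :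
    scaleWeight a N 1 k ≤ 2 ^ (-(min a (N - a) * |(k : ℝ)|)) := by
  rcases le_total 0 k with hk | hk
  · have hk' : (0 : ℝ) ≤ k := by exact_mod_cast hk
    calc scaleWeight a N 1 k ≤ 2 ^ (a * k) * (((2 : ℝ) ^ k * 1) ^ N)⁻¹ := by
          unfold scaleWeight; gcongr; exact min_le_right _ _
      _ = 2 ^ ((a - N) * k) := by
          rw [mul_one, ← zpow_natCast, ← zpow_mul, ← two_rpow_intCast, ← Real.rpow_neg two_pos.le,
            ← Real.rpow_add two_pos]
          congr 1; push_cast; ring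
      _ ≤ _ := by
          rw [abs_of_nonneg hk']
          refine Real.rpow_le_rpow_of_exponent_le one_le_two ?_
          nlinarith [min_le_right a (N - a)]
  · have hk' : (k : ℝ) ≤ 0 := by exact_mod_cast hk
    calc scaleWeight a N 1 k ≤ 2 ^ (a * k) * 1 := by
          unfold scaleWeight; gcongr; exact min_le_left _ _
      _ ≤ _ := by
          rw [mul_one, abs_of_nonpos hk']
          refine Real.rpow_le_rpow_of_exponent_le one_le_two ?_
          nlinarith [min_le_left a (N - a)]

theorem summable_scaleWeight_one {a : ℝ} {N : ℕ} (ha : 0 < a) (hN : a < N) :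
    Summable (scaleWeight a N 1) :=
  Summable.of_nonneg_of_le (fun k => scaleWeight_nonneg a N zero_le_one k) scaleWeight_one_le
    (summable_two_rpow_neg_abs (lt_min ha (sub_pos.2 hN)))

theorem scaleWeight_two_zpow (a : ℝ) (N : ℕ) (m k : ℤ) :
    scaleWeight a N (2 ^ m) k = 2 ^ (-a * m) * scaleWeight a N 1 (k + m) := by
  unfold scaleWeight
  rw [← mul_assoc, ← Real.rpow_add two_pos, mul_one, zpow_add₀ two_ne_zero]
  congr 2
  push_cast
  ring

theorem scaleWeight_anti (a : ℝ) (N : ℕ) {s t : ℝ} (hs : 0 < s) (hst : s ≤ t) (k : ℤ) :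
    scaleWeight a N t k ≤ scaleWeight a N s k := by
  unfold scaleWeight
  gcongr

/-- Homogeneity: for `t = 2^m` the sum is that for `t = 1`, shifted in `k` and multiplied by
`2^(-am)`. A general `t` is rounded down to a power of two, at the cost of a factor `2^a`. -/
theorem exists_scaleWeight_le {a : ℝ} {N : ℕ} (ha : 0 < a) (hN : a < N) : ∃ C : ℝ, 0 ≤ C ∧
    ∀ t : ℝ, 0 < t → Summable (scaleWeight a N t) ∧ ∑' k, scaleWeight a N t k ≤ C * t ^ (-a) := by
  have hs := summable_scaleWeight_one ha hN
  refine ⟨2 ^ a * ∑' k, scaleWeight a N 1 k,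
    mul_nonneg (by positivity) (tsum_nonneg fun k => scaleWeight_nonneg a N zero_le_one k),
    fun t ht => ?_⟩
  obtain ⟨m, hm1, hm2⟩ := exists_mem_Ico_zpow ht one_lt_two
  have hm : (0 : ℝ) < 2 ^ m := by positivity
  have hsm : HasSum (scaleWeight a N (2 ^ m)) (2 ^ (-a * m) * ∑' k, scaleWeight a N 1 k) := by
    simp only [funext (scaleWeight_two_zpow a N m)]
    exact ((Equiv.addRight m).hasSum_iff.2 hs.hasSum).mul_left _
  have hst : Summable (scaleWeight a N t) :=
    Summable.of_nonneg_of_le (fun k => scaleWeight_nonneg a N ht.le k)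
      (scaleWeight_anti a N hm hm1) hsm.summable
  refine ⟨hst, ?_⟩
  calc ∑' k, scaleWeight a N t k ≤ ∑' k, scaleWeight a N (2 ^ m) k :=
        hst.tsum_le_tsum (scaleWeight_anti a N hm hm1) hsm.summable
    _ = 2 ^ (-a * m) * ∑' k, scaleWeight a N 1 k := hsm.tsum_eq
    _ ≤ (2 ^ a * t ^ (-a)) * ∑' k, scaleWeight a N 1 k := by
        gcongr
        · exact tsum_nonneg fun k => scaleWeight_nonneg a N zero_le_one k
        · have h1 : (2 : ℝ) ^ (-a * m) = 2 ^ a * ((2 : ℝ) ^ (m + 1)) ^ (-a) := by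
            rw [← two_rpow_intCast, ← Real.rpow_mul two_pos.le, ← Real.rpow_add two_pos]
            congr 1; push_cast; ring
          rw [h1]
          exact mul_le_mul_of_nonneg_left
            (Real.rpow_le_rpow_of_nonpos ht hm2.le (by linarith)) (by positivity)
    _ = _ := by ring

/-! ### Symbols of order `ν` and their kernels -/

/-- A sequence of continuous functions `B k` with `‖B k‖_∞ ≲ 2 ^ (ν k)`. -/
structure IsSymbol (B : ℤ → E n → ℂ) (ν : ℝ) : Prop where
  continuous : ∀ k, Continuous (B k)
  bound : ∃ D : ℝ, 0 ≤ D ∧ ∀ k z, ‖B k z‖ ≤ D * 2 ^ (ν * (k : ℝ))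

/-- The symbol `2 ^ k B k`. -/
noncomputable def raise (B : ℤ → E n → ℂ) (k : ℤ) (z : E n) : ℂ := (((2 : ℝ) ^ k : ℝ) : ℂ) * B k z

theorem IsSymbol.raise {B : ℤ → E n → ℂ} {ν : ℝ} (h : IsSymbol B ν) :
    IsSymbol (SingInt.raise B) (ν + 1) := by
  obtain ⟨D, hD0, hD⟩ := h.bound
  refine ⟨fun k => continuous_const.mul (h.continuous k), D, hD0, fun k z => ?_⟩
  rw [SingInt.raise, norm_mul, Complex.norm_real, Real.norm_of_nonneg (by positivity), add_mul,
    one_mul, Real.rpow_add two_pos, two_rpow_intCast]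
  calc _ ≤ (2 : ℝ) ^ k * (D * 2 ^ (ν * (k : ℝ))) := by gcongr; exact hD k z
    _ = _ := by ring

theorem IsSymbol.raise_iterate {B : ℤ → E n → ℂ} {ν : ℝ} (h : IsSymbol B ν) (m : ℕ) :
    IsSymbol (SingInt.raise^[m] B) (ν + m) := by
  induction m with
  | zero => simpa using h
  | succ m ih =>
    rw [Function.iterate_succ_apply']
    have := ih.raise
    push_cast
    rwa [← add_assoc]

/-- The kernel at scale `2 ^ (-k)`. -/
noncomputable def levelKernel (B : ℤ → E n → ℂ) (u v : 𝓢(E n, ℂ)) (k : ℤ) (p : E n × E n) : ℂ :=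
  sandwich (B k) (dyadic k u) (dyadic k v) p

/-- The sum of the kernels over all scales, a function off the diagonal. -/
noncomputable def seriesKernel (B : ℤ → E n → ℂ) (u v : 𝓢(E n, ℂ)) (p : E n × E n) : ℂ :=
  ∑' k, levelKernel B u v k p

theorem IsSymbol.exists_norm_levelKernel_le {B : ℤ → E n → ℂ} {ν : ℝ} (h : IsSymbol B ν)
    (u v : 𝓢(E n, ℂ)) (N : ℕ) : ∃ C : ℝ, 0 ≤ C ∧ ∀ k p,
      ‖levelKernel B u v k p‖ ≤ C * 2 ^ ((n + ν) * (k : ℝ)) ∧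
      (p.1 ≠ p.2 → ‖levelKernel B u v k p‖ ≤ C * scaleWeight (n + ν) N ‖p.1 - p.2‖ k) := by
  obtain ⟨D, hD0, hD⟩ := h.bound
  obtain ⟨C, hC0, hC⟩ := exists_norm_sandwich_dyadic_le u v N
  have e : ∀ k : ℤ, C * (D * 2 ^ (ν * (k : ℝ))) * 2 ^ (k * (n : ℤ)) =
      C * D * 2 ^ ((n + ν) * (k : ℝ)) := by
    intro k
    rw [← two_rpow_intCast (k * n), add_mul, Real.rpow_add two_pos]
    push_cast
    rw [mul_comm (n : ℝ) k]
    ring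
  refine ⟨C * D, by positivity, fun k p => ?_⟩
  obtain ⟨h1, h2⟩ := hC (B k) _ (hD k) k p
  rw [e k] at h1 h2
  refine ⟨h1, fun hp => ?_⟩
  have hp' : 0 < ((2 : ℝ) ^ k * ‖p.1 - p.2‖) ^ N := by
    have := norm_pos_iff.2 (sub_ne_zero.2 hp)
    positivity
  rw [scaleWeight, ← mul_assoc, mul_min_of_nonneg _ _ (by positivity), mul_one]
  refine le_min h1 ?_
  rw [← div_eq_mul_inv, le_div_iff₀ hp', mul_comm]
  exact h2

/-- The hypothesis `0 < n + ν` makes the coarse scales summable, and any `N > n + ν` handles the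
fine ones. -/
theorem IsSymbol.exists_seriesKernel_le {B : ℤ → E n → ℂ} {ν : ℝ} (h : IsSymbol B ν)
    (hν : 0 < n + ν) (u v : 𝓢(E n, ℂ)) : ∃ C : ℝ, 0 ≤ C ∧ ∀ p : E n × E n, p.1 ≠ p.2 →
      Summable (fun k => levelKernel B u v k p) ∧
      ‖seriesKernel B u v p‖ ≤ C * ‖p.1 - p.2‖ ^ (-(n + ν)) := by
  obtain ⟨N, hN⟩ := exists_nat_gt (n + ν)
  obtain ⟨C, hC0, hC⟩ := h.exists_norm_levelKernel_le u v N
  obtain ⟨C', hC0', hC'⟩ := exists_scaleWeight_le hν hN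
  refine ⟨C * C', by positivity, fun p hp => ?_⟩
  obtain ⟨hs, hle⟩ := hC' _ (norm_pos_iff.2 (sub_ne_zero.2 hp))
  refine ⟨Summable.of_norm_bounded (hs.mul_left C) fun k => (hC k p).2 hp, ?_⟩
  refine (tsum_of_norm_bounded (hs.mul_left C).hasSum fun k => (hC k p).2 hp).trans ?_
  rw [tsum_mul_left, mul_assoc]
  gcongr

theorem levelKernel_lineDeriv_left (B : ℤ → E n → ℂ) (u v : 𝓢(E n, ℂ)) (i : Fin n) (k : ℤ)
    (p : E n × E n) : sandwich (B k) (∂_{coordVec i} (dyadic k u)) (dyadic k v) p =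
      levelKernel (raise B) (∂_{coordVec i} u) v k p := by
  rw [lineDeriv_dyadic, sandwich_smul_left, levelKernel, ← sandwich_const_mul]
  rfl

theorem levelKernel_lineDeriv_right (B : ℤ → E n → ℂ) (u v : 𝓢(E n, ℂ)) (i : Fin n) (k : ℤ)
    (p : E n × E n) : sandwich (B k) (dyadic k u) (∂_{coordVec i} (dyadic k v)) p =
      levelKernel (raise B) u (∂_{coordVec i} v) k p := by
  rw [lineDeriv_dyadic, sandwich_smul_right, levelKernel, ← sandwich_const_mul]
  rfl

theorem isOpen_offDiag : IsOpen {p : E n × E n | p.1 ≠ p.2} :=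
  isOpen_ne_fun continuous_fst continuous_snd

/-- The derivative of the kernel off the diagonal. -/
noncomputable def seriesKernelDeriv (B : ℤ → E n → ℂ) (u v : 𝓢(E n, ℂ)) (p : E n × E n) :
    E n × E n →L[ℝ] ℂ :=
  ∑ i, (seriesKernel (raise B) (∂_{coordVec i} u) v p • fstCoord i -
    seriesKernel (raise B) u (∂_{coordVec i} v) p • sndCoord i)

/-- Termwise differentiation near `p`. A derivative at scale `k` costs `2^k`, which is recorded by
raising the symbol; the raised weights are still summable, uniformly as long as `‖x - y‖` stays
bounded below. -/
theorem IsSymbol.hasFDerivAt_seriesKernel {B : ℤ → E n → ℂ} {ν : ℝ} (h : IsSymbol B ν)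
    (hν : 0 < n + ν) (u v : 𝓢(E n, ℂ)) {p : E n × E n} (hp : p.1 ≠ p.2) :
    HasFDerivAt (seriesKernel B u v) (seriesKernelDeriv B u v p) p := by
  have hν' : 0 < n + (ν + 1) := by linarith
  obtain ⟨N, hN⟩ := exists_nat_gt (n + (ν + 1))
  choose C hC0 hC using fun i : Fin n => h.raise.exists_norm_levelKernel_le (∂_{coordVec i} u) v N
  choose C' hC0' hC' using fun i : Fin n =>
    h.raise.exists_norm_levelKernel_le u (∂_{coordVec i} v) N
  obtain ⟨D, hD0, hD⟩ := h.bound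
  -- In the ball of radius `δ/2` each variable moves by less than `δ/2`, so the distance to the
  -- diagonal shrinks by less than `δ`, half of its value at `p`.
  set δ : ℝ := ‖p.1 - p.2‖ / 2 with hδ
  have hδ0 : 0 < δ := half_pos (norm_pos_iff.2 (sub_ne_zero.2 hp))
  have hball : ∀ q ∈ Metric.ball p (δ / 2), δ ≤ ‖q.1 - q.2‖ := by
    intro q hq
    rw [Metric.mem_ball, dist_eq_norm] at hq
    have h1 : ‖(q - p).1‖ ≤ ‖q - p‖ := norm_fst_le _
    have h2 : ‖(q - p).2‖ ≤ ‖q - p‖ := norm_snd_le _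
    have h3 : p.1 - p.2 = (q.1 - q.2) - ((q - p).1 - (q - p).2) := by
      simp only [Prod.fst_sub, Prod.snd_sub]; abel
    have h4 : ‖p.1 - p.2‖ ≤ ‖q.1 - q.2‖ + ‖(q - p).1 - (q - p).2‖ := by
      rw [h3]; exact norm_sub_le _ _
    have h5 := norm_sub_le (q - p).1 (q - p).2
    linarith
  have hne : ∀ q ∈ Metric.ball p (δ / 2), q.1 ≠ q.2 := fun q hq e => by
    have := hball q hq
    rw [e, sub_self, norm_zero] at this
    linarith
  obtain ⟨Cs, -, hsc⟩ := exists_scaleWeight_le hν' hN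
  have hs := (hsc δ hδ0).1
  have hsum : ∀ (u' v' : 𝓢(E n, ℂ)), Summable fun k => levelKernel (SingInt.raise B) u' v' k p :=
    fun u' v' => ((h.raise.exists_seriesKernel_le hν' u' v').choose_spec.2 p hp).1
  have key := hasFDerivAt_tsum_of_isPreconnected (𝕜 := ℝ)
    (f := fun k => levelKernel B u v k)
    (f' := fun k q => ∑ i, (levelKernel (SingInt.raise B) (∂_{coordVec i} u) v k q • fstCoord i -
      levelKernel (SingInt.raise B) u (∂_{coordVec i} v) k q • sndCoord i))
    (u := fun k => (∑ i, (C i + C' i)) * scaleWeight (n + (ν + 1)) N δ k)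
    (hs.mul_left _) (Metric.isOpen_ball (x := p) (ε := δ / 2))
    (convex_ball p (δ / 2)).isPreconnected ?_ ?_ (Metric.mem_ball_self (half_pos hδ0))
    (((h.exists_seriesKernel_le hν u v).choose_spec.2 p hp).1)
    (Metric.mem_ball_self (half_pos hδ0))
  · refine key.congr_fderiv (HasSum.tsum_eq (hasSum_sum fun i _ => ?_))
    exact ((hsum _ _).hasSum.smul_const _).sub ((hsum _ _).hasSum.smul_const _)
  · intro k q _
    have := hasFDerivAt_sandwich (h.continuous k) (hD k) (dyadic k u) (dyadic k v) q
    rw [sandwichDeriv] at this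
    simp only [levelKernel_lineDeriv_left, levelKernel_lineDeriv_right] at this
    exact this
  · intro k q hq
    rw [Finset.sum_mul]
    refine (norm_sum_le _ _).trans (Finset.sum_le_sum fun i _ => (norm_sub_le _ _).trans ?_)
    rw [norm_smul, norm_smul, add_mul]
    have hw := scaleWeight_anti (n + (ν + 1)) N hδ0 (hball q hq) k
    refine add_le_add ?_ ?_
    · refine (mul_le_of_le_one_right (norm_nonneg _) (norm_fstCoord_le i)).trans
        (((hC i k q).2 (hne q hq)).trans ?_)
      exact mul_le_mul_of_nonneg_left hw (hC0 i)
    · refine (mul_le_of_le_one_right (norm_nonneg _) (norm_sndCoord_le i)).trans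
        (((hC' i k q).2 (hne q hq)).trans ?_)
      exact mul_le_mul_of_nonneg_left hw (hC0' i)

/-- The derivative is a finite combination of kernels of the same type with the raised symbol, so
the induction on `m` lets the symbol, its order, `u` and `v` vary. -/
theorem IsSymbol.contDiffOn_seriesKernel (m : ℕ) {B : ℤ → E n → ℂ} {ν : ℝ} (h : IsSymbol B ν)
    (hν : 0 < n + ν) (u v : 𝓢(E n, ℂ)) :
    ContDiffOn ℝ m (seriesKernel B u v) {p | p.1 ≠ p.2} := by
  induction m generalizing B ν u v with
  | zero =>
    rw [Nat.cast_zero, contDiffOn_zero]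
    exact fun p hp => (h.hasFDerivAt_seriesKernel hν u v hp).continuousAt.continuousWithinAt
  | succ m ih =>
    rw [Nat.cast_succ, contDiffOn_succ_iff_fderiv_of_isOpen isOpen_offDiag]
    refine ⟨fun p hp =>
      (h.hasFDerivAt_seriesKernel hν u v hp).differentiableAt.differentiableWithinAt,
      fun hm => by simp at hm, ?_⟩
    have e : ∀ p ∈ {p : E n × E n | p.1 ≠ p.2}, fderiv ℝ (seriesKernel B u v) p =
        seriesKernelDeriv B u v p := fun p hp => (h.hasFDerivAt_seriesKernel hν u v hp).fderiv
    refine ContDiffOn.congr ?_ e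
    unfold seriesKernelDeriv
    refine ContDiffOn.sum fun i _ => ?_
    exact ((ih h.raise (by linarith) _ _).smul contDiffOn_const).sub
      ((ih h.raise (by linarith) _ _).smul contDiffOn_const)

/-! ### Mixed derivatives off the diagonal -/

theorem partialD_congr_of_isOpen {U : Set (E n)} (hU : IsOpen U) {f g : E n → ℂ}
    (h : ∀ x ∈ U, f x = g x) (i : Fin n) : ∀ x ∈ U, partialD i f x = partialD i g x := by
  intro x hx
  have : f =ᶠ[𝓝 x] g := by filter_upwards [hU.mem_nhds hx] with y hy using h y hy
  rw [partialD, partialD, this.fderiv_eq]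

/-- Bookkeeping for families closed under differentiation: one coordinate derivative advances `m`,
differentiates `w` and costs the factor `c`. It is used with `m` counting how often the symbol has
been raised, with `c = -1` in the variable `y` and `c = 1` in `x`. -/
theorem multiD_eq_of_isOpen {U : Set (E n)} (hU : IsOpen U) (c : ℂ)
    (Φ : ℕ → 𝓢(E n, ℂ) → E n → ℂ)
    (hΦ : ∀ m w i, ∀ x ∈ U, fderiv ℝ (Φ m w) x (coordVec i) = c * Φ (m + 1) (∂_{coordVec i} w) x)
    (hd : ∀ m w, ∀ x ∈ U, DifferentiableAt ℝ (Φ m w) x)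
    (α : Fin n → ℕ) {f : E n → ℂ} {w : 𝓢(E n, ℂ)} {m : ℕ} {d : ℂ}
    (hf : ∀ x ∈ U, f x = d * Φ m w x) :
    ∀ x ∈ U, multiD α f x = d * c ^ order α * Φ (m + order α) (derivS α w) x := by
  have step : ∀ (i : Fin n) (j : ℕ) (f : E n → ℂ) (w : 𝓢(E n, ℂ)) (m : ℕ) (d : ℂ),
      (∀ x ∈ U, f x = d * Φ m w x) → ∀ x ∈ U, (partialD i)^[j] f x = d * c ^ j *
        Φ (m + j) ((fun g : 𝓢(E n, ℂ) => ∂_{coordVec i} g)^[j] w) x := by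
    intro i j
    induction j with
    | zero => intro f w m d hf x hx; simpa using hf x hx
    | succ j ih =>
      intro f w m d hf x hx
      rw [Function.iterate_succ_apply, Function.iterate_succ_apply]
      have h1 : ∀ x ∈ U, partialD i f x = (d * c) * Φ (m + 1) (∂_{coordVec i} w) x := by
        intro y hy
        rw [partialD_congr_of_isOpen hU hf i y hy, partialD, fderiv_const_mul (hd m w y hy),
          _root_.smul_apply, hΦ m w i y hy, smul_eq_mul, mul_assoc]
      rw [ih _ _ _ _ h1 x hx, pow_succ', add_assoc, add_comm 1 j]
      ring
  have main : ∀ l : List (Fin n), ∀ x ∈ U,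
      l.foldr (fun i F => (partialD i)^[α i] F) f x = d * c ^ (l.map α).sum *
        Φ (m + (l.map α).sum)
          (l.foldr (fun i F => (fun g : 𝓢(E n, ℂ) => ∂_{coordVec i} g)^[α i] F) w) x := by
    intro l
    induction l with
    | nil => intro x hx; simpa using hf x hx
    | cons i l ih =>
      intro x hx
      simp only [List.foldr_cons, List.map_cons, List.sum_cons]
      rw [step i (α i) _ _ _ _ ih x hx, add_comm (α i), pow_add, ← add_assoc]
      ring
  have ho : ((List.finRange n).map α).sum = order α := by
    rw [order, ← List.sum_ofFn, List.ofFn_eq_map]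
  have := main (List.finRange n)
  rwa [ho] at this

theorem IsSymbol.mixedD_seriesKernel {B : ℤ → E n → ℂ} {ν : ℝ} (h : IsSymbol B ν)
    (hν : 0 < n + ν) (u v : 𝓢(E n, ℂ)) (α β : Fin n → ℕ) {x y : E n} (hxy : x ≠ y) :
    mixedD α β (fun x y => seriesKernel B u v (x, y)) x y = (-1) ^ order β *
      seriesKernel (SingInt.raise^[order α + order β] B) (derivS α u) (derivS β v) (x, y) := by
  have hm : ∀ m : ℕ, 0 < n + (ν + m) := fun m => by
    have : (0 : ℝ) ≤ m := by positivity
    linarith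
  have inner : ∀ x' ∈ {x' : E n | x' ≠ y}, multiD β (fun y' => seriesKernel B u v (x', y')) y =
      (-1) ^ order β * seriesKernel (SingInt.raise^[order β] B) u (derivS β v) (x', y) := by
    intro x' hx'
    have := multiD_eq_of_isOpen (U := {y' : E n | x' ≠ y'}) (isOpen_ne_fun continuous_const continuous_id) (-1)
      (fun m w y' => seriesKernel (SingInt.raise^[m] B) u w (x', y')) ?_ ?_ β
      (f := fun y' => seriesKernel B u v (x', y')) (w := v) (m := 0) (d := 1)
      (fun y' _ => by simp) y hx'
    · simpa using this
    · intro m w i y' hy'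
      have hd := (h.raise_iterate m).hasFDerivAt_seriesKernel (hm m) u w (p := (x', y')) hy'
      have hd2 := hd.comp y' (hasFDerivAt_prodMk_right x' y')
      have e : fderiv ℝ (fun y' => seriesKernel (SingInt.raise^[m] B) u w (x', y')) y' = _ :=
        hd2.fderiv
      rw [e, Function.iterate_succ_apply']
      simp [seriesKernelDeriv, fstCoord_apply, sndCoord_apply, apply_ite Complex.ofReal]
    · intro m w y' hy'
      exact ((h.raise_iterate m).hasFDerivAt_seriesKernel (hm m) u w (p := (x', y')) hy').comp y'
        (hasFDerivAt_prodMk_right x' y') |>.differentiableAt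
  have outer := multiD_eq_of_isOpen (U := {x' : E n | x' ≠ y}) isOpen_ne 1
      (fun m w x' => seriesKernel (SingInt.raise^[m] B) w (derivS β v) (x', y)) ?_ ?_ α
      (w := u) (m := order β) (d := (-1) ^ order β) inner x hxy
  · rw [mixedD, outer, one_pow, mul_one, add_comm (order α)]
  · intro m w i x' hx'
    have hd := (h.raise_iterate m).hasFDerivAt_seriesKernel (hm m) w (derivS β v)
      (p := (x', y)) hx'
    have hd2 := HasFDerivAt.comp (f := fun e => (e, y)) x' hd (hasFDerivAt_prodMk_left x' y)
    have e : fderiv ℝ (fun x' => seriesKernel (SingInt.raise^[m] B) w (derivS β v) (x', y)) x' = _ :=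
      hd2.fderiv
    rw [e, Function.iterate_succ_apply']
    simp [seriesKernelDeriv, fstCoord_apply, sndCoord_apply, apply_ite Complex.ofReal]
  · intro m w x' hx'
    exact (HasFDerivAt.comp (f := fun e => (e, y)) x' ((h.raise_iterate m).hasFDerivAt_seriesKernel
      (hm m) w (derivS β v) (p := (x', y)) hx') (hasFDerivAt_prodMk_left x' y)).differentiableAt

/-! ### The distribution kernel of a paraproduct -/

/-- The Schwartz function `u` is, for every `N`, a sum of pure `N`-th order derivatives. -/
def HasPrimitives (u : 𝓢(E n, ℂ)) : Prop :=
  ∀ N : ℕ, ∃ Θ : Fin n → 𝓢(E n, ℂ), u = ∑ i, (fun g : 𝓢(E n, ℂ) => ∂_{coordVec i} g)^[N] (Θ i)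

/-- The pure `N`-th derivative in the `i`-th coordinate direction of the first variable. -/
noncomputable def fstDeriv (N : ℕ) (i : Fin n) (F : 𝓢(E n × E n, ℂ)) : 𝓢(E n × E n, ℂ) :=
  (fun G : 𝓢(E n × E n, ℂ) => ∂_{((coordVec i : E n), (0 : E n))} G)^[N] F

/-- The sum of the `L¹` norms of the pure `N`-th derivatives in the first variable. -/
noncomputable def derivNorm (N : ℕ) (F : 𝓢(E n × E n, ℂ)) : ℝ := ∑ i, normL1 (fstDeriv N i F)

theorem derivNorm_nonneg (N : ℕ) (F : 𝓢(E n × E n, ℂ)) : 0 ≤ derivNorm N F :=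
  Finset.sum_nonneg fun _ _ => normL1_nonneg _

/-- The contribution of the scale `2 ^ (-k)` to the distribution kernel. -/
noncomputable def levelPair (B : ℤ → E n → ℂ) (u v : 𝓢(E n, ℂ)) (F : 𝓢(E n × E n, ℂ)) (k : ℤ) :
    ℂ := layer (B k) (dyadic k u) (dyadic k v) F

theorem dyadic_sum {ι : Type*} (s : Finset ι) (k : ℤ) (u : ι → 𝓢(E n, ℂ)) :
    dyadic k (∑ i ∈ s, u i) = ∑ i ∈ s, dyadic k (u i) := by
  ext x
  simp only [dyadic_apply, _root_.sum_apply, Finset.mul_sum]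

theorem dyadic_lineDeriv_iterate (k : ℤ) (i : Fin n) (N : ℕ) (u : 𝓢(E n, ℂ)) :
    dyadic k ((fun g : 𝓢(E n, ℂ) => ∂_{coordVec i} g)^[N] u) =
      ((((2 : ℝ) ^ k)⁻¹ ^ N : ℝ) : ℂ) •
        (fun g : 𝓢(E n, ℂ) => ∂_{coordVec i} g)^[N] (dyadic k u) := by
  have h2 : ((2 : ℝ) ^ k : ℝ) ≠ 0 := by positivity
  induction N generalizing u with
  | zero => simp
  | succ N ih =>
    have e : dyadic k (∂_{coordVec i} u) =
        ((((2 : ℝ) ^ k)⁻¹ : ℝ) : ℂ) • ∂_{coordVec i} (dyadic k u) := by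
      rw [lineDeriv_dyadic, smul_smul, ← Complex.ofReal_mul, inv_mul_cancel₀ h2,
        Complex.ofReal_one, one_smul]
    have e2 : ∀ (c : ℂ) (w : 𝓢(E n, ℂ)), (fun g : 𝓢(E n, ℂ) => ∂_{coordVec i} g)^[N] (c • w) =
        c • (fun g : 𝓢(E n, ℂ) => ∂_{coordVec i} g)^[N] w := by
      intro c w
      clear ih e
      induction N generalizing w with
      | zero => rfl
      | succ N ih =>
        rw [Function.iterate_succ_apply, Function.iterate_succ_apply, ← ih]
        congr 1
        exact (lineDerivOpCLM ℂ 𝓢(E n, ℂ) (coordVec i)).map_smul c w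
    rw [Function.iterate_succ_apply, ih, e, e2, smul_smul, ← Complex.ofReal_mul, ← pow_succ,
      Function.iterate_succ_apply]

/-! ### Convergence and size of the distribution kernel -/

section

variable {B : ℤ → E n → ℂ} {ν : ℝ} {u : 𝓢(E n, ℂ)}

theorem IsSymbol.levelPair_add (h : IsSymbol B ν) (u v : 𝓢(E n, ℂ)) (F G : 𝓢(E n × E n, ℂ))
    (k : ℤ) : levelPair B u v (F + G) k = levelPair B u v F k + levelPair B u v G k := by
  obtain ⟨D, -, hD⟩ := h.bound
  exact layer_add (h.continuous k) (hD k) _ _ F G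

/-- Integrating by parts in the first variable gains powers of `2 ^ (-k)`. -/
theorem IsSymbol.levelPair_primitive (h : IsSymbol B ν) (N : ℕ) (Θ : Fin n → 𝓢(E n, ℂ))
    (v : 𝓢(E n, ℂ)) (F : 𝓢(E n × E n, ℂ)) (k : ℤ) :
    levelPair B (∑ i, (fun g : 𝓢(E n, ℂ) => ∂_{coordVec i} g)^[N] (Θ i)) v F k =
      ((((2 : ℝ) ^ k)⁻¹ ^ N : ℝ) : ℂ) * (-1) ^ N * ∑ i, levelPair B (Θ i) v (fstDeriv N i F) k := by
  obtain ⟨D, -, hD⟩ := h.bound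
  rw [levelPair, dyadic_sum, layer_sum_left (h.continuous k) (hD k), Finset.mul_sum]
  refine Finset.sum_congr rfl fun i _ => ?_
  rw [dyadic_lineDeriv_iterate, layer_smul_left,
    layer_lineDeriv_iterate_left (h.continuous k) (hD k), mul_assoc]
  rfl

theorem IsSymbol.exists_norm_levelPair_le (h : IsSymbol B ν) (u v : 𝓢(E n, ℂ)) :
    ∃ C : ℝ, 0 ≤ C ∧ ∀ k F, ‖levelPair B u v F k‖ ≤ C * 2 ^ ((n + ν) * (k : ℝ)) * normL1 F := by
  obtain ⟨C, hC0, hC⟩ := h.exists_norm_levelKernel_le u v 0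
  exact ⟨C, hC0, fun k F => norm_layer_le (fun p => (hC k p).1) F⟩

/-- The two branches of the minimum in the weight are the estimates without and with `N`
integrations by parts. The number `r` plays the role of the length scale of `F`: `N` derivatives
cost `r^(-N)`. -/
theorem IsSymbol.exists_levelPair_le (h : IsSymbol B ν) (hu : HasPrimitives u) (v : 𝓢(E n, ℂ))
    (N : ℕ) : ∃ C : ℝ, 0 ≤ C ∧ ∀ (F : 𝓢(E n × E n, ℂ)) (A r : ℝ), 0 < r → normL1 F ≤ A →
      derivNorm N F ≤ A * (r ^ N)⁻¹ → ∀ k,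
        ‖levelPair B u v F k‖ ≤ C * A * scaleWeight (n + ν) N r k := by
  obtain ⟨C, hC0, hC⟩ := h.exists_norm_levelPair_le u v
  obtain ⟨Θ, hΘ⟩ := hu N
  choose C' hC0' hC' using fun i => h.exists_norm_levelPair_le (Θ i) v
  refine ⟨C + ∑ i, C' i, add_nonneg hC0 (Finset.sum_nonneg fun i _ => hC0' i),
    fun F A r hr hA hA' k => ?_⟩
  have hA0 : 0 ≤ A := (normL1_nonneg F).trans hA
  have hS0 : 0 ≤ ∑ i, C' i := Finset.sum_nonneg fun i _ => hC0' i
  have h2 : (0 : ℝ) < 2 ^ k := by positivity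
  rw [scaleWeight, ← mul_assoc, mul_min_of_nonneg _ _ (by positivity), mul_one]
  refine le_min ?_ ?_
  · refine (hC k F).trans ?_
    calc C * 2 ^ ((n + ν) * (k : ℝ)) * normL1 F ≤ C * 2 ^ ((n + ν) * (k : ℝ)) * A := by gcongr
      _ = C * A * 2 ^ ((n + ν) * (k : ℝ)) := by ring
      _ ≤ _ := by gcongr; linarith
  · rw [hΘ, h.levelPair_primitive, norm_mul, norm_mul, norm_pow (-1 : ℂ), norm_neg, norm_one,
      one_pow, mul_one, Complex.norm_real, Real.norm_of_nonneg (by positivity)]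
    calc _ ≤ ((2 : ℝ) ^ k)⁻¹ ^ N * ∑ i, (∑ j, C' j) * 2 ^ ((n + ν) * (k : ℝ)) *
          normL1 (fstDeriv N i F) := by
          gcongr
          refine (norm_sum_le _ _).trans (Finset.sum_le_sum fun i _ => (hC' i k _).trans ?_)
          have := normL1_nonneg (fstDeriv N i F)
          gcongr
          exact Finset.single_le_sum (fun j _ => hC0' j) (Finset.mem_univ i)
      _ = ((2 : ℝ) ^ k)⁻¹ ^ N * ((∑ j, C' j) * 2 ^ ((n + ν) * (k : ℝ)) * derivNorm N F) := by
          rw [derivNorm, Finset.mul_sum, Finset.mul_sum]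
          simp only [Finset.mul_sum]
      _ ≤ ((2 : ℝ) ^ k)⁻¹ ^ N * ((C + ∑ j, C' j) * 2 ^ ((n + ν) * (k : ℝ)) * (A * (r ^ N)⁻¹)) := by
          have := derivNorm_nonneg N F
          gcongr
          linarith
      _ = _ := by rw [mul_pow, mul_inv, inv_pow]; ring

theorem exists_gauge_derivNorm_le (N : ℕ) : ∃ q : 𝓢(E n × E n, ℂ) → ℝ, IsGauge q ∧
    ∀ F, normL1 F + derivNorm N F ≤ q F := by
  obtain ⟨q, hq, h⟩ := exists_gauge_normL1_le (E n × E n)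
  have hc : ∀ i : Fin n, Continuous (fstDeriv N i : 𝓢(E n × E n, ℂ) → _) ∧
      fstDeriv N i (0 : 𝓢(E n × E n, ℂ)) = 0 := by
    intro i
    unfold fstDeriv
    have h0 := (lineDerivOpCLM ℂ 𝓢(E n × E n, ℂ) ((coordVec i : E n), (0 : E n)))
    refine ⟨(show Continuous (fun G : 𝓢(E n × E n, ℂ) => ∂_{((coordVec i : E n), (0 : E n))} G) from
      (lineDerivOpCLM ℂ 𝓢(E n × E n, ℂ) ((coordVec i : E n), (0 : E n))).continuous).iterate N, ?_⟩
    exact Function.iterate_fixed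
      (map_zero (lineDerivOpCLM ℂ 𝓢(E n × E n, ℂ) ((coordVec i : E n), (0 : E n)))) N
  exact ⟨_, hq.add (IsGauge.sum (s := Finset.univ) fun i _ => hq.comp (hc i).1 (hc i).2),
    fun F => add_le_add (h F) (Finset.sum_le_sum fun i _ => h _)⟩

/-- The distribution kernel obtained by summing over all scales. -/
theorem IsSymbol.exists_kernel (h : IsSymbol B ν) (hν : 0 < n + ν) (hu : HasPrimitives u)
    (v : 𝓢(E n, ℂ)) : ∃ κ : 𝓢'(E n × E n, ℂ), ∀ F, HasSum (levelPair B u v F) (κ F) := by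
  obtain ⟨N, hN⟩ := exists_nat_gt (n + ν)
  obtain ⟨C, hC0, hC⟩ := h.exists_levelPair_le hu v N
  obtain ⟨q, hq, hq'⟩ := exists_gauge_derivNorm_le (n := n) N
  have hw := summable_scaleWeight_one hν hN
  -- Every Schwartz function is admissible at scale `r = 1`, with `A` a continuous gauge of it;
  -- continuity of the limit functional follows.
  have hb : ∀ F k, ‖levelPair B u v F k‖ ≤ C * q F * scaleWeight (n + ν) N 1 k := by
    intro F k
    have := hq' F
    refine hC F (q F) 1 one_pos ?_ ?_ k
    · linarith [derivNorm_nonneg N F]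
    · rw [one_pow, inv_one, mul_one]; linarith [normL1_nonneg F]
  have hs : ∀ F, Summable (levelPair B u v F) := fun F =>
    Summable.of_norm_bounded (hw.mul_left _) (hb F)
  let A : 𝓢(E n × E n, ℂ) →ₗ[ℂ] ℂ :=
    { toFun := fun F => ∑' k, levelPair B u v F k
      map_add' := fun F G => by
        rw [← (hs F).tsum_add (hs G)]
        exact tsum_congr fun k => h.levelPair_add u v F G k
      map_smul' := fun c F => by
        rw [RingHom.id_apply, smul_eq_mul, ← tsum_mul_left]
        exact tsum_congr fun k => layer_smul _ _ _ c F }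
  have hA : Continuous A := by
    have h0 : 0 ≤ C * ∑' k, scaleWeight (n + ν) N 1 k :=
      mul_nonneg hC0 (tsum_nonneg fun k => scaleWeight_nonneg (n + ν) N zero_le_one k)
    refine (hq.const_mul h0).continuous_of_le A fun F => ?_
    refine (tsum_of_norm_bounded (hw.mul_left _).hasSum (hb F)).trans_eq ?_
    rw [tsum_mul_left]
    ring
  exact ⟨ContinuousLinearMap.toPointwiseConvergenceCLM _ _ _ _ ⟨A, hA⟩, fun F => (hs F).hasSum⟩

/-- Summing the weights over all scales gives `r^(-(n+ν))`. Keeping track of the length scale of `F`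
is what weak boundedness needs. -/
theorem IsSymbol.exists_norm_kernel_le (h : IsSymbol B ν) (hν : 0 < n + ν) (hu : HasPrimitives u)
    (v : 𝓢(E n, ℂ)) {N : ℕ} (hN : n + ν < N) : ∃ C : ℝ, 0 ≤ C ∧ ∀ κ : 𝓢'(E n × E n, ℂ),
      (∀ F, HasSum (levelPair B u v F) (κ F)) → ∀ (F : 𝓢(E n × E n, ℂ)) (A r : ℝ), 0 < r →
        normL1 F ≤ A → derivNorm N F ≤ A * (r ^ N)⁻¹ → ‖κ F‖ ≤ C * A * r ^ (-(n + ν)) := by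
  obtain ⟨C, hC0, hC⟩ := h.exists_levelPair_le hu v N
  obtain ⟨C', hC0', hC'⟩ := exists_scaleWeight_le hν hN
  refine ⟨C * C', by positivity, fun κ hκ F A r hr hA hA' => ?_⟩
  obtain ⟨hs, hle⟩ := hC' r hr
  have hA0 : 0 ≤ A := (normL1_nonneg F).trans hA
  rw [← (hκ F).tsum_eq]
  refine (tsum_of_norm_bounded (hs.mul_left _).hasSum (hC F A r hr hA hA')).trans ?_
  rw [tsum_mul_left]
  calc C * A * ∑' k, scaleWeight (n + ν) N r k ≤ C * A * (C' * r ^ (-(n + ν))) := by gcongr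
    _ = _ := by ring

/-- Off the diagonal the distribution kernel is the function kernel. -/
theorem IsSymbol.kernel_eq_integral (h : IsSymbol B ν) (hν : 0 < n + ν) (v : 𝓢(E n, ℂ))
    {κ : 𝓢'(E n × E n, ℂ)} (hκ : ∀ F, HasSum (levelPair B u v F) (κ F)) (F : 𝓢(E n × E n, ℂ))
    {δ : ℝ} (hδ : 0 < δ) (hF : ∀ p, F p ≠ 0 → δ ≤ ‖p.1 - p.2‖) :
    κ F = ∫ p, seriesKernel B u v p * F p := by
  obtain ⟨N, hN⟩ := exists_nat_gt (n + ν)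
  obtain ⟨C, hC0, hC⟩ := h.exists_norm_levelKernel_le u v N
  obtain ⟨C', -, hC'⟩ := exists_scaleWeight_le hν hN
  obtain ⟨D, -, hD⟩ := h.bound
  have hint : ∀ k, Integrable fun p => levelKernel B u v k p * F p := fun k =>
    integrable_sandwich_mul (h.continuous k) (hD k) _ _ F
  -- Since `F` vanishes at distance less than `δ` from the diagonal, the weights at `δ` dominate
  -- uniformly and allow the exchange of sum and integral.
  have hb : ∀ k, ∫ p, ‖levelKernel B u v k p * F p‖ ≤
      C * scaleWeight (n + ν) N δ k * normL1 F := by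
    intro k
    rw [normL1, ← integral_const_mul]
    refine integral_mono (hint k).norm (F.integrable.norm.const_mul _) fun p => ?_
    dsimp only
    rw [norm_mul]
    by_cases hp : F p = 0
    · simp [hp]
    · have h1 := hF p hp
      have h2 : p.1 ≠ p.2 := fun e => by rw [e, sub_self, norm_zero] at h1; linarith
      gcongr
      refine ((hC k p).2 h2).trans ?_
      gcongr
      exact scaleWeight_anti _ _ hδ h1 k
  have hsum : Summable fun k => ∫ p, ‖levelKernel B u v k p * F p‖ :=
    Summable.of_nonneg_of_le (fun k => integral_nonneg fun p => norm_nonneg _) hb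
      (((hC' δ hδ).1.mul_left C).mul_right _)
  have := hasSum_integral_of_summable_integral_norm hint hsum
  refine (hκ F).unique ?_
  simp only [tsum_mul_right] at this
  exact this

end

/-! ### Iterated directional derivatives -/

/-- The list of directions of the derivative `D ^ α` along a linear embedding. -/
noncomputable def directions {V : Type*} (ι : E n → V) (α : Fin n → ℕ) : List V :=
  (List.finRange n).flatMap fun i => List.replicate (α i) (ι (coordVec i))

theorem length_directions {V : Type*} (ι : E n → V) (α : Fin n → ℕ) :
    (directions ι α).length = order α := by
  simp only [directions, List.length_flatMap, List.length_replicate, order]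
  rw [← List.sum_ofFn, List.ofFn_eq_map]

section iterDir

variable {V : Type*} [NormedAddCommGroup V] [NormedSpace ℝ V]

/-- Iterated directional derivatives along a list of vectors. -/
noncomputable def iterDir (l : List V) (G : V → ℂ) : V → ℂ :=
  l.foldr (fun w G p => fderiv ℝ G p w) G

theorem contDiffOn_iterDir {U : Set V} (hU : IsOpen U) (l : List V) {m : ℕ} {G : V → ℂ}
    (hG : ContDiffOn ℝ (m + l.length : ℕ) G U) : ContDiffOn ℝ m (iterDir l G) U := by
  induction l generalizing m with
  | nil => exact hG
  | cons w l ih =>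
    have h1 : ContDiffOn ℝ (m + 1 : ℕ) (iterDir l G) U := ih (by
      rw [List.length_cons, ← add_assoc, add_right_comm] at hG
      exact hG)
    push_cast at h1
    rw [contDiffOn_succ_iff_fderiv_of_isOpen hU] at h1
    exact h1.2.2.clm_apply contDiffOn_const

theorem differentiableAt_iterDir {U : Set V} (hU : IsOpen U) (l : List V) {m : ℕ} {G : V → ℂ}
    (hG : ContDiffOn ℝ m G U) (hl : l.length < m) {p : V} (hp : p ∈ U) :
    DifferentiableAt ℝ (iterDir l G) p := by
  have h1 : ContDiffOn ℝ (1 : ℕ) (iterDir l G) U :=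
    contDiffOn_iterDir hU l (hG.of_le (by exact_mod_cast by omega))
  exact (h1.contDiffAt (hU.mem_nhds hp)).differentiableAt (by norm_num)

theorem iterDir_add_mul {U : Set V} (hU : IsOpen U) (l : List V) {m : ℕ} {G H : V → ℂ} (c : ℂ)
    (hG : ContDiffOn ℝ m G U) (hH : ContDiffOn ℝ m H U) (hl : l.length ≤ m) :
    ∀ p ∈ U, iterDir l (fun p => G p + c * H p) p = iterDir l G p + c * iterDir l H p := by
  induction l with
  | nil => intro p _; rfl
  | cons w l ih =>
    intro p hp
    have hl' : l.length < m := hl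
    have h1 := ih hl'.le
    have h2 : iterDir l (fun p => G p + c * H p) =ᶠ[𝓝 p]
        fun p => iterDir l G p + c * iterDir l H p := by
      filter_upwards [hU.mem_nhds hp] with q hq using h1 q hq
    have dG := differentiableAt_iterDir hU l hG hl' hp
    have dH := differentiableAt_iterDir hU l hH hl' hp
    change fderiv ℝ (iterDir l (fun p => G p + c * H p)) p w = fderiv ℝ (iterDir l G) p w +
      c * fderiv ℝ (iterDir l H) p w
    have h3 : fderiv ℝ (fun p => iterDir l G p + c * iterDir l H p) p = _ :=
      (dG.hasFDerivAt.add (dH.hasFDerivAt.const_mul c)).fderiv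
    rw [h2.fderiv_eq, h3]
    rfl

/-- Chain rule along the slice `s`: its derivative `L` is constant, so each partial derivative
becomes a derivative in the fixed direction `L e_i`. Only points mapped into the open set `U`
matter, and these form an open set. -/
theorem multiD_comp_eq_iterDir {U : Set V} (hU : IsOpen U) {s : E n → V} (L : E n →L[ℝ] V)
    (hs : ∀ x, HasFDerivAt s L x) {m : ℕ} {G : V → ℂ} (hG : ContDiffOn ℝ m G U) (α : Fin n → ℕ)
    (hα : order α ≤ m) {f : E n → ℂ} (hf : ∀ x, s x ∈ U → f x = G (s x)) :
    ∀ x, s x ∈ U → multiD α f x = iterDir (directions L α) G (s x) := by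
  have hsc : Continuous s := continuous_iff_continuousAt.2 fun x => (hs x).continuousAt
  have hsU : IsOpen (s ⁻¹' U) := hU.preimage hsc
  have step : ∀ (i : Fin n) (j : ℕ) (f : E n → ℂ) (l : List V), l.length + j ≤ m →
      (∀ x, s x ∈ U → f x = iterDir l G (s x)) →
      ∀ x, s x ∈ U → (partialD i)^[j] f x = iterDir (List.replicate j (L (coordVec i)) ++ l) G (s x) := by
    intro i j f l hl hf
    induction j with
    | zero => exact hf
    | succ j ih =>
      intro x hx
      have h1 := ih (by omega)
      rw [Function.iterate_succ_apply', partialD_congr_of_isOpen hsU h1 i x hx, partialD]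
      have hd : DifferentiableAt ℝ (iterDir (List.replicate j (L (coordVec i)) ++ l) G) (s x) :=
        differentiableAt_iterDir hU _ hG (by simp; omega) hx
      have h2 := (hd.hasFDerivAt.comp x (hs x)).fderiv
      have h3 : fderiv ℝ (fun x => iterDir (List.replicate j (L (coordVec i)) ++ l) G (s x)) x = _ :=
        h2
      rw [h3]
      rfl
  have main : ∀ l : List (Fin n), (l.map α).sum ≤ m → ∀ x, s x ∈ U →
      l.foldr (fun i F => (partialD i)^[α i] F) f x =
        iterDir (l.flatMap fun i => List.replicate (α i) (L (coordVec i))) G (s x) := by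
    intro l
    induction l with
    | nil => intro _ x hx; exact hf x hx
    | cons i l ih =>
      intro hl x hx
      rw [List.map_cons, List.sum_cons] at hl
      simp only [List.foldr_cons, List.flatMap_cons]
      refine step i (α i) _ _ ?_ (ih (by omega)) x hx
      simp only [List.length_flatMap, List.length_replicate]
      have : (l.map fun i => α i).sum = (l.map α).sum := rfl
      rw [this]
      omega
  refine main (List.finRange n) ?_
  rwa [← List.ofFn_eq_map, List.sum_ofFn]

end iterDir

/-- Derivatives taken slice by slice are hard to add, since `K` is differentiable only off the
diagonal. As directional derivatives of one function on an open subset of the product they become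
linear in `K`. -/
theorem mixedD_eq_iterDir {K : E n → E n → ℂ} {M : ℕ}
    (hK : ContDiffOn ℝ M (fun p : E n × E n => K p.1 p.2) {p | p.1 ≠ p.2}) {α β : Fin n → ℕ}
    (hM : order α + order β ≤ M) {x y : E n} (hxy : x ≠ y) :
    mixedD α β K x y = iterDir
      (directions (ContinuousLinearMap.inl ℝ (E n) (E n)) α ++
        directions (ContinuousLinearMap.inr ℝ (E n) (E n)) β)
      (fun p : E n × E n => K p.1 p.2) (x, y) := by
  have inner : ∀ x' : E n, (x', y) ∈ {p : E n × E n | p.1 ≠ p.2} →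
      multiD β (K x') y = iterDir (directions (ContinuousLinearMap.inr ℝ (E n) (E n)) β)
        (fun p : E n × E n => K p.1 p.2) (x', y) := fun x' hx' =>
    multiD_comp_eq_iterDir isOpen_offDiag (s := fun y' => (x', y'))
      (ContinuousLinearMap.inr ℝ (E n) (E n)) (fun y' => hasFDerivAt_prodMk_right x' y') hK β
      (by omega) (fun y' _ => rfl) y hx'
  have h2 : ContDiffOn ℝ (order α)
      (iterDir (directions (ContinuousLinearMap.inr ℝ (E n) (E n)) β)
        (fun p : E n × E n => K p.1 p.2)) {p | p.1 ≠ p.2} :=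
    contDiffOn_iterDir isOpen_offDiag _ (hK.of_le (by
      rw [length_directions]; exact_mod_cast hM))
  have := multiD_comp_eq_iterDir isOpen_offDiag (s := fun x' => (x', y))
      (ContinuousLinearMap.inl ℝ (E n) (E n)) (fun x' => hasFDerivAt_prodMk_left x' y) h2 α
      le_rfl inner x hxy
  rw [mixedD, this]
  simp only [iterDir, List.foldr_append]

theorem mixedD_add_mul {K H : E n → E n → ℂ} {M : ℕ} (c : ℂ)
    (hK : ContDiffOn ℝ M (fun p : E n × E n => K p.1 p.2) {p | p.1 ≠ p.2})
    (hH : ContDiffOn ℝ M (fun p : E n × E n => H p.1 p.2) {p | p.1 ≠ p.2}) {α β : Fin n → ℕ}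
    (hM : order α + order β ≤ M) {x y : E n} (hxy : x ≠ y) :
    mixedD α β (fun x y => K x y + c * H x y) x y = mixedD α β K x y + c * mixedD α β H x y := by
  have hS : ContDiffOn ℝ M (fun p : E n × E n => K p.1 p.2 + c * H p.1 p.2) {p | p.1 ≠ p.2} :=
    hK.add (contDiffOn_const.mul hH)
  rw [mixedD_eq_iterDir hK hM hxy, mixedD_eq_iterDir hH hM hxy,
    mixedD_eq_iterDir (K := fun x y => K x y + c * H x y) hS hM hxy]
  refine iterDir_add_mul isOpen_offDiag _ c hK hH ?_ (x, y) hxy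
  rw [List.length_append, length_directions, length_directions]
  exact hM

/-- The product is continuous with compact support: near a point of the diagonal either `f(y)` or
`g(x)` vanishes identically, which hides the singularity of `K`. -/
theorem integrable_offDiag {K : E n × E n → ℂ} (hK : ContinuousOn K {p | p.1 ≠ p.2})
    {f g : 𝓢(E n, ℂ)} (hf : HasCompactSupport f) (hg : HasCompactSupport g)
    (hfg : Disjoint (tsupport f) (tsupport g)) : Integrable fun p => K p * f p.2 * g p.1 := by
  refine Continuous.integrable_of_hasCompactSupport ?_ ?_
  · rw [continuous_iff_continuousAt]
    intro p
    by_cases hp : p.1 = p.2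
    · have h0 : (fun p : E n × E n => K p * f p.2 * g p.1) =ᶠ[𝓝 p] fun _ => 0 := by
        by_cases hx : p.2 ∈ tsupport f
        · have hx' : p.1 ∉ tsupport g := by
            rw [hp]; exact Set.disjoint_left.1 hfg hx
          have := (notMem_tsupport_iff_eventuallyEq.1 hx').comp_tendsto
            (continuous_fst.tendsto p)
          filter_upwards [this] with q hq
          have : g q.1 = 0 := hq
          simp [this]
        · have := (notMem_tsupport_iff_eventuallyEq.1 hx).comp_tendsto
            (continuous_snd.tendsto p)
          filter_upwards [this] with q hq
          have : f q.2 = 0 := hq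
          simp [this]
      exact continuousAt_const.congr h0.symm
    · have h1 : ContinuousAt K p := hK.continuousAt (isOpen_offDiag.mem_nhds hp)
      exact (h1.mul (f.continuous.comp continuous_snd).continuousAt).mul
        (g.continuous.comp continuous_fst).continuousAt
  · refine HasCompactSupport.intro (hg.isCompact.prod hf.isCompact) fun p hp => ?_
    rw [Set.mem_prod, not_and_or] at hp
    rcases hp with hp | hp
    · simp [image_eq_zero_of_notMem_tsupport hp]
    · simp [image_eq_zero_of_notMem_tsupport hp]

/-! ### Stability of the kernel estimates under linear combinations -/

namespace Operator

theorem IsSingular.add_mul {ν γ : ℝ} {M : ℕ} {T T₁ T₂ : Operator n} (c : ℂ) (h₁ : T₁.P ≤ T.P)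
    (h₂ : T₂.P ≤ T.P) (hker : ∀ F, T.ker F = T₁.ker F + c * T₂.ker F)
    (hkerT : ∀ F, T.kerT F = T₁.kerT F + c * T₂.kerT F) (hT₁ : T₁.IsSingular ν M γ)
    (hT₂ : T₂.IsSingular ν M γ) : T.IsSingular ν M γ := by
  obtain ⟨K, hK, hKp, hKt, C, hC, hC'⟩ := hT₁
  obtain ⟨H, hH, hHp, hHt, D, hD, hD'⟩ := hT₂
  have key : ∀ f g : 𝓢(E n, ℂ), HasCompactSupport f → HasCompactSupport g →
      Disjoint (tsupport f) (tsupport g) →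
      ∫ p : E n × E n, (K p.1 p.2 + c * H p.1 p.2) * f p.2 * g p.1 =
        (∫ p : E n × E n, K p.1 p.2 * f p.2 * g p.1) +
          c * ∫ p : E n × E n, H p.1 p.2 * f p.2 * g p.1 := by
    intro f g hf hg hfg
    rw [← integral_const_mul, ← integral_add (integrable_offDiag hK.continuousOn hf hg hfg)
      ((integrable_offDiag hH.continuousOn hf hg hfg).const_mul c)]
    congr 1 with p
    ring
  refine ⟨fun x y => K x y + c * H x y, hK.add (contDiffOn_const.mul hH), ?_, ?_,
    C + ‖c‖ * D, ?_, ?_⟩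
  · intro f g hf hg hfg
    rw [key f g hf.1 hg hfg, ← hKp f g (hf.mono h₁) hg hfg, ← hHp f g (hf.mono h₂) hg hfg]
    exact hker _
  · intro f g hf hg hfg
    rw [key f g hf hg.1 hfg, ← hKt f g hf (hg.mono h₁) hfg, ← hHt f g hf (hg.mono h₂) hfg]
    exact hkerT _
  · intro α β hM x y hxy
    rw [mixedD_add_mul c hK hH hM hxy, _root_.add_mul, mul_assoc]
    refine (norm_add_le _ _).trans (add_le_add (hC α β hM x y hxy) ?_)
    rw [norm_mul]
    exact mul_le_mul_of_nonneg_left (hD α β hM x y hxy) (norm_nonneg c)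
  · intro α β hM x y h hh
    -- The condition `‖h‖ < ‖x - y‖ / 2` keeps all three pairs of points off the diagonal, where
    -- derivatives of the kernels are additive.
    have n1 : x ≠ y := by
      rintro rfl
      rw [sub_self, norm_zero] at hh
      linarith [norm_nonneg h]
    have n2 : x + h ≠ y := by
      rintro rfl
      rw [sub_add_cancel_left, norm_neg] at hh
      linarith [norm_nonneg h]
    have n3 : x ≠ y + h := by
      rintro rfl
      rw [add_sub_cancel_left] at hh
      linarith [norm_nonneg h]
    rw [mixedD_add_mul c hK hH hM.le n1, mixedD_add_mul c hK hH hM.le n2,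
      mixedD_add_mul c hK hH hM.le n3]
    have e1 := hC' α β hM x y h hh
    have e2 := mul_le_mul_of_nonneg_left (hD' α β hM x y h hh) (norm_nonneg c)
    rw [mul_add, ← norm_mul, ← norm_mul] at e2
    have t1 := norm_add_le (mixedD α β K (x + h) y - mixedD α β K x y)
      (c * (mixedD α β H (x + h) y - mixedD α β H x y))
    have t2 := norm_add_le (mixedD α β K x y - mixedD α β K x (y + h))
      (c * (mixedD α β H x y - mixedD α β H x (y + h)))
    have r1 : mixedD α β K (x + h) y + c * mixedD α β H (x + h) y -
        (mixedD α β K x y + c * mixedD α β H x y) =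
        (mixedD α β K (x + h) y - mixedD α β K x y) +
        c * (mixedD α β H (x + h) y - mixedD α β H x y) := by ring
    have r2 : mixedD α β K x y + c * mixedD α β H x y -
        (mixedD α β K x (y + h) + c * mixedD α β H x (y + h)) =
        (mixedD α β K x y - mixedD α β K x (y + h)) +
        c * (mixedD α β H x y - mixedD α β H x (y + h)) := by ring
    rw [r1, r2, _root_.add_mul, mul_assoc]
    linarith

theorem IsSingular.zero (P : ℕ) (ν γ : ℝ) (M : ℕ) :
    (⟨P, 0, 0, fun _ _ _ _ => rfl⟩ : Operator n).IsSingular ν M γ := by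
  have hc : ContDiffOn ℝ M (fun p : E n × E n => (fun _ _ : E n => (0 : ℂ)) p.1 p.2)
      {p | p.1 ≠ p.2} := contDiffOn_const
  have hz : ∀ (α β : Fin n → ℕ) (x y : E n), mixedD α β (fun _ _ => (0 : ℂ)) x y = 0 := by
    intro α β x y
    have z : ∀ α : Fin n → ℕ, multiD α (fun _ : E n => (0 : ℂ)) = fun _ => 0 := by
      intro α
      have := multiD_coe α (0 : 𝓢(E n, ℂ))
      unfold multiD
      have s : ∀ (i : Fin n) (j : ℕ), (partialD i)^[j] (fun _ : E n => (0 : ℂ)) = fun _ => 0 := by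
        intro i j
        refine Function.iterate_fixed ?_ j
        funext x
        simp [partialD]
      induction List.finRange n with
      | nil => rfl
      | cons i l ih => rw [List.foldr_cons, ih, s]
    simp only [mixedD, z]
  refine ⟨fun _ _ => 0, hc, ?_, ?_, 0, ?_, ?_⟩
  · intro f g _ _ _
    simp [pair]
  · intro f g _ _ _
    simp [pair, trans]
  · intro α β _ x y _
    simp [hz]
  · intro α β _ x y h _
    simp [hz]

end Operator

/-! ### Properties of `D ^ α` -/

/-- Transfers a relation from one derivative to `D^α`; the index `m` counts derivatives, so that the
relation may carry powers of a dilation factor. -/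
theorem derivS_rel (R : ℕ → 𝓢(E n, ℂ) → 𝓢(E n, ℂ) → Prop)
    (h : ∀ (m : ℕ) (i : Fin n) (f g : 𝓢(E n, ℂ)), R m f g → R (m + 1) (∂_{coordVec i} f) (∂_{coordVec i} g)) (α : Fin n → ℕ)
    {m : ℕ} {f g : 𝓢(E n, ℂ)} (hfg : R m f g) :
    R (m + order α) (derivS α f) (derivS α g) := by
  have step : ∀ (i : Fin n) (j : ℕ) (m : ℕ) (f g : 𝓢(E n, ℂ)), R m f g →
      R (m + j) ((fun g : 𝓢(E n, ℂ) => ∂_{coordVec i} g)^[j] f)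
        ((fun g : 𝓢(E n, ℂ) => ∂_{coordVec i} g)^[j] g) := by
    intro i j
    induction j with
    | zero => intro m f g h; exact h
    | succ j ih =>
      intro m f g hR
      rw [Function.iterate_succ_apply', Function.iterate_succ_apply', ← add_assoc]
      exact h _ _ _ _ (ih m f g hR)
  have main : ∀ l : List (Fin n), R (m + (l.map α).sum)
      (l.foldr (fun i F => (fun g : 𝓢(E n, ℂ) => ∂_{coordVec i} g)^[α i] F) f)
      (l.foldr (fun i F => (fun g : 𝓢(E n, ℂ) => ∂_{coordVec i} g)^[α i] F) g) := by
    intro l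
    induction l with
    | nil => simpa using hfg
    | cons i l ih =>
      rw [List.map_cons, List.sum_cons, add_comm (α i), ← add_assoc]
      exact step i (α i) _ _ _ ih
  have ho : ((List.finRange n).map α).sum = order α := by
    rw [order, ← List.sum_ofFn, List.ofFn_eq_map]
  rw [← ho]
  exact main _

theorem derivS_zero (f : 𝓢(E n, ℂ)) : derivS 0 f = f := by
  unfold derivS
  induction List.finRange n with
  | nil => rfl
  | cons i l ih => rw [List.foldr_cons, ih]; rfl

theorem derivS_single (i : Fin n) (N : ℕ) (f : 𝓢(E n, ℂ)) :
    derivS (Pi.single i N) f = (fun g : 𝓢(E n, ℂ) => ∂_{coordVec i} g)^[N] f := by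
  classical
  have h : ∀ l : List (Fin n), l.Nodup →
      l.foldr (fun j F => (fun g : 𝓢(E n, ℂ) => ∂_{coordVec j} g)^[(Pi.single i N : Fin n → ℕ) j] F) f =
        if i ∈ l then (fun g : 𝓢(E n, ℂ) => ∂_{coordVec i} g)^[N] f else f := by
    intro l hl
    induction l with
    | nil => rfl
    | cons j l ih =>
      rw [List.nodup_cons] at hl
      rw [List.foldr_cons, ih hl.2]
      by_cases hj : j = i
      · subst hj
        simp [hl.1]
      · simp [hj, Ne.symm hj]
  rw [derivS, h _ (List.nodup_finRange n), if_pos (List.mem_finRange i)]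

theorem derivS_cv (α : Fin n → ℕ) (f g : 𝓢(E n, ℂ)) : derivS α (cv f g) = cv (derivS α f) g :=
  derivS_rel (fun _ F G => F = cv G g) (fun _ i F G h => by rw [h, lineDeriv_cv]) α (m := 0) rfl

theorem derivS_dyadic (α : Fin n → ℕ) (k : ℤ) (f : 𝓢(E n, ℂ)) :
    derivS α (dyadic k f) = ((((2 : ℝ) ^ k) ^ order α : ℝ) : ℂ) • dyadic k (derivS α f) := by
  have := derivS_rel (fun m F G => F = ((((2 : ℝ) ^ k) ^ m : ℝ) : ℂ) • dyadic k G)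
    (fun m i F G h => ?_) α (m := 0) (f := dyadic k f) (g := f) (by simp)
  · simpa using this
  · rw [h]
    have : ∂_{coordVec i} (((((2 : ℝ) ^ k) ^ m : ℝ) : ℂ) • dyadic k G) =
      ((((2 : ℝ) ^ k) ^ m : ℝ) : ℂ) • ∂_{coordVec i} (dyadic k G) :=
        (lineDerivOpCLM ℂ 𝓢(E n, ℂ) (coordVec i)).map_smul _ _
    rw [this, lineDeriv_dyadic, smul_smul, ← Complex.ofReal_mul, ← pow_succ]

theorem cv_smul_left (c : ℂ) (f g : 𝓢(E n, ℂ)) : cv (c • f) g = c • cv f g := by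
  ext x
  simp only [_root_.smul_apply, cv_apply, smul_eq_mul, mul_assoc, integral_const_mul]

/-- The derivative moves from `f` to `φ` at the cost `2^(k|α|)`. This is what puts a paraproduct in
sandwich form with `v = D^α φ`. -/
theorem cv_dyadic_derivS (α : Fin n → ℕ) (k : ℤ) (φ f : 𝓢(E n, ℂ)) :
    cv (dyadic k φ) (derivS α f) =
      ((((2 : ℝ) ^ k) ^ order α : ℝ) : ℂ) • cv (dyadic k (derivS α φ)) f := by
  rw [cv_comm, ← derivS_cv, cv_comm, derivS_cv, derivS_dyadic, cv_smul_left]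

/-! ### Operators given by a symbol -/

/-- The operator `T` is the sum of the sandwich operators of the symbol `B`. -/
structure Represents (T : Operator n) (B : ℤ → E n → ℂ) (u v : 𝓢(E n, ℂ)) : Prop where
  hasSum : ∀ F, HasSum (levelPair B u v F) (T.ker F)
  transpose : ∀ f g, T.kerT (tensor f g) = T.ker (tensor g f)

/-- Exchanging the two variables. -/
noncomputable def swapS (n : ℕ) : 𝓢(E n × E n, ℂ) →L[ℂ] 𝓢(E n × E n, ℂ) :=
  compCLMOfContinuousLinearEquiv ℂ (ContinuousLinearEquiv.prodComm ℝ (E n) (E n))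

theorem swapS_tensor (f g : 𝓢(E n, ℂ)) : swapS n (tensor f g) = tensor g f := by
  ext p
  simp [swapS, mul_comm]

/-- The series converges against every Schwartz function of two variables, so no moment condition is
needed and `P = 0`. The transpose has the kernel with the variables exchanged. -/
theorem IsSymbol.exists_operator {B : ℤ → E n → ℂ} {ν : ℝ} {u : 𝓢(E n, ℂ)} (h : IsSymbol B ν)
    (hν : 0 < n + ν) (hu : HasPrimitives u) (v : 𝓢(E n, ℂ)) :
    ∃ T : Operator n, T.P = 0 ∧ Represents T B u v := by
  obtain ⟨κ, hκ⟩ := h.exists_kernel hν hu v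
  let κ' : 𝓢'(E n × E n, ℂ) := ContinuousLinearMap.toPointwiseConvergenceCLM _ _ _ _
    ((⟨κ.toLinearMap, κ.continuous⟩ : 𝓢(E n × E n, ℂ) →L[ℂ] ℂ) ∘L swapS n)
  have hs : ∀ f g, κ' (tensor f g) = κ (tensor g f) := fun f g => by
    rw [← swapS_tensor]; rfl
  exact ⟨⟨0, κ, κ', fun f g _ _ => (hs f g).symm⟩, rfl, hκ, hs⟩

/-! ### Off-diagonal estimates for represented operators -/

section

variable {B : ℤ → E n → ℂ} {ν : ℝ} {u v : 𝓢(E n, ℂ)} {T : Operator n}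

theorem exists_dist_of_disjoint {f g : 𝓢(E n, ℂ)} (hf : HasCompactSupport f)
    (hfg : Disjoint (tsupport f) (tsupport g)) :
    ∃ δ : ℝ, 0 < δ ∧ ∀ p : E n × E n, tensor g f p ≠ 0 → δ ≤ ‖p.1 - p.2‖ := by
  obtain ⟨δ, hδ, h⟩ := hfg.exists_thickenings hf.isCompact (isClosed_tsupport g)
  refine ⟨δ, hδ, fun p hp => ?_⟩
  rw [tensor_apply] at hp
  have h1 : p.1 ∈ tsupport g := subset_tsupport _ (left_ne_zero_of_mul hp)
  have h2 : p.2 ∈ tsupport f := subset_tsupport _ (right_ne_zero_of_mul hp)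
  by_contra hlt
  push Not at hlt
  have h3 : p.1 ∈ Metric.thickening δ (tsupport f) :=
    Metric.mem_thickening_iff.2 ⟨p.2, h2, by rwa [dist_eq_norm]⟩
  exact Set.disjoint_left.1 h h3 (Metric.self_subset_thickening hδ _ h1)

/-- Mean value inequality for a kernel of order `ν` along a segment on which the distance to the
diagonal stays at least half of its initial value. The Lipschitz bound is then interpolated to the
exponent `γ`. -/
theorem IsSymbol.exists_holder (h : IsSymbol B ν) (hν : 0 < n + ν) (u v : 𝓢(E n, ℂ)) {γ : ℝ}
    (hγ0 : 0 < γ) (hγ1 : γ ≤ 1) : ∃ C : ℝ, 0 ≤ C ∧ ∀ (p w : E n × E n) (t : ℝ),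
      t < ‖p.1 - p.2‖ / 2 → ‖w.1‖ + ‖w.2‖ = t →
        ‖seriesKernel B u v (p + w) - seriesKernel B u v p‖ ≤
          C * (t ^ γ * ‖p.1 - p.2‖ ^ (-(n + ν + γ))) := by
  choose C hC0 hC using fun i : Fin n =>
    h.raise.exists_seriesKernel_le (by linarith) (∂_{coordVec i} u) v
  choose C' hC0' hC' using fun i : Fin n =>
    h.raise.exists_seriesKernel_le (by linarith) u (∂_{coordVec i} v)
  set S := ∑ i, (C i + C' i)
  have hS0 : 0 ≤ S := Finset.sum_nonneg fun i _ => add_nonneg (hC0 i) (hC0' i)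
  refine ⟨S * 2 ^ (n + (ν + 1)), by positivity, fun p w t ht hw => ?_⟩
  set d := ‖p.1 - p.2‖ with hd
  have ht0 : 0 ≤ t := by rw [← hw]; positivity
  have hd0 : 0 < d := by linarith
  have hseg : ∀ q ∈ segment ℝ p (p + w), d / 2 ≤ ‖q.1 - q.2‖ := by
    intro q hq
    rw [segment_eq_image'] at hq
    obtain ⟨s, ⟨hs0, hs1⟩, rfl⟩ := hq
    have e : p.1 - p.2 = ((p + s • (p + w - p)).1 - (p + s • (p + w - p)).2) -
        s • (w.1 - w.2) := by
      simp only [add_sub_cancel_left, Prod.fst_add, Prod.snd_add, Prod.smul_fst, Prod.smul_snd,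
        smul_sub]
      abel
    have h1 : d ≤ ‖(p + s • (p + w - p)).1 - (p + s • (p + w - p)).2‖ + ‖s • (w.1 - w.2)‖ := by
      rw [hd]; nth_rewrite 1 [e]; exact norm_sub_le _ _
    have h2 : ‖s • (w.1 - w.2)‖ ≤ t := by
      rw [norm_smul, Real.norm_of_nonneg hs0, ← hw]
      exact (mul_le_of_le_one_left (norm_nonneg _) hs1).trans (norm_sub_le _ _)
    linarith
  have hne : ∀ q ∈ segment ℝ p (p + w), q.1 ≠ q.2 := fun q hq e => by
    have := hseg q hq
    rw [e, sub_self, norm_zero] at this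
    linarith
  have hb : ∀ q ∈ segment ℝ p (p + w),
      ‖seriesKernelDeriv B u v q‖ ≤ S * (d / 2) ^ (-(n + (ν + 1))) := by
    intro q hq
    have hle : ‖q.1 - q.2‖ ^ (-(n + (ν + 1))) ≤ (d / 2) ^ (-(n + (ν + 1))) :=
      Real.rpow_le_rpow_of_nonpos (by positivity) (hseg q hq) (by linarith)
    rw [Finset.sum_mul]
    refine (norm_sum_le _ _).trans (Finset.sum_le_sum fun i _ => (norm_sub_le _ _).trans ?_)
    rw [norm_smul, norm_smul, add_mul]
    refine add_le_add ?_ ?_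
    · exact (mul_le_of_le_one_right (norm_nonneg _) (norm_fstCoord_le i)).trans
        ((hC i q (hne q hq)).2.trans (mul_le_mul_of_nonneg_left hle (hC0 i)))
    · exact (mul_le_of_le_one_right (norm_nonneg _) (norm_sndCoord_le i)).trans
        ((hC' i q (hne q hq)).2.trans (mul_le_mul_of_nonneg_left hle (hC0' i)))
  have := (convex_segment p (p + w)).norm_image_sub_le_of_norm_hasFDerivWithin_le
    (fun q hq => (h.hasFDerivAt_seriesKernel hν u v (hne q hq)).hasFDerivWithinAt) hb
    (left_mem_segment ℝ p (p + w)) (right_mem_segment ℝ p (p + w))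
  refine this.trans ?_
  have hwt : ‖p + w - p‖ ≤ t := by
    rw [add_sub_cancel_left, ← hw, Prod.norm_def]
    exact max_le (le_add_of_nonneg_right (norm_nonneg _)) (le_add_of_nonneg_left (norm_nonneg _))
  -- As `t ≤ d` and `γ ≤ 1`, one has `t^(1-γ) ≤ d^(1-γ)`; the case `t = 0` is separate because of
  -- the real powers.
  have ht1 : t ≤ t ^ γ * d ^ (1 - γ) := by
    rcases ht0.eq_or_lt with h0 | h0
    · rw [← h0, Real.zero_rpow hγ0.ne', zero_mul]
    · calc t = t ^ γ * t ^ (1 - γ) := by rw [← Real.rpow_add h0]; simp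
        _ ≤ _ := by
          gcongr
          linarith
  calc _ ≤ S * (d / 2) ^ (-(n + (ν + 1))) * (t ^ γ * d ^ (1 - γ)) := by
        gcongr; exact hwt.trans ht1
    _ = S * 2 ^ (n + (ν + 1)) * (t ^ γ * (d ^ (-(n + (ν + 1))) * d ^ (1 - γ))) := by
        rw [Real.div_rpow hd0.le two_pos.le, Real.rpow_neg two_pos.le]
        field_simp
    _ = _ := by
        rw [← Real.rpow_add hd0]
        congr 3
        ring_nf

theorem Represents.isSingularInf (hT : Represents T B u v) (h : IsSymbol B ν) (hν : 0 < n + ν) :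
    T.IsSingularInf ν := by
  intro M γ hγ0 hγ1
  have hm : ∀ m : ℕ, 0 < n + (ν + m) := fun m => by
    have : (0 : ℝ) ≤ m := by positivity
    linarith
  have hrep : ∀ f g : 𝓢(E n, ℂ), HasCompactSupport f → Disjoint (tsupport f) (tsupport g) →
      T.ker (tensor g f) = ∫ p : E n × E n, seriesKernel B u v (p.1, p.2) * f p.2 * g p.1 := by
    intro f g hf hfg
    obtain ⟨δ, hδ, hd⟩ := exists_dist_of_disjoint hf hfg
    rw [h.kernel_eq_integral hν v hT.hasSum _ hδ hd]
    congr 1 with p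
    rw [tensor_apply]
    ring
  choose C hC0 hC using fun α β : Fin n → ℕ =>
    (h.raise_iterate (order α + order β)).exists_seriesKernel_le (hm _) (derivS α u) (derivS β v)
  choose C' hC0' hC' using fun α β : Fin n → ℕ =>
    (h.raise_iterate (order α + order β)).exists_holder (hm _) (derivS α u) (derivS β v) hγ0 hγ1
  let I := multiIndices n M ×ˢ multiIndices n M
  -- One constant for all indices of order at most `M`; the factor `2` accounts for the increments
  -- in `x` and in `y`.
  set S := ∑ i ∈ I, (C i.1 i.2 + 2 * C' i.1 i.2) with hS
  have hle : ∀ α β : Fin n → ℕ, order α + order β ≤ M → C α β + 2 * C' α β ≤ S := fun α β hM =>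
    Finset.single_le_sum (f := fun i : (Fin n → ℕ) × (Fin n → ℕ) => C i.1 i.2 + 2 * C' i.1 i.2)
      (fun i _ => add_nonneg (hC0 _ _) (mul_nonneg two_pos.le (hC0' _ _)))
      (Finset.mem_product.2 ⟨mem_multiIndices.2 (by dsimp; omega), mem_multiIndices.2 (by dsimp; omega)⟩ :
        (α, β) ∈ I)
  refine ⟨fun x y => seriesKernel B u v (x, y), h.contDiffOn_seriesKernel M hν u v, ?_, ?_, S,
    ?_, ?_⟩
  · intro f g hf _ hfg
    exact hrep f g hf.1 hfg
  · intro f g hf _ hfg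
    exact (hT.transpose f g).trans (hrep f g hf hfg)
  · intro α β hM x y hxy
    rw [h.mixedD_seriesKernel hν u v α β hxy, norm_mul, norm_pow, norm_neg, norm_one, one_pow,
      one_mul]
    refine (hC α β (x, y) hxy).2.trans ?_
    have e : -((n : ℝ) + (ν + ((order α + order β : ℕ) : ℝ))) = -((n : ℝ) + ν + order α + order β) := by
      push_cast; ring
    rw [e]
    gcongr
    linarith [hle α β hM, hC0' α β]
  · intro α β hM x y w hw
    have n1 : x ≠ y := by
      rintro rfl
      rw [sub_self, norm_zero] at hw
      linarith [norm_nonneg w]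
    have n2 : x + w ≠ y := by
      rintro rfl
      rw [sub_add_cancel_left, norm_neg] at hw
      linarith [norm_nonneg w]
    have n3 : x ≠ y + w := by
      rintro rfl
      rw [add_sub_cancel_left] at hw
      linarith [norm_nonneg w]
    rw [h.mixedD_seriesKernel hν u v α β n1, h.mixedD_seriesKernel hν u v α β n2,
      h.mixedD_seriesKernel hν u v α β n3, ← mul_sub, ← mul_sub, norm_mul, norm_mul, norm_pow,
      norm_neg, norm_one, one_pow, one_mul, one_mul, norm_sub_rev (seriesKernel _ _ _ (x, y))]
    have e1 := hC' α β (x, y) (w, 0) ‖w‖ hw (by simp)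
    have e2 := hC' α β (x, y) (0, w) ‖w‖ hw (by simp)
    rw [Prod.mk_add_mk, add_zero] at e1 e2
    have e : -((n : ℝ) + (ν + ((order α + order β : ℕ) : ℝ)) + γ) = -((n : ℝ) + ν + M + γ) := by
      rw [hM]; ring
    rw [e] at e1 e2
    refine (add_le_add e1 e2).trans ?_
    rw [← add_mul]
    have := hle α β hM.le
    have := hC0 α β
    gcongr
    linarith

end

/-! ### Estimates for pairings with tensor products -/

theorem normL1_cv_le (f g : 𝓢(E n, ℂ)) : normL1 (cv f g) ≤ normL1 f * normL1 g := by
  have hm : Continuous (Function.uncurry fun x t : E n => ‖f t‖ * ‖g (x - t)‖) := by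
    have := f.continuous
    have := g.continuous
    unfold Function.uncurry
    fun_prop
  have hint : Integrable (Function.uncurry fun x t : E n => ‖f t‖ * ‖g (x - t)‖)
      ((volume : Measure (E n)).prod (volume : Measure (E n))) := by
    have := (f.integrable (μ := volume)).norm.convolution_integrand
      (ContinuousLinearMap.mul ℝ ℝ) (g.integrable (μ := volume)).norm
    exact this
  have h1 : normL1 (cv f g) ≤ ∫ x, ∫ t, ‖f t‖ * ‖g (x - t)‖ := by
    refine integral_mono (cv f g).integrable.norm hint.integral_prod_left fun x => ?_
    dsimp only
    rw [cv_apply]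
    refine (norm_integral_le_integral_norm _).trans_eq ?_
    simp only [norm_mul]
  refine h1.trans_eq ?_
  rw [integral_integral_swap hint]
  simp only [integral_const_mul]
  have : ∀ t : E n, ∫ x, ‖g (x - t)‖ = normL1 g := fun t =>
    integral_sub_right_eq_self (fun x => ‖g x‖) t
  simp only [this, integral_mul_const]
  rfl

theorem norm_cv_apply_le (f g : 𝓢(E n, ℂ)) (x : E n) :
    ‖cv f g x‖ ≤ normL1 f * SchwartzMap.seminorm ℂ 0 0 g := by
  rw [cv_apply, normL1, ← integral_mul_const]
  refine norm_integral_le_of_norm_le (f.integrable.norm.mul_const _)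
    (Eventually.of_forall fun t => ?_)
  rw [norm_mul]
  gcongr
  exact norm_le_seminorm_zero g _

theorem normL1_reflect (f : 𝓢(E n, ℂ)) : normL1 (reflect f) = normL1 f := by
  simp only [normL1, reflect_apply]
  exact integral_neg_eq_self (fun x => ‖f x‖) volume

theorem levelPair_tensor {B : ℤ → E n → ℂ} {ν : ℝ} (h : IsSymbol B ν) (u v g f : 𝓢(E n, ℂ))
    (k : ℤ) : levelPair B u v (tensor g f) k =
      ∫ z, B k z * (cv (reflect (dyadic k u)) g z * cv (dyadic k v) f z) := by
  obtain ⟨D, -, hD⟩ := h.bound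
  exact layer_tensor (h.continuous k) (hD k) _ _ g f

/-- The factor with `g` is measured in the sup norm and the one with `f` in `L¹`, because `g` will
be a derivative of a truncated monomial, whose `L¹` norm is less favourable as `R → ∞`. -/
theorem IsSymbol.exists_norm_levelPair_tensor_le {B : ℤ → E n → ℂ} {ν : ℝ} (h : IsSymbol B ν) :
    ∃ D : ℝ, 0 ≤ D ∧ ∀ (u v g f : 𝓢(E n, ℂ)) (k : ℤ),
      ‖levelPair B u v (tensor g f) k‖ ≤ D * 2 ^ (ν * (k : ℝ)) *
        (normL1 u * SchwartzMap.seminorm ℂ 0 0 g * normL1 (cv (dyadic k v) f)) := by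
  obtain ⟨D, hD0, hD⟩ := h.bound
  refine ⟨D, hD0, fun u v g f k => ?_⟩
  rw [levelPair_tensor h, normL1.eq_1 (cv (dyadic k v) f), ← integral_const_mul, ← integral_const_mul]
  refine norm_integral_le_of_norm_le (((cv (dyadic k v) f).integrable.norm.const_mul _).const_mul _)
    (Eventually.of_forall fun z => ?_)
  rw [norm_mul, norm_mul]
  have h1 := norm_cv_apply_le (reflect (dyadic k u)) g z
  rw [normL1_reflect, normL1_dyadic] at h1
  gcongr
  exact hD k z

theorem norm_two_rpow_mul_le {a b c : ℝ} {k : ℤ} (hab : (a + b) * k ≤ c) :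
    (2 : ℝ) ^ (a * k) * 2 ^ (b * k) ≤ 2 ^ c := by
  rw [← Real.rpow_add two_pos, ← add_mul]
  exact Real.rpow_le_rpow_of_exponent_le one_le_two hab

/-! ### Derivatives of truncated monomials -/

theorem lineDeriv_scale {c : ℝ} (hc : c ≠ 0) (i : Fin n) (u : 𝓢(E n, ℂ)) :
    ∂_{coordVec i} (scale c u) = (c : ℂ) • scale c (∂_{coordVec i} u) := by
  ext x
  rw [_root_.smul_apply, scale_apply hc, SchwartzMap.lineDerivOp_apply_eq_fderiv,
    SchwartzMap.lineDerivOp_apply_eq_fderiv]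
  have e : (scale c u : E n → ℂ) = fun x => u (c • x) := by
    funext x; exact scale_apply hc u x
  have hd : HasFDerivAt (fun x : E n => u (c • x))
      ((fderiv ℝ u (c • x)).comp (c • ContinuousLinearMap.id ℝ (E n))) x :=
    (u.differentiableAt (x := c • x)).hasFDerivAt.comp x
      (c • ContinuousLinearMap.id ℝ (E n)).hasFDerivAt
  rw [e, hd.fderiv]
  simp

theorem derivS_scale {c : ℝ} (hc : c ≠ 0) (α : Fin n → ℕ) (f : 𝓢(E n, ℂ)) :
    derivS α (scale c f) = ((c ^ order α : ℝ) : ℂ) • scale c (derivS α f) := by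
  have := derivS_rel (fun m F G => F = ((c ^ m : ℝ) : ℂ) • scale c G)
    (fun m i F G h => ?_) α (m := 0) (f := scale c f) (g := f) (by simp)
  · simpa using this
  · rw [h]
    have : ∂_{coordVec i} (((c ^ m : ℝ) : ℂ) • scale c G) =
      ((c ^ m : ℝ) : ℂ) • ∂_{coordVec i} (scale c G) :=
        (lineDerivOpCLM ℂ 𝓢(E n, ℂ) (coordVec i)).map_smul _ _
    rw [this, lineDeriv_scale hc, smul_smul, ← Complex.ofReal_mul, ← pow_succ]

theorem derivS_smul (α : Fin n → ℕ) (c : ℂ) (f : 𝓢(E n, ℂ)) :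
    derivS α (c • f) = c • derivS α f :=
  derivS_rel (fun _ F G => F = c • G) (fun _ i F G h => by
    rw [h]; exact (lineDerivOpCLM ℂ 𝓢(E n, ℂ) (coordVec i)).map_smul c G) α (m := 0) rfl

theorem seminorm_zero_scale_le {c : ℝ} (hc : c ≠ 0) (u : 𝓢(E n, ℂ)) :
    SchwartzMap.seminorm ℂ 0 0 (scale c u) ≤ SchwartzMap.seminorm ℂ 0 0 u := by
  refine SchwartzMap.seminorm_le_bound ℂ 0 0 _ (apply_nonneg _ _) fun x => ?_
  rw [pow_zero, one_mul, norm_iteratedFDeriv_zero, scale_apply hc]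
  exact norm_le_seminorm_zero u _

theorem cutMono_eq (α : Fin n → ℕ) (η : 𝓢(E n, ℂ)) {R : ℝ} (hR : R ≠ 0) :
    cutMono α η R = ((R ^ order α : ℝ) : ℂ) • scale R⁻¹ (monoMul α η) := by
  ext x
  rw [cutMono_apply α η hR, _root_.smul_apply, scale_apply (inv_ne_zero hR), monoMul_apply,
    mono_smul, smul_eq_mul]
  have : (R : ℂ) ≠ 0 := by exact_mod_cast hR
  push_cast
  rw [inv_pow]
  field_simp

theorem seminorm_derivS_cutMono_le (α β : Fin n → ℕ) (η : 𝓢(E n, ℂ)) {R : ℝ} (hR : 0 < R) :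
    SchwartzMap.seminorm ℂ 0 0 (derivS β (cutMono α η R)) ≤
      R ^ order α * R⁻¹ ^ order β * SchwartzMap.seminorm ℂ 0 0 (derivS β (monoMul α η)) := by
  have hR' : R⁻¹ ≠ 0 := inv_ne_zero hR.ne'
  rw [cutMono_eq α η hR.ne', derivS_smul, derivS_scale hR', smul_smul, map_smul_eq_mul, norm_mul,
    Complex.norm_real, Complex.norm_real, Real.norm_of_nonneg (by positivity),
    Real.norm_of_nonneg (by positivity)]
  gcongr
  exact seminorm_zero_scale_le hR' _

theorem fstDeriv_tensor (N : ℕ) (i : Fin n) (g f : 𝓢(E n, ℂ)) :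
    fstDeriv N i (tensor g f) = tensor (derivS (Pi.single i N) g) f := by
  rw [derivS_single]
  unfold fstDeriv
  induction N generalizing g with
  | zero => rfl
  | succ N ih =>
    rw [Function.iterate_succ_apply, Function.iterate_succ_apply, ← ih]
    congr 1
    ext p
    have h1 : HasFDerivAt (fun p : E n × E n => g p.1)
        ((fderiv ℝ g p.1).comp (ContinuousLinearMap.fst ℝ (E n) (E n))) p :=
      (g.differentiableAt (x := p.1)).hasFDerivAt.comp p hasFDerivAt_fst
    have h2 : HasFDerivAt (fun p : E n × E n => f p.2)
        ((fderiv ℝ f p.2).comp (ContinuousLinearMap.snd ℝ (E n) (E n))) p :=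
      (f.differentiableAt (x := p.2)).hasFDerivAt.comp p hasFDerivAt_snd
    have h3 : fderiv ℝ (tensor g f) p = _ := (h1.mul h2).fderiv
    rw [SchwartzMap.lineDerivOp_apply_eq_fderiv, h3, tensor_apply,
      SchwartzMap.lineDerivOp_apply_eq_fderiv]
    simp [mul_comm]

/-! ### The transpose annihilates polynomials -/

section

variable {B : ℤ → E n → ℂ} {ν : ℝ} {u v : 𝓢(E n, ℂ)} {T : Operator n}

/-- The transpose of a paraproduct annihilates all polynomials. -/
theorem Represents.trans_annihilates (hT : Represents T B u v) (h : IsSymbol B ν)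
    (hu : HasPrimitives u) (α : Fin n → ℕ) : T.trans.Annihilates α := by
  obtain ⟨N₀, hN₀⟩ := exists_nat_ge (ν + 1)
  -- `N ≥ ν + 1` makes `2^((ν-N)k)` decay geometrically as `k → ∞`, and `N ≥ |α| + 1` makes
  -- `R^(|α|-N)` at most `1/R` for `R ≥ 1`.
  set N := N₀ + order α + 1 with hN
  have hN1 : ν + 1 ≤ N := by rw [hN]; push_cast; linarith [(order α).cast_nonneg (α := ℝ)]
  -- As `k → -∞` the factor `2^((ν-N)k)` grows; the vanishing moments of `ψ` supply `2^(Qk)`, and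
  -- this `Q` leaves at least a factor `2^k`.
  obtain ⟨Q, hQ⟩ := exists_nat_ge (N - ν + 1)
  obtain ⟨P, hP⟩ := exists_gauge_normL1_cv_of_nonpos n Q
  obtain ⟨q, -, hq⟩ := hP v
  obtain ⟨Θ, hΘ⟩ := hu N
  obtain ⟨D, hD0, hD⟩ := h.exists_norm_levelPair_tensor_le
  refine ⟨max P (max T.P (order α)), le_max_of_le_right (le_max_left _ _),
    le_max_of_le_right (le_max_right _ _), fun η _ _ ψ hψ => ?_⟩
  set S : ℝ := ∑ i, normL1 (Θ i) * SchwartzMap.seminorm ℂ 0 0 (derivS (Pi.single i N) (monoMul α η))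
  have hS0 : 0 ≤ S := Finset.sum_nonneg fun i _ => mul_nonneg (normL1_nonneg _) (apply_nonneg _ _)
  set A := |q ψ| + normL1 v * normL1 ψ
  have hA0 : 0 ≤ A :=
    add_nonneg (abs_nonneg _) (mul_nonneg (normL1_nonneg _) (normL1_nonneg _))
  have hvψ : ∀ k : ℤ, (2 : ℝ) ^ ((ν - N) * k) * normL1 (cv (dyadic k v) ψ) ≤
      A * 2 ^ (-(1 * |(k : ℝ)|)) := by
    intro k
    rcases le_total 0 k with hk | hk
    · have hk' : (0 : ℝ) ≤ k := by exact_mod_cast hk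
      have h1 := normL1_cv_le (dyadic k v) ψ
      rw [normL1_dyadic] at h1
      rw [mul_comm]
      gcongr
      · exact h1.trans (le_add_of_nonneg_left (abs_nonneg _))
      · norm_num
      · rw [abs_of_nonneg hk']
        nlinarith
    · have hk' : (k : ℝ) ≤ 0 := by exact_mod_cast hk
      have h1 := hq ψ (hψ.2.mono (le_max_left _ _)) k hk
      have h2 : (2 : ℝ) ^ ((Q : ℤ) * k) = 2 ^ ((Q : ℝ) * k) := by
        rw [← two_rpow_intCast]; push_cast; rfl
      rw [h2] at h1
      calc _ ≤ (2 : ℝ) ^ ((ν - N) * k) * (A * 2 ^ ((Q : ℝ) * k)) := by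
            gcongr
            refine h1.trans ?_
            gcongr
            exact (le_abs_self _).trans (le_add_of_nonneg_right
              (mul_nonneg (normL1_nonneg _) (normL1_nonneg _)))
        _ = A * ((2 : ℝ) ^ ((ν - N) * k) * 2 ^ ((Q : ℝ) * k)) := by ring
        _ ≤ _ := by
            gcongr
            refine norm_two_rpow_mul_le ?_
            rw [abs_of_nonpos hk']
            nlinarith
  -- The `N` derivatives taken from `u` fall on the truncated monomial, which sits in the first
  -- variable, and produce the factor `R^(|α|-N)`.
  have hterm : ∀ R : ℝ, 0 < R → ∀ k, ‖levelPair B u v (tensor (cutMono α η R) ψ) k‖ ≤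
      D * S * A * (R ^ order α * R⁻¹ ^ N) * 2 ^ (-(1 * |(k : ℝ)|)) := by
    intro R hR k
    have h2 : (0 : ℝ) < 2 ^ k := by positivity
    rw [hΘ, h.levelPair_primitive, norm_mul, norm_mul, norm_pow (-1 : ℂ), norm_neg, norm_one,
      one_pow, mul_one, Complex.norm_real, Real.norm_of_nonneg (by positivity)]
    have hi : ∀ i, ‖levelPair B (Θ i) v (fstDeriv N i (tensor (cutMono α η R) ψ)) k‖ ≤
        D * 2 ^ (ν * (k : ℝ)) * (normL1 (Θ i) * (R ^ order α * R⁻¹ ^ N *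
          SchwartzMap.seminorm ℂ 0 0 (derivS (Pi.single i N) (monoMul α η))) *
            normL1 (cv (dyadic k v) ψ)) := by
      intro i
      rw [fstDeriv_tensor]
      refine (hD _ _ _ _ k).trans ?_
      have h3 := seminorm_derivS_cutMono_le α (Pi.single i N) η hR
      rw [order_single] at h3
      have := normL1_nonneg (Θ i)
      have := normL1_nonneg (cv (dyadic k v) ψ)
      gcongr
    have e : ((2 : ℝ) ^ k)⁻¹ ^ N * 2 ^ (ν * (k : ℝ)) = 2 ^ ((ν - N) * k) := by
      rw [← two_rpow_intCast, ← Real.rpow_neg two_pos.le, ← Real.rpow_natCast, ← Real.rpow_mul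
        two_pos.le, ← Real.rpow_add two_pos]
      congr 1
      ring
    calc _ ≤ ((2 : ℝ) ^ k)⁻¹ ^ N * ∑ i, D * 2 ^ (ν * (k : ℝ)) * (normL1 (Θ i) *
          (R ^ order α * R⁻¹ ^ N *
          SchwartzMap.seminorm ℂ 0 0 (derivS (Pi.single i N) (monoMul α η))) *
            normL1 (cv (dyadic k v) ψ)) := by
          gcongr
          exact (norm_sum_le _ _).trans (Finset.sum_le_sum fun i _ => hi i)
      _ = D * S * (R ^ order α * R⁻¹ ^ N) *
          ((((2 : ℝ) ^ k)⁻¹ ^ N * 2 ^ (ν * (k : ℝ))) * normL1 (cv (dyadic k v) ψ)) := by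
          simp only [S, Finset.mul_sum, Finset.sum_mul]
          refine Finset.sum_congr rfl fun i _ => ?_
          ring
      _ ≤ D * S * (R ^ order α * R⁻¹ ^ N) * (A * 2 ^ (-(1 * |(k : ℝ)|))) := by
          rw [e]
          exact mul_le_mul_of_nonneg_left (hvψ k) (by positivity)
      _ = _ := by ring
  have hsum := summable_two_rpow_neg_abs one_pos
  have hbound : ∀ R : ℝ, 1 ≤ R → ‖T.trans.pair (cutMono α η R) ψ‖ ≤
      D * S * A * (∑' k : ℤ, (2 : ℝ) ^ (-(1 * |(k : ℝ)|))) * R⁻¹ := by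
    intro R hR
    have hR0 : 0 < R := by linarith
    have e : T.trans.pair (cutMono α η R) ψ = T.ker (tensor (cutMono α η R) ψ) :=
      hT.transpose _ _
    rw [e, ← (hT.hasSum _).tsum_eq]
    refine (tsum_of_norm_bounded (hsum.mul_left _).hasSum (hterm R hR0)).trans ?_
    rw [tsum_mul_left]
    have h1 : R ^ order α * R⁻¹ ^ N ≤ R⁻¹ := by
      rw [hN, add_assoc, add_comm N₀, add_assoc, pow_add, ← mul_assoc, ← mul_pow,
        mul_inv_cancel₀ hR0.ne', one_pow, one_mul, pow_add, pow_one]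
      exact mul_le_of_le_one_right (by positivity)
        (pow_le_one₀ (by positivity) (inv_le_one_of_one_le₀ hR))
    have h0 : 0 ≤ ∑' k : ℤ, (2 : ℝ) ^ (-(1 * |(k : ℝ)|)) := tsum_nonneg fun k => by positivity
    calc _ ≤ D * S * A * R⁻¹ * ∑' k : ℤ, (2 : ℝ) ^ (-(1 * |(k : ℝ)|)) := by gcongr
      _ = _ := by ring
  refine squeeze_zero_norm' (a := fun R => D * S * A * (∑' k : ℤ, (2 : ℝ) ^ (-(1 * |(k : ℝ)|))) * R⁻¹)
    ?_ ?_
  · filter_upwards [eventually_ge_atTop 1] with R hR using hbound R hR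
  · simpa using tendsto_inv_atTop_zero.const_mul
      (D * S * A * (∑' k : ℤ, (2 : ℝ) ^ (-(1 * |(k : ℝ)|))))

/-! ### Weak boundedness -/

theorem normL1_tensor (g f : 𝓢(E n, ℂ)) : normL1 (tensor g f) = normL1 g * normL1 f := by
  simp only [normL1, tensor_apply, norm_mul]
  exact integral_prod_mul (fun x => ‖g x‖) (fun y => ‖f y‖)

theorem normL1_le_of_support {g : 𝓢(E n, ℂ)} {c : E n} {r A : ℝ}
    (hg : tsupport g ⊆ Metric.ball c r) (hA : ∀ x, ‖g x‖ ≤ A) :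
    normL1 g ≤ A * volume.real (Metric.ball c r) := by
  have e : normL1 g = ∫ x in Metric.ball c r, ‖g x‖ := by
    rw [normL1, setIntegral_eq_integral_of_forall_compl_eq_zero]
    intro x hx
    rw [image_eq_zero_of_notMem_tsupport fun h => hx (hg h), norm_zero]
  rw [e]
  refine (le_abs_self _).trans ?_
  refine norm_setIntegral_le_of_norm_le_const (f := fun x => ‖g x‖) measure_ball_lt_top
    fun x _ => ?_
  rw [norm_norm]
  exact hA x

/-- With `V` the volume of the ball, the tensor product of two normalized bumps has `L¹` norm at
most `V²` and length scale `V^(1/n)`. The scaled kernel bound gives `V² V^(-(n+ν)/n) = V^(1-ν/n)`.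
-/
theorem Represents.wbp (hn : 0 < n) (hT : Represents T B u v) (h : IsSymbol B ν) (hν : 0 < n + ν)
    (hu : HasPrimitives u) : T.WBP ν := by
  obtain ⟨N, hN⟩ := exists_nat_gt (n + ν)
  obtain ⟨C, hC0, hC⟩ := h.exists_norm_kernel_le hν hu v hN
  have hn' : (n : ℝ) ≠ 0 := by exact_mod_cast hn.ne'
  have main : ∀ (c : E n) (r : ℝ), 0 < r → ∀ g f : 𝓢(E n, ℂ),
      tsupport g ⊆ Metric.ball c r → tsupport f ⊆ Metric.ball c r →
      (∀ β : Fin n → ℕ, order β ≤ N → ∀ x,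
        ‖multiD β g x‖ ≤ volume.real (Metric.ball c r) ^ (-(order β : ℝ) / n)) →
      (∀ β : Fin n → ℕ, order β ≤ N → ∀ x,
        ‖multiD β f x‖ ≤ volume.real (Metric.ball c r) ^ (-(order β : ℝ) / n)) →
      ‖T.ker (tensor g f)‖ ≤ C * n * volume.real (Metric.ball c r) ^ (1 - ν / n) := by
    intro c r hr g f hgs hfs hg hf
    set V := volume.real (Metric.ball c r) with hV
    have hV0 : 0 < V := ENNReal.toReal_pos
      (Metric.measure_ball_pos volume c hr).ne' measure_ball_lt_top.ne
    set ρ := V ^ ((n : ℝ)⁻¹) with hρ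
    have hρ0 : 0 < ρ := by positivity
    have one : ∀ (f : 𝓢(E n, ℂ)), (∀ β : Fin n → ℕ, order β ≤ N → ∀ x,
        ‖multiD β f x‖ ≤ V ^ (-(order β : ℝ) / n)) → ∀ x, ‖f x‖ ≤ 1 := by
      intro f hf x
      have := hf 0 (by simp [order_zero]) x
      rw [multiD_coe, derivS_zero, order_zero] at this
      simpa using this
    have hf1 : normL1 f ≤ V := by simpa using normL1_le_of_support hfs (one f hf)
    have hg1 : normL1 g ≤ V := by simpa using normL1_le_of_support hgs (one g hg)
    have hρN : (ρ ^ N)⁻¹ = V ^ (-(N : ℝ) / n) := by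
      rw [hρ, ← Real.rpow_natCast, ← Real.rpow_mul hV0.le, ← Real.rpow_neg hV0.le]
      congr 1
      field_simp
    have hn1 : (1 : ℝ) ≤ n := by exact_mod_cast hn
    -- The factor `n` is not needed here; it matches the sum of `n` pure derivatives below, since
    -- both bounds must share the constant `A`.
    have h1 : normL1 (tensor g f) ≤ n * (V * V) := by
      rw [normL1_tensor]
      calc _ ≤ 1 * (V * V) := by
            rw [one_mul]
            exact mul_le_mul hg1 hf1 (normL1_nonneg _) hV0.le
        _ ≤ _ := by gcongr
    have h2 : derivNorm N (tensor g f) ≤ n * (V * V) * (ρ ^ N)⁻¹ := by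
      have hi : ∀ i : Fin n, normL1 (fstDeriv N i (tensor g f)) ≤ V * V * (ρ ^ N)⁻¹ := by
        intro i
        rw [fstDeriv_tensor, normL1_tensor]
        have h3 : normL1 (derivS (Pi.single i N) g) ≤ (ρ ^ N)⁻¹ * V := by
          refine normL1_le_of_support ((tsupport_derivS_subset _ g).trans hgs) fun x => ?_
          have := hg (Pi.single i N) (by rw [order_single]) x
          rwa [multiD_coe, order_single, ← hρN] at this
        calc _ ≤ ((ρ ^ N)⁻¹ * V) * V :=
              mul_le_mul h3 hf1 (normL1_nonneg _) (by positivity)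
          _ = _ := by ring
      refine (Finset.sum_le_sum fun i _ => hi i).trans_eq ?_
      rw [Finset.sum_const, Finset.card_univ, Fintype.card_fin, nsmul_eq_mul]
      ring
    refine (hC T.ker hT.hasSum _ _ ρ hρ0 h1 h2).trans_eq ?_
    have e : V * V * ρ ^ (-(n + ν)) = V ^ (1 - ν / n) := by
      rw [hρ, ← Real.rpow_mul hV0.le]
      nth_rewrite 1 2 [← Real.rpow_one V]
      rw [← Real.rpow_add hV0, ← Real.rpow_add hV0]
      congr 1
      field_simp
      ring
    rw [← e]
    ring
  refine ⟨T.P, N, C * n + C * n, le_rfl, fun c r hr ψ φ _ _ hψ hφ hb => ?_⟩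
  rw [add_mul]
  refine add_le_add ?_ ?_
  · exact main c r hr φ ψ hφ hψ (fun β hβ x => (hb β hβ x).2) (fun β hβ x => (hb β hβ x).1)
  · have e : T.trans.pair ψ φ = T.ker (tensor ψ φ) := hT.transpose _ _
    rw [e]
    exact main c r hr ψ φ hψ hφ (fun β hβ x => (hb β hβ x).1) (fun β hβ x => (hb β hβ x).2)

end

/-! ### Functionals given by a symbol -/

/-- The contribution of the scale `2 ^ (-k)` to the functional
`ψ ↦ ∑_k ∫ B_k (u_k (- ·) * ψ)`. -/
noncomputable def symbolPair (B : ℤ → E n → ℂ) (u ψ : 𝓢(E n, ℂ)) (k : ℤ) : ℂ :=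
  ∫ z, B k z * cv (reflect (dyadic k u)) ψ z

theorem reflect_dyadic (k : ℤ) (u : 𝓢(E n, ℂ)) : reflect (dyadic k u) = dyadic k (reflect u) := by
  ext x
  rw [reflect_apply, dyadic_apply, dyadic_apply, reflect_apply, smul_neg]

theorem InSInf.reflect {u : 𝓢(E n, ℂ)} (h : InSInf u) : InSInf (SingInt.reflect u) :=
  fun P => (h P).scale (by norm_num)

/-- Decay `2^(-Q|k|)` with `Q ≥ |a| + 1` beats the weight in both directions. The number `P` depends
on `n` and `a` alone and not on `u`, which lets the moments of `ψ` be fixed before its partner `ψ'`.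
-/
theorem exists_gauge_symbolPair (n : ℕ) (a : ℝ) : ∃ P : ℕ, ∀ u : 𝓢(E n, ℂ), InSInf u →
    ∃ q : 𝓢(E n, ℂ) → ℝ, IsGauge q ∧ ∀ ψ, InSP P ψ → ∀ k : ℤ,
      2 ^ (a * k) * normL1 (cv (dyadic k u) ψ) ≤ q ψ * 2 ^ (-(1 * |(k : ℝ)|)) := by
  obtain ⟨Q, hQ⟩ := exists_nat_ge (|a| + 1)
  obtain ⟨P, hP⟩ := exists_gauge_normL1_cv n Q
  refine ⟨P, fun u hu => ?_⟩
  obtain ⟨q, hq, h⟩ := hP u hu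
  refine ⟨q, hq, fun ψ hψ k => ?_⟩
  have h1 := h ψ hψ k
  have e : (2 : ℝ) ^ (-((Q : ℤ) * |k|)) = 2 ^ (-(Q * |(k : ℝ)|)) := by
    rw [← two_rpow_intCast]; push_cast; rfl
  rw [e] at h1
  calc _ ≤ (2 : ℝ) ^ (a * k) * (q ψ * 2 ^ (-(Q * |(k : ℝ)|))) := by gcongr
    _ = q ψ * (2 ^ (a * k) * 2 ^ (-(Q * |(k : ℝ)|))) := by ring
    _ ≤ _ := by
      have := hq.nonneg ψ
      rw [← Real.rpow_add two_pos]
      gcongr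
      · norm_num
      · have h2 : a * k ≤ |a| * |(k : ℝ)| := by rw [← abs_mul]; exact le_abs_self _
        nlinarith [abs_nonneg (k : ℝ)]

section

variable {B : ℤ → E n → ℂ} {ν : ℝ} {u v : 𝓢(E n, ℂ)}

theorem IsSymbol.integrable_mul (h : IsSymbol B ν) (k : ℤ) (g : 𝓢(E n, ℂ)) :
    Integrable fun z => B k z * g z := by
  obtain ⟨D, -, hD⟩ := h.bound
  exact g.integrable.bdd_mul (h.continuous k).aestronglyMeasurable
    (Eventually.of_forall (hD k))

theorem IsSymbol.exists_norm_symbolPair_le (h : IsSymbol B ν) : ∃ D : ℝ, 0 ≤ D ∧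
    ∀ (u ψ : 𝓢(E n, ℂ)) (k : ℤ), ‖symbolPair B u ψ k‖ ≤
      D * (2 ^ (ν * (k : ℝ)) * normL1 (cv (dyadic k (reflect u)) ψ)) := by
  obtain ⟨D, hD0, hD⟩ := h.bound
  refine ⟨D, hD0, fun u ψ k => ?_⟩
  rw [symbolPair, reflect_dyadic, ← mul_assoc, normL1, ← integral_const_mul]
  refine norm_integral_le_of_norm_le ((cv _ ψ).integrable.norm.const_mul _)
    (Eventually.of_forall fun z => ?_)
  rw [norm_mul]
  gcongr
  exact hD k z

theorem cv_add_right (f g h : 𝓢(E n, ℂ)) : cv f (g + h) = cv f g + cv f h :=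
  map_add (SchwartzMap.convolution (ContinuousLinearMap.mul ℂ ℂ) f) g h

theorem cv_smul_right (c : ℂ) (f g : 𝓢(E n, ℂ)) : cv f (c • g) = c • cv f g := by
  rw [cv_comm, cv_smul_left, cv_comm]

theorem IsSymbol.symbolPair_add (h : IsSymbol B ν) (u f g : 𝓢(E n, ℂ)) (k : ℤ) :
    symbolPair B u (f + g) k = symbolPair B u f k + symbolPair B u g k := by
  simp only [symbolPair, cv_add_right, _root_.add_apply, mul_add]
  exact integral_add (h.integrable_mul k _) (h.integrable_mul k _)

theorem symbolPair_smul (B : ℤ → E n → ℂ) (c : ℂ) (u f : 𝓢(E n, ℂ)) (k : ℤ) :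
    symbolPair B u (c • f) k = c * symbolPair B u f k := by
  simp only [symbolPair, cv_smul_right, _root_.smul_apply, smul_eq_mul]
  rw [← integral_const_mul]
  congr 1 with z
  ring

/-- A continuous projection onto `𝓢_P`. -/
theorem exists_moment_projection (n P : ℕ) : ∃ Q : 𝓢(E n, ℂ) →L[ℂ] 𝓢(E n, ℂ),
    (∀ g, InSP P (Q g)) ∧ ∀ g, InSP P g → Q g = g := by
  obtain ⟨φ, hφ⟩ := exists_dual_function n
  -- The normalized derivatives of `φ` form a system biorthogonal to the moments, so subtracting the
  -- corresponding combination removes all moments of order at most `P`.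
  let e : (Fin n → ℕ) → 𝓢(E n, ℂ) := fun γ =>
    ((-1) ^ order γ / ((∏ i, (γ i).factorial : ℕ) : ℂ)) • derivS γ φ
  have he : ∀ α γ, order α ≤ P → moment α (e γ) = if α = γ then 1 else 0 := by
    intro α γ hα
    rw [moment_smul, moment_derivS_of_dual (fun γ _ => hφ γ) α γ hα]
    split_ifs with h
    · have h0 : ((∏ i, (γ i).factorial : ℕ) : ℂ) ≠ 0 := by
        exact_mod_cast Finset.prod_ne_zero_iff.2 fun i _ => (γ i).factorial_ne_zero
      field_simp
      rw [← pow_mul, mul_comm, pow_mul]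
      norm_num
    · rw [mul_zero]
  let m : (Fin n → ℕ) → 𝓢(E n, ℂ) →L[ℂ] ℂ := fun γ => integralCLM ℂ volume ∘L monoMul γ
  have hm : ∀ γ g, m γ g = moment γ g := fun γ g => (moment_eq γ g).symm
  refine ⟨ContinuousLinearMap.id ℂ _ - ∑ γ ∈ multiIndices n P, (m γ).smulRight (e γ),
    fun g => ?_, fun g hg => ?_⟩
  · rw [inSP_iff]
    intro α hα
    have e1 : (ContinuousLinearMap.id ℂ 𝓢(E n, ℂ) -
        ∑ γ ∈ multiIndices n P, (m γ).smulRight (e γ)) g =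
        g - ∑ γ ∈ multiIndices n P, moment γ g • e γ := by
      simp [_root_.sum_apply, hm]
    rw [e1, moment_sub, moment_sum, Finset.sum_eq_single α]
    · rw [moment_smul, he α α hα, if_pos rfl, mul_one, sub_self]
    · intro γ _ hγ
      rw [moment_smul, he α γ hα, if_neg hγ.symm, mul_zero]
    · intro h
      exact absurd (mem_multiIndices.2 hα) h
  · rw [inSP_iff] at hg
    have : ∀ γ ∈ multiIndices n P, moment γ g • e γ = 0 := fun γ hγ => by
      rw [hg γ (mem_multiIndices.1 hγ), zero_smul]
    simp [_root_.sum_apply, hm, Finset.sum_eq_zero this]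

/-- The functional of a symbol is given on some `𝓢_P` by a tempered distribution. -/
theorem exists_distribution (n : ℕ) (ν : ℝ) : ∃ P : ℕ, ∀ (B : ℤ → E n → ℂ) (u : 𝓢(E n, ℂ)),
    IsSymbol B ν → InSInf u →
      ∃ A : 𝓢'(E n, ℂ), ∀ ψ, InSP P ψ → HasSum (symbolPair B u ψ) (A ψ) := by
  obtain ⟨P, hP⟩ := exists_gauge_symbolPair n ν
  refine ⟨P, fun B u h hu => ?_⟩
  obtain ⟨q, hq, hb⟩ := hP (reflect u) hu.reflect
  obtain ⟨D, hD0, hD⟩ := h.exists_norm_symbolPair_le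
  obtain ⟨Q, hQ, hQ'⟩ := exists_moment_projection n P
  have hw := summable_two_rpow_neg_abs one_pos
  have hbound : ∀ ψ, InSP P ψ → ∀ k,
      ‖symbolPair B u ψ k‖ ≤ D * q ψ * 2 ^ (-(1 * |(k : ℝ)|)) := fun ψ hψ k =>
    (hD u ψ k).trans (by rw [mul_assoc]; exact mul_le_mul_of_nonneg_left (hb ψ hψ k) hD0)
  have hs : ∀ ψ, InSP P ψ → Summable (symbolPair B u ψ) := fun ψ hψ =>
    Summable.of_norm_bounded (hw.mul_left _) (hbound ψ hψ)
  -- Convergence is established only on `𝓢_P`. Composing with the projection `Q` extends the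
  -- functional to all Schwartz functions without changing it there.
  let A : 𝓢(E n, ℂ) →ₗ[ℂ] ℂ :=
    { toFun := fun F => ∑' k, symbolPair B u (Q F) k
      map_add' := fun F G => by
        rw [← (hs _ (hQ F)).tsum_add (hs _ (hQ G)), map_add]
        exact tsum_congr fun k => h.symbolPair_add u _ _ k
      map_smul' := fun c F => by
        rw [RingHom.id_apply, smul_eq_mul, ← tsum_mul_left, map_smul]
        exact tsum_congr fun k => symbolPair_smul B c u _ k }
  have h0 : 0 ≤ D * ∑' k : ℤ, (2 : ℝ) ^ (-(1 * |(k : ℝ)|)) :=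
    mul_nonneg hD0 (tsum_nonneg fun k => by positivity)
  have hA : Continuous A := by
    refine ((hq.comp (L := fun g => Q g) Q.continuous Q.map_zero).const_mul h0).continuous_of_le A
      fun F => ?_
    refine (tsum_of_norm_bounded (hw.mul_left _).hasSum (hbound _ (hQ F))).trans_eq ?_
    rw [tsum_mul_left]
    ring
  refine ⟨ContinuousLinearMap.toPointwiseConvergenceCLM _ _ _ _ ⟨A, hA⟩, fun ψ hψ => ?_⟩
  have e : (ContinuousLinearMap.toPointwiseConvergenceCLM _ _ _ _
      (⟨A, hA⟩ : 𝓢(E n, ℂ) →L[ℂ] ℂ) : 𝓢'(E n, ℂ)) ψ = ∑' k, symbolPair B u ψ k := by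
    change ∑' k, symbolPair B u (Q ψ) k = _
    rw [hQ' ψ hψ]
  rw [e]
  exact (hs ψ hψ).hasSum

/-! ### Besov bounds -/

theorem BesovBound.add {θ : 𝓢(E n, ℂ)} {s : ℝ} {b b' : 𝓢'(E n, ℂ)} (h : BesovBound θ s b)
    (h' : BesovBound θ s b') : BesovBound θ s (b + b') := by
  obtain ⟨C, hC⟩ := h
  obtain ⟨C', hC'⟩ := h'
  refine ⟨C + C', fun k x => ?_⟩
  have e : distConv θ k (b + b') x = distConv θ k b x + distConv θ k b' x := rfl
  rw [e]
  calc _ ≤ (2 : ℝ) ^ (s * k) * (‖distConv θ k b x‖ + ‖distConv θ k b' x‖) := by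
        gcongr; exact norm_add_le _ _
    _ ≤ _ := by rw [mul_add]; exact add_le_add (hC k x) (hC' k x)

theorem BesovBound.smul {θ : 𝓢(E n, ℂ)} {s : ℝ} {b : 𝓢'(E n, ℂ)} (c : ℂ) (h : BesovBound θ s b) :
    BesovBound θ s (c • b) := by
  obtain ⟨C, hC⟩ := h
  refine ⟨‖c‖ * C, fun k x => ?_⟩
  have e : distConv θ k (c • b) x = c * distConv θ k b x := rfl
  rw [e, norm_mul, mul_left_comm]
  exact mul_le_mul_of_nonneg_left (hC k x) (norm_nonneg c)

theorem BesovBound.zero (θ : 𝓢(E n, ℂ)) (s : ℝ) : BesovBound θ s (0 : 𝓢'(E n, ℂ)) :=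
  ⟨0, fun k x => by
    have e : distConv θ k (0 : 𝓢'(E n, ℂ)) x = 0 := rfl
    rw [e, norm_zero, mul_zero]⟩

theorem BesovBound.sum {ι : Type*} {t : Finset ι} {θ : 𝓢(E n, ℂ)} {s : ℝ} {b : ι → 𝓢'(E n, ℂ)}
    (h : ∀ i ∈ t, BesovBound θ s (b i)) : BesovBound θ s (∑ i ∈ t, b i) := by
  classical
  induction t using Finset.induction_on with
  | empty => simpa using BesovBound.zero θ s
  | insert i t hi ih =>
    rw [Finset.sum_insert hi]
    exact (h i (Finset.mem_insert_self i t)).add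
      (ih fun j hj => h j (Finset.mem_insert_of_mem hj))

theorem dyadic_cv (k : ℤ) (f g : 𝓢(E n, ℂ)) : dyadic k (cv f g) = cv (dyadic k f) (dyadic k g) :=
  ext_fourier fun ξ => by simp only [fourier_dyadic, fourier_cv]

theorem dyadic_dyadic (j k : ℤ) (f : 𝓢(E n, ℂ)) : dyadic j (dyadic k f) = dyadic (j + k) f :=
  ext_fourier fun ξ => by
    simp only [fourier_dyadic, smul_smul]
    rw [← zpow_add₀ two_ne_zero, neg_add_rev]

theorem reflect_cv (f g : 𝓢(E n, ℂ)) : reflect (cv f g) = cv (reflect f) (reflect g) :=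
  ext_fourier fun ξ => by simp only [fourier_reflect, fourier_cv]

theorem normL1_cv_translate (f g : 𝓢(E n, ℂ)) (a : E n) :
    normL1 (cv f (translate a g)) = normL1 (cv f g) := by
  have e : ∀ x, cv f (translate a g) x = cv f g (x - a) := by
    intro x
    rw [cv_apply, cv_apply]
    congr 1 with t
    have : translate a g (x - t) = g (x - t - a) := rfl
    rw [this, sub_right_comm]
  simp only [normL1, e]
  exact integral_sub_right_eq_self (fun x => ‖cv f g x‖) a

/-- Scale and translation invariance of the `L¹` norm: only the relative scale `j - k` matters. -/
theorem normL1_cv_dyadic_dyadic (j k : ℤ) (u θ : 𝓢(E n, ℂ)) (a : E n) :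
    normL1 (cv (dyadic j (reflect u)) (translate a (reflect (dyadic k θ)))) =
      normL1 (cv (dyadic (j - k) u) θ) := by
  rw [normL1_cv_translate, ← reflect_dyadic, ← reflect_cv, normL1_reflect,
    show dyadic j u = dyadic k (dyadic (j - k) u) by rw [dyadic_dyadic]; congr 1; ring,
    ← dyadic_cv, normL1_dyadic]

/-- A distribution given by a symbol of order `ν` has regularity `-ν`. -/
theorem exists_besovBound_of_symbol (n : ℕ) (ν : ℝ) : ∃ P₀ : ℕ, ∀ (B : ℤ → E n → ℂ)
    (u : 𝓢(E n, ℂ)) (b : 𝓢'(E n, ℂ)) (P : ℕ), IsSymbol B ν → InSInf u →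
      (∀ ψ, InSP P ψ → HasSum (symbolPair B u ψ) (b ψ)) →
      ∀ θ, InSP P₀ θ → InSP P θ → BesovBound θ (-ν) b := by
  obtain ⟨P₀, hP₀⟩ := exists_gauge_symbolPair n ν
  refine ⟨P₀, fun B u b P h hu hb θ hθ₀ hθ => ?_⟩
  obtain ⟨q, hq, hqb⟩ := hP₀ u hu
  obtain ⟨D, hD0, hD⟩ := h.exists_norm_symbolPair_le
  have hw := summable_two_rpow_neg_abs one_pos
  refine ⟨D * q θ * ∑' k : ℤ, (2 : ℝ) ^ (-(1 * |(k : ℝ)|)), fun k x => ?_⟩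
  have hmem : InSP P (translate x (reflect (dyadic k θ))) :=
    ((hθ.dyadic k).scale (by norm_num)).translate x
  have hs := hb _ hmem
  -- Almost orthogonality: terms decay in `|j - k|`, and the common factor `2^(νk)` is exactly
  -- compensated by the weight in the Besov norm of order `-ν`.
  have hterm : ∀ j : ℤ, ‖symbolPair B u (translate x (reflect (dyadic k θ))) j‖ ≤
      2 ^ (ν * (k : ℝ)) * (D * q θ * 2 ^ (-(1 * |((j - k : ℤ) : ℝ)|))) := by
    intro j
    refine (hD u _ j).trans ?_
    rw [normL1_cv_dyadic_dyadic]
    have h1 := hqb θ hθ₀ (j - k)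
    have e : (2 : ℝ) ^ (ν * (j : ℝ)) = 2 ^ (ν * (k : ℝ)) * 2 ^ (ν * ((j - k : ℤ) : ℝ)) := by
      rw [← Real.rpow_add two_pos]
      congr 1
      push_cast
      ring
    calc _ = D * 2 ^ (ν * (k : ℝ)) *
          (2 ^ (ν * ((j - k : ℤ) : ℝ)) * normL1 (cv (dyadic (j - k) u) θ)) := by rw [e]; ring
      _ ≤ D * 2 ^ (ν * (k : ℝ)) * (q θ * 2 ^ (-(1 * |((j - k : ℤ) : ℝ)|))) := by gcongr
      _ = _ := by ring
  have hsum : HasSum (fun j : ℤ => 2 ^ (ν * (k : ℝ)) * (D * q θ * 2 ^ (-(1 * |((j - k : ℤ) : ℝ)|))))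
      (2 ^ (ν * (k : ℝ)) * (D * q θ * ∑' k : ℤ, (2 : ℝ) ^ (-(1 * |(k : ℝ)|)))) :=
    (((Equiv.subRight k).hasSum_iff (f := fun i : ℤ => (2 : ℝ) ^ (-(1 * |(i : ℝ)|)))).2
      hw.hasSum |>.mul_left _).mul_left _
  have hle : ‖distConv θ k b x‖ ≤ 2 ^ (ν * (k : ℝ)) *
      (D * q θ * ∑' k : ℤ, (2 : ℝ) ^ (-(1 * |(k : ℝ)|))) := by
    have e : distConv θ k b x = b (translate x (reflect (dyadic k θ))) := rfl
    rw [e, ← hs.tsum_eq]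
    exact tsum_of_norm_bounded hsum hterm
  calc _ ≤ (2 : ℝ) ^ (-ν * k) * (2 ^ (ν * (k : ℝ)) *
        (D * q θ * ∑' k : ℤ, (2 : ℝ) ^ (-(1 * |(k : ℝ)|)))) := by gcongr
    _ = _ := by
      rw [← mul_assoc, ← Real.rpow_add two_pos, ← add_mul, neg_add_cancel, zero_mul,
        Real.rpow_zero, one_mul]

/-- The functional of a symbol of order `ν` is given by a tempered distribution of regularity
`-ν`. -/
theorem exists_distribution_besovBound (n : ℕ) (ν : ℝ) : ∃ P : ℕ, ∀ (B : ℤ → E n → ℂ)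
    (u : 𝓢(E n, ℂ)), IsSymbol B ν → InSInf u → ∃ A : 𝓢'(E n, ℂ),
      (∀ ψ, InSP P ψ → HasSum (symbolPair B u ψ) (A ψ)) ∧
      ∀ θ, InSP P θ → BesovBound θ (-ν) A := by
  obtain ⟨P, hP⟩ := exists_distribution n ν
  obtain ⟨P₀, hP₀⟩ := exists_besovBound_of_symbol n ν
  refine ⟨max P P₀, fun B u h hu => ?_⟩
  obtain ⟨A, hA⟩ := hP B u h hu
  exact ⟨A, fun ψ hψ => hA ψ (hψ.mono (le_max_left _ _)), fun θ hθ =>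
    hP₀ B u A P h hu hA θ (hθ.mono (le_max_right _ _)) (hθ.mono (le_max_left _ _))⟩

theorem BesovBound.isSymbol {θ : 𝓢(E n, ℂ)} {s : ℝ} {b : 𝓢'(E n, ℂ)} (h : BesovBound θ s b) :
    IsSymbol (fun k => distConv θ k b) (-s) := by
  obtain ⟨C, hC⟩ := h
  have hC0 : 0 ≤ C := le_trans (by positivity) (hC 0 0)
  refine ⟨fun k => continuous_distribution_translate b _, C, hC0, fun k z => ?_⟩
  have h1 := hC k z
  rw [neg_mul, Real.rpow_neg two_pos.le, ← div_eq_mul_inv, le_div_iff₀ (by positivity), mul_comm]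
  exact h1

theorem Resolves.reflect {a a' : 𝓢(E n, ℂ)} (h : Resolves a a') :
    Resolves (SingInt.reflect a) (SingInt.reflect a') := by
  have e : ((𝓕 (SingInt.reflect a') : 𝓢(E n, ℂ)) : E n → ℂ) =
      (𝓕 a' : 𝓢(E n, ℂ)) ∘ (Homeomorph.neg (E n)) := by
    funext ξ; exact fourier_reflect a' ξ
  refine ⟨fun ξ => ?_, ?_, ?_⟩
  · rw [fourier_reflect, fourier_reflect, h.mul_fourier, annulusBump_neg]
  · rw [e]
    exact h.compact.comp_homeomorph _
  · intro ξ hξ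
    rw [e, tsupport_comp_eq_preimage] at hξ
    have := h.support hξ
    simpa using this

/-- The reproducing formula in terms of `a_k * b`. -/
theorem Resolves.exists_hasSum_symbolPair {a a' : 𝓢(E n, ℂ)} (h : Resolves a a')
    (b : 𝓢'(E n, ℂ)) : ∃ P : ℕ, ∀ ψ, InSP P ψ →
      HasSum (symbolPair (fun k => distConv a k b) a' ψ) (b ψ) := by
  -- The pair is reflected because `b` applied to the translate by `z` of the reflected `a_k` is
  -- `(a_k * b)(z)`.
  obtain ⟨P, hP⟩ := h.reflect.exists_hasSum_distribution b
  refine ⟨P, fun ψ hψ => ?_⟩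
  have e : (fun k : ℤ => b (block (SingInt.reflect a) (SingInt.reflect a') k ψ)) =
      symbolPair (fun k => distConv a k b) a' ψ := by
    funext k
    rw [block, distribution_cv, symbolPair, reflect_dyadic]
    congr 1 with z
    rw [mul_comm, ← reflect_dyadic]
    rfl
  rw [← e]
  exact hP ψ hψ

end

/-! ### Non-convolution moments of represented operators -/

/-- The truncation `η(·/R)` tends boundedly to `η 0 = 1`, so convolving it with `w` tends to the
total integral of `w`. -/
theorem tendsto_cv_scale (w η : 𝓢(E n, ℂ)) (hη : η 0 = 1) (z : E n) :
    Tendsto (fun R : ℝ => cv w (scale R⁻¹ η) z) atTop (𝓝 (∫ x, w x)) := by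
  have h := tendsto_integral_filter_of_dominated_convergence (μ := (volume : Measure (E n)))
    (F := fun (R : ℝ) (t : E n) => w t * scale R⁻¹ η (z - t)) (f := fun t => w t * 1)
    (l := atTop) (fun t => ‖w t‖ * SchwartzMap.seminorm ℂ 0 0 η) ?_ ?_
    (w.integrable.norm.mul_const _) ?_
  · simpa only [cv_apply, mul_one] using h
  · refine Eventually.of_forall fun R => Continuous.aestronglyMeasurable ?_
    have := w.continuous
    have := (scale R⁻¹ η).continuous
    fun_prop
  · filter_upwards [eventually_gt_atTop 0] with R hR
    refine Eventually.of_forall fun t => ?_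
    rw [norm_mul]
    gcongr
    exact (norm_le_seminorm_zero _ _).trans (seminorm_zero_scale_le (inv_ne_zero hR.ne') η)
  · refine Eventually.of_forall fun t => Tendsto.const_mul _ ?_
    have h1 : Tendsto (fun R : ℝ => η (R⁻¹ • (z - t))) atTop (𝓝 1) := by
      have h2 : Tendsto (fun R : ℝ => R⁻¹ • (z - t)) atTop (𝓝 0) := by
        simpa using (tendsto_inv_atTop_zero (𝕜 := ℝ)).smul_const (z - t)
      have h3 := (η.continuous.tendsto 0).comp h2
      rwa [hη] at h3
    refine h1.congr' ?_
    filter_upwards [eventually_gt_atTop 0] with R hR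
    rw [scale_apply (inv_ne_zero hR.ne')]

theorem integral_dyadic (k : ℤ) (w : 𝓢(E n, ℂ)) : ∫ x, dyadic k w x = ∫ x, w x := by
  rw [← integral_dyadic_change k (fun x : E n => w x)]
  congr 1 with x
  rw [dyadic_apply, Complex.real_smul]

/-! ### Moments of a represented operator as limits of truncations -/

section

variable {B : ℤ → E n → ℂ} {ν : ℝ} {u v : 𝓢(E n, ℂ)}

theorem IsSymbol.tendsto_levelPair_scale (h : IsSymbol B ν) (u v ψ η : 𝓢(E n, ℂ)) (hη : η 0 = 1)
    (k : ℤ) : Tendsto (fun R : ℝ => levelPair B u v (tensor ψ (scale R⁻¹ η)) k) atTop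
      (𝓝 ((∫ x, v x) * symbolPair B u ψ k)) := by
  obtain ⟨D, -, hD⟩ := h.bound
  have hg := h.integrable_mul k (cv (reflect (dyadic k u)) ψ)
  have key := tendsto_integral_filter_of_dominated_convergence (μ := (volume : Measure (E n)))
    (F := fun (R : ℝ) (z : E n) => B k z * cv (reflect (dyadic k u)) ψ z *
      cv (dyadic k v) (scale R⁻¹ η) z)
    (f := fun z => B k z * cv (reflect (dyadic k u)) ψ z * ∫ x, v x)
    (l := atTop) (fun z => ‖B k z * cv (reflect (dyadic k u)) ψ z‖ *
      (normL1 v * SchwartzMap.seminorm ℂ 0 0 η)) ?_ ?_ (hg.norm.mul_const _) ?_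
  · have e : (∫ z, B k z * cv (reflect (dyadic k u)) ψ z * ∫ x, v x) =
        (∫ x, v x) * symbolPair B u ψ k := by
      rw [integral_mul_const, mul_comm]; rfl
    rw [e] at key
    refine key.congr fun R => ?_
    rw [levelPair_tensor h]
    simp only [mul_assoc]
  · exact Eventually.of_forall fun R => hg.aestronglyMeasurable.mul
      (cv (dyadic k v) (scale R⁻¹ η)).continuous.aestronglyMeasurable
  · filter_upwards [eventually_gt_atTop 0] with R hR
    refine Eventually.of_forall fun z => ?_
    rw [norm_mul]
    refine mul_le_mul_of_nonneg_left ?_ (norm_nonneg _)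
    refine (norm_cv_apply_le _ _ z).trans ?_
    rw [normL1_dyadic]
    exact mul_le_mul_of_nonneg_left (seminorm_zero_scale_le (inv_ne_zero hR.ne') η)
      (normL1_nonneg v)
  · refine Eventually.of_forall fun z => Tendsto.const_mul _ ?_
    have := tendsto_cv_scale (dyadic k v) η hη z
    rwa [integral_dyadic] at this

/-- Dominated convergence over the scales. The truncated factor enters only through the sup norm of
`η`, which does not change with `R`; the summable majorant comes from the moments of `u` and `ψ`. -/
theorem exists_tendsto_tsum_levelPair (n : ℕ) (ν : ℝ) : ∃ P : ℕ, ∀ (B : ℤ → E n → ℂ)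
    (u v : 𝓢(E n, ℂ)), IsSymbol B ν → InSInf u → ∀ ψ η : 𝓢(E n, ℂ), InSP P ψ → η 0 = 1 →
      (∀ R : ℝ, 0 < R → Summable (levelPair B u v (tensor ψ (scale R⁻¹ η)))) ∧
      Tendsto (fun R : ℝ => ∑' k, levelPair B u v (tensor ψ (scale R⁻¹ η)) k) atTop
        (𝓝 ((∫ x, v x) * ∑' k, symbolPair B u ψ k)) := by
  obtain ⟨P, hP⟩ := exists_gauge_symbolPair n ν
  refine ⟨P, fun B u v h hu ψ η hψ hη => ?_⟩
  obtain ⟨q, hq, hqb⟩ := hP (reflect u) hu.reflect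
  obtain ⟨D, hD0, hD⟩ := h.bound
  have hw := summable_two_rpow_neg_abs one_pos
  set K := D * q ψ * (normL1 v * SchwartzMap.seminorm ℂ 0 0 η) with hK
  have hb : ∀ R : ℝ, 0 < R → ∀ k, ‖levelPair B u v (tensor ψ (scale R⁻¹ η)) k‖ ≤
      K * 2 ^ (-(1 * |(k : ℝ)|)) := by
    intro R hR k
    have h1 : ‖levelPair B u v (tensor ψ (scale R⁻¹ η)) k‖ ≤ D * 2 ^ (ν * (k : ℝ)) *
        (normL1 v * SchwartzMap.seminorm ℂ 0 0 η) * normL1 (cv (dyadic k (reflect u)) ψ) := by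
      rw [levelPair_tensor h, normL1.eq_1 (cv (dyadic k (reflect u)) ψ), ← integral_const_mul]
      refine norm_integral_le_of_norm_le ((cv _ ψ).integrable.norm.const_mul _)
        (Eventually.of_forall fun z => ?_)
      have h2 := norm_cv_apply_le (dyadic k v) (scale R⁻¹ η) z
      rw [normL1_dyadic] at h2
      have h3 := h2.trans (mul_le_mul_of_nonneg_left
        (seminorm_zero_scale_le (inv_ne_zero hR.ne') η) (normL1_nonneg v))
      rw [norm_mul, norm_mul, reflect_dyadic, mul_comm ‖cv _ _ _‖, ← mul_assoc]
      gcongr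
      exact hD k z
    refine h1.trans ?_
    have h0 : 0 ≤ normL1 v * SchwartzMap.seminorm ℂ 0 0 η :=
      mul_nonneg (normL1_nonneg v) (apply_nonneg _ _)
    calc _ = D * (normL1 v * SchwartzMap.seminorm ℂ 0 0 η) *
          (2 ^ (ν * (k : ℝ)) * normL1 (cv (dyadic k (reflect u)) ψ)) := by ring
      _ ≤ D * (normL1 v * SchwartzMap.seminorm ℂ 0 0 η) * (q ψ * 2 ^ (-(1 * |(k : ℝ)|))) :=
          mul_le_mul_of_nonneg_left (hqb ψ hψ k) (mul_nonneg hD0 h0)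
      _ = _ := by rw [hK]; ring
  refine ⟨fun R hR => Summable.of_norm_bounded (hw.mul_left K) (hb R hR), ?_⟩
  rw [← tsum_mul_left]
  refine tendsto_tsum_of_dominated_convergence (bound := fun k : ℤ => K * 2 ^ (-(1 * |(k : ℝ)|)))
    (hw.mul_left K) (fun k => h.tendsto_levelPair_scale u v ψ η hη k) ?_
  filter_upwards [eventually_gt_atTop 0] with R hR using hb R hR

/-- The symbol `2 ^ (-m k) B k`. -/
noncomputable def lower (m : ℕ) (B : ℤ → E n → ℂ) (k : ℤ) (z : E n) : ℂ :=
  ((((2 : ℝ) ^ k)⁻¹ ^ m : ℝ) : ℂ) * B k z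

theorem IsSymbol.lower (h : IsSymbol B ν) (m : ℕ) : IsSymbol (SingInt.lower m B) (ν - m) := by
  obtain ⟨D, hD0, hD⟩ := h.bound
  refine ⟨fun k => continuous_const.mul (h.continuous k), D, hD0, fun k z => ?_⟩
  have e : (2 : ℝ) ^ ((ν - m) * (k : ℝ)) = ((2 : ℝ) ^ k)⁻¹ ^ m * 2 ^ (ν * (k : ℝ)) := by
    rw [← two_rpow_intCast, ← Real.rpow_neg two_pos.le, ← Real.rpow_natCast, ← Real.rpow_mul
      two_pos.le, ← Real.rpow_add two_pos]
    congr 1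
    ring
  rw [SingInt.lower, norm_mul, Complex.norm_real, Real.norm_of_nonneg (by positivity), e]
  calc _ ≤ ((2 : ℝ) ^ k)⁻¹ ^ m * (D * 2 ^ (ν * (k : ℝ))) := by gcongr; exact hD k z
    _ = _ := by ring

theorem monoMul_dyadic (γ : Fin n → ℕ) (k : ℤ) (u : 𝓢(E n, ℂ)) : monoMul γ (dyadic k u) =
    ((((2 : ℝ) ^ k)⁻¹ ^ order γ : ℝ) : ℂ) • dyadic k (monoMul γ u) := by
  ext x
  rw [_root_.smul_apply, monoMul_apply, dyadic_apply, dyadic_apply, monoMul_apply, mono_smul,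
    smul_eq_mul]
  have h2 : (((2 : ℝ) ^ k : ℝ) : ℂ) ≠ 0 := by
    exact_mod_cast zpow_ne_zero k (two_ne_zero' ℝ)
  rw [Complex.ofReal_pow, Complex.ofReal_inv, inv_pow]
  field_simp

/-- Binomial expansion of `(x - y)^β` through `x - y = (x - z) + (z - y)`: each monomial is absorbed
by one of the outer functions. -/
theorem mono_mul_sandwich {B : E n → ℂ} {D : ℝ} (hB : Continuous B) (hD : ∀ z, ‖B z‖ ≤ D)
    (u v : 𝓢(E n, ℂ)) (β : Fin n → ℕ) (p : E n × E n) :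
    mono β (p.1 - p.2) * sandwich B u v p =
      ∑ γ ∈ below β, multiChoose β γ * sandwich B (monoMul γ u) (monoMul (β - γ) v) p := by
  simp only [sandwich]
  simp only [← integral_const_mul]
  rw [← integral_finsetSum]
  · congr 1 with z
    have : p.1 - p.2 = (p.1 - z) + (z - p.2) := by abel
    rw [this, mono_add, Finset.sum_mul]
    refine Finset.sum_congr rfl fun γ _ => ?_
    rw [monoMul_apply, monoMul_apply]
    ring
  · intro γ _
    exact (integrable_sandwich hB hD _ _ p).const_mul _

/-- Each power of `x - y` is worth `2^(-k)` at scale `k`, so multiplying the kernel by `(x - y)^β`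
lowers the order of the symbol by `|β|`. -/
theorem IsSymbol.levelPair_cutMoment (h : IsSymbol B ν) (u v η ψ : 𝓢(E n, ℂ)) (β : Fin n → ℕ)
    (R : ℝ) (k : ℤ) : levelPair B u v (cutMoment β η ψ R) k =
      ∑ γ ∈ below β, multiChoose β γ * levelPair (SingInt.lower (order β) B) (monoMul γ u)
        (monoMul (β - γ) v) (tensor ψ (scale R⁻¹ η)) k := by
  obtain ⟨D, -, hD⟩ := h.bound
  have e : ∀ p, sandwich (B k) (dyadic k u) (dyadic k v) p * cutMoment β η ψ R p =
      ∑ γ ∈ below β, multiChoose β γ * (sandwich (SingInt.lower (order β) B k)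
        (dyadic k (monoMul γ u)) (dyadic k (monoMul (β - γ) v)) p *
          tensor ψ (scale R⁻¹ η) p) := by
    intro p
    have e1 : cutMoment β η ψ R p = mono β (p.1 - p.2) * tensor ψ (scale R⁻¹ η) p := by
      simp [cutMoment, smulLeftCLM_apply_apply (mono_sub_hasTemperateGrowth β)]
    rw [e1, ← mul_assoc, mul_comm (sandwich _ _ _ p), mono_mul_sandwich (h.continuous k) (hD k),
      Finset.sum_mul]
    refine Finset.sum_congr rfl fun γ hγ => ?_
    have e2 : sandwich (SingInt.lower (order β) B k) (dyadic k (monoMul γ u))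
        (dyadic k (monoMul (β - γ) v)) p = ((((2 : ℝ) ^ k)⁻¹ ^ order β : ℝ) : ℂ) *
        sandwich (B k) (dyadic k (monoMul γ u)) (dyadic k (monoMul (β - γ) v)) p :=
      sandwich_const_mul _ _ _ _ p
    rw [monoMul_dyadic, monoMul_dyadic, sandwich_smul_left, sandwich_smul_right, e2,
      ← order_sub (mem_below.1 hγ), pow_add, Complex.ofReal_mul]
    ring
  rw [levelPair, layer]
  simp only [e]
  rw [integral_finsetSum]
  · simp only [integral_const_mul]
    rfl
  · intro γ _
    obtain ⟨D', -, hD'⟩ := (h.lower (order β)).bound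
    exact (integrable_sandwich_mul ((h.lower (order β)).continuous k) (hD' k) _ _ _).const_mul _

/-- The value at `ψ` of the moment of order `β` of the operator given by `B`, `u` and `v`. -/
noncomputable def momentLimit (B : ℤ → E n → ℂ) (u v : 𝓢(E n, ℂ)) (β : Fin n → ℕ)
    (ψ : 𝓢(E n, ℂ)) : ℂ :=
  ∑ γ ∈ below β, multiChoose β γ * (moment (β - γ) v *
    ∑' k, symbolPair (lower (order β) B) (monoMul γ u) ψ k)

/-- The moments of a represented operator exist. -/
theorem exists_tendsto_moment (n : ℕ) (ν : ℝ) (β : Fin n → ℕ) : ∃ P : ℕ,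
    ∀ (B : ℤ → E n → ℂ) (u v : 𝓢(E n, ℂ)) (T : Operator n), IsSymbol B ν → InSInf u →
      Represents T B u v → ∀ ψ η : 𝓢(E n, ℂ), InSP P ψ → η 0 = 1 →
      Tendsto (fun R : ℝ => T.ker (cutMoment β η ψ R)) atTop
        (𝓝 (momentLimit B u v β ψ)) := by
  obtain ⟨P, hP⟩ := exists_tendsto_tsum_levelPair n (ν - order β)
  refine ⟨P, fun B u v T h hu hT ψ η hψ hη => ?_⟩
  have key : ∀ γ ∈ below β, _ := fun γ _ =>
    hP (SingInt.lower (order β) B) (monoMul γ u) (monoMul (β - γ) v) (h.lower _) (hu.monoMul γ)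
      ψ η hψ hη
  have hm : ∀ γ, moment (β - γ) v = ∫ x, monoMul (β - γ) v x := fun γ => by
    simp only [moment, monoMul_apply]
  simp only [momentLimit, hm]
  refine (tendsto_finsetSum _ fun γ hγ => (key γ hγ).2.const_mul _).congr' ?_
  filter_upwards [eventually_gt_atTop 0] with R hR
  have h1 : HasSum (levelPair B u v (cutMoment β η ψ R)) (∑ γ ∈ below β, multiChoose β γ *
      ∑' k, levelPair (SingInt.lower (order β) B) (monoMul γ u) (monoMul (β - γ) v)
        (tensor ψ (scale R⁻¹ η)) k) := by
    simp only [funext (h.levelPair_cutMoment u v η ψ β R)]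
    exact hasSum_sum fun γ hγ => ((key γ hγ).1 R hR).hasSum.mul_left _
  exact h1.unique (hT.hasSum _)

end

/-- The non-convolution moments of an operator given by a symbol are tempered distributions. -/
theorem exists_moment_distribution (n : ℕ) (ν : ℝ) (β : Fin n → ℕ) : ∃ P : ℕ,
    ∀ (B : ℤ → E n → ℂ) (u v : 𝓢(E n, ℂ)), IsSymbol B ν → InSInf u → ∃ A : 𝓢'(E n, ℂ),
      (∀ ψ, InSP P ψ → A ψ = momentLimit B u v β ψ) ∧
      ∀ θ, InSP P θ → BesovBound θ (order β - ν) A := by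
  obtain ⟨P, hP⟩ := exists_distribution_besovBound n (ν - order β)
  refine ⟨P, fun B u v h hu => ?_⟩
  choose A hA hA' using fun γ : Fin n → ℕ =>
    hP _ _ (h.lower (order β)) (hu.monoMul γ)
  rw [neg_sub] at hA'
  refine ⟨∑ γ ∈ below β, ((multiChoose β γ : ℂ) * moment (β - γ) v) • A γ, fun ψ hψ => ?_,
    fun θ hθ => BesovBound.sum fun γ _ => (hA' γ θ hθ).smul _⟩
  have e : (∑ γ ∈ below β, ((multiChoose β γ : ℂ) * moment (β - γ) v) • A γ) ψ =
      ∑ γ ∈ below β, ((multiChoose β γ : ℂ) * moment (β - γ) v) * A γ ψ := by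
    simp
  rw [e, momentLimit]
  refine Finset.sum_congr rfl fun γ _ => ?_
  rw [(hA γ ψ hψ).tsum_eq, mul_assoc]

/-! ### Linear combinations of operators -/

namespace Operator

variable {T T₁ T₂ : Operator n} {ν : ℝ}

theorem WBP.add_mul (c : ℂ) (hker : ∀ F, T.ker F = T₁.ker F + c * T₂.ker F)
    (hkerT : ∀ F, T.kerT F = T₁.kerT F + c * T₂.kerT F) (hT₁ : T₁.WBP ν) (hT₂ : T₂.WBP ν) :
    T.WBP ν := by
  obtain ⟨M₁, N₁, C₁, -, h₁⟩ := hT₁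
  obtain ⟨M₂, N₂, C₂, -, h₂⟩ := hT₂
  refine ⟨max T.P (max M₁ M₂), max N₁ N₂, C₁ + ‖c‖ * C₂, le_max_left _ _,
    fun x r hr ψ φ hψ hφ hψs hφs hb => ?_⟩
  have e₁ := h₁ x r hr ψ φ (hψ.mono ((le_max_left _ _).trans (le_max_right _ _))) hφ hψs hφs
    fun β hβ => hb β (hβ.trans (le_max_left _ _))
  have e₂ := h₂ x r hr ψ φ (hψ.mono ((le_max_right _ _).trans (le_max_right _ _))) hφ hψs hφs
    fun β hβ => hb β (hβ.trans (le_max_right _ _))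
  have e₃ := mul_le_mul_of_nonneg_left e₂ (norm_nonneg c)
  have t₁ := norm_add_le (T₁.pair ψ φ) (c * T₂.pair ψ φ)
  have t₂ := norm_add_le (T₁.trans.pair ψ φ) (c * T₂.trans.pair ψ φ)
  have r₁ : T.pair ψ φ = T₁.pair ψ φ + c * T₂.pair ψ φ := hker _
  have r₂ : T.trans.pair ψ φ = T₁.trans.pair ψ φ + c * T₂.trans.pair ψ φ := hkerT _
  rw [norm_mul] at t₁ t₂
  rw [r₁, r₂, _root_.add_mul]
  linarith

theorem WBP.zero (P : ℕ) (ν : ℝ) : (⟨P, 0, 0, fun _ _ _ _ => rfl⟩ : Operator n).WBP ν :=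
  ⟨P, 0, 0, le_rfl, fun _ _ _ _ _ _ _ _ _ _ => by simp [pair, trans]⟩

theorem Annihilates.add_mul {α : Fin n → ℕ} (c : ℂ)
    (hker : ∀ F, T.ker F = T₁.ker F + c * T₂.ker F) (hT₁ : T₁.Annihilates α)
    (hT₂ : T₂.Annihilates α) : T.Annihilates α := by
  obtain ⟨P₁, -, hα, h₁⟩ := hT₁
  obtain ⟨P₂, -, -, h₂⟩ := hT₂
  have a₁ : P₁ ≤ max T.P (max P₁ P₂) := (le_max_left _ _).trans (le_max_right _ _)
  have a₂ : P₂ ≤ max T.P (max P₁ P₂) := (le_max_right _ _).trans (le_max_right _ _)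
  refine ⟨max T.P (max P₁ P₂), le_max_left _ _, hα.trans a₁, fun η hη hη1 ψ hψ => ?_⟩
  have e₁ := h₁ η (hη.mono (by omega)) hη1 ψ (hψ.mono a₁)
  have e₂ := h₂ η (hη.mono (by omega)) hη1 ψ (hψ.mono a₂)
  have e := e₁.add (e₂.const_mul c)
  rw [mul_zero, add_zero] at e
  exact e.congr fun R => (hker _).symm

theorem Annihilates.zero (P : ℕ) (α : Fin n → ℕ) :
    (⟨P, 0, 0, fun _ _ _ _ => rfl⟩ : Operator n).Annihilates α :=
  ⟨max P (order α), le_max_left _ _, le_max_right _ _, fun _ _ _ _ _ => by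
    simp [pair]⟩

/-- The sum of finitely many operators. -/
noncomputable def sum {ι : Type*} (t : Finset ι) (B : ι → Operator n) (P : ℕ)
    (hP : ∀ i, (B i).P ≤ P) : Operator n where
  P := P
  ker := ∑ i ∈ t, (B i).ker
  kerT := ∑ i ∈ t, (B i).kerT
  transpose_eq f g hf hg := by
    simp only [_root_.sum_apply]
    exact Finset.sum_congr rfl fun i _ =>
      (B i).transpose_eq f g (hf.mono (hP i)) (hg.mono (hP i))

section

variable {ι : Type*} {t : Finset ι} {B : ι → Operator n} {P : ℕ} {hP : ∀ i, (B i).P ≤ P}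

theorem sum_ker (F : 𝓢(E n × E n, ℂ)) : (sum t B P hP).ker F = ∑ i ∈ t, (B i).ker F := by
  simp [sum]

theorem sum_kerT (F : 𝓢(E n × E n, ℂ)) : (sum t B P hP).kerT F = ∑ i ∈ t, (B i).kerT F := by
  simp [sum]

/-- The hypothesis on sums carries an explicit coefficient `1`, so that the `add_mul` lemmas, used
elsewhere with `-1`, apply as they stand. -/
theorem sum_induction (p : Operator n → Prop)
    (hz : p ⟨P, 0, 0, fun _ _ _ _ => rfl⟩)
    (hadd : ∀ T T₁ T₂ : Operator n, T₁.P ≤ T.P → T₂.P ≤ T.P →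
      (∀ F, T.ker F = T₁.ker F + 1 * T₂.ker F) → (∀ F, T.kerT F = T₁.kerT F + 1 * T₂.kerT F) →
      p T₁ → p T₂ → p T) (h : ∀ i ∈ t, p (B i)) : p (sum t B P hP) := by
  classical
  induction t using Finset.induction_on with
  | empty =>
    have : sum ∅ B P hP = ⟨P, 0, 0, fun _ _ _ _ => rfl⟩ := by
      simp [sum]
    rw [this]
    exact hz
  | insert i t hi ih =>
    refine hadd _ (sum t B P hP) (B i) le_rfl (hP i) (fun F => ?_) (fun F => ?_)
      (ih fun j hj => h j (Finset.mem_insert_of_mem hj)) (h i (Finset.mem_insert_self i t))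
    · rw [sum_ker, sum_ker, Finset.sum_insert hi, one_mul, add_comm]
    · rw [sum_kerT, sum_kerT, Finset.sum_insert hi, one_mul, add_comm]

theorem sum_isSingularInf {ν : ℝ} (h : ∀ i ∈ t, (B i).IsSingularInf ν) :
    (sum t B P hP).IsSingularInf ν := fun M γ h0 h1 =>
  sum_induction (fun T => T.IsSingular ν M γ) (IsSingular.zero P ν γ M)
    (fun _ _ _ a₁ a₂ k k' => IsSingular.add_mul 1 a₁ a₂ k k') fun i hi => h i hi M γ h0 h1

theorem sum_wbp {ν : ℝ} (h : ∀ i ∈ t, (B i).WBP ν) : (sum t B P hP).WBP ν :=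
  sum_induction (fun T => T.WBP ν) (WBP.zero P ν) (fun _ _ _ _ _ k k' => WBP.add_mul 1 k k') h

theorem sum_trans_annihilates {α : Fin n → ℕ} (h : ∀ i ∈ t, (B i).trans.Annihilates α) :
    (sum t B P hP).trans.Annihilates α :=
  sum_induction (fun T => T.trans.Annihilates α) (Annihilates.zero P α)
    (fun _ _ _ _ _ _ k' => Annihilates.add_mul 1 k') h

end

end Operator

/-! ### Paraproducts -/

/-- The coefficient `(-1) ^ |α| / α!`. -/
noncomputable def taylorCoeff (α : Fin n → ℕ) : ℂ :=
  (-1 : ℂ) ^ order α / ((∏ i, (α i).factorial : ℕ) : ℂ)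

theorem taylorCoeff_mul (α : Fin n → ℕ) :
    taylorCoeff α * ((-1) ^ order α * ((∏ i, (α i).factorial : ℕ) : ℂ)) = 1 := by
  have h0 : ((∏ i, (α i).factorial : ℕ) : ℂ) ≠ 0 := by
    exact_mod_cast Finset.prod_ne_zero_iff.2 fun i _ => (α i).factorial_ne_zero
  rw [taylorCoeff]
  field_simp
  rw [← pow_mul, mul_comm, pow_mul]
  norm_num

/-- The symbol of the paraproduct `Π_b^α`. -/
noncomputable def paraSymbol (ψ : 𝓢(E n, ℂ)) (b : 𝓢'(E n, ℂ)) (α : Fin n → ℕ) (k : ℤ) (z : E n) :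
    ℂ :=
  taylorCoeff α * (((((2 : ℝ) ^ k) ^ order α : ℝ) : ℂ) * distConv ψ k b z)

/-- The cost `2^(k|α|)` of the derivatives is offset by the regularity `|α| - ν` of `b`, which
leaves order `ν` for every `α`. -/
theorem BesovBound.isSymbol_paraSymbol {ψ : 𝓢(E n, ℂ)} {b : 𝓢'(E n, ℂ)} {α : Fin n → ℕ} {ν : ℝ}
    (h : BesovBound ψ (order α - ν) b) : IsSymbol (paraSymbol ψ b α) ν := by
  obtain ⟨hc, D, hD0, hD⟩ := h.isSymbol
  refine ⟨fun k => continuous_const.mul (continuous_const.mul (hc k)), ‖taylorCoeff α‖ * D,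
    by positivity, fun k z => ?_⟩
  have e : (((2 : ℝ) ^ k) ^ order α) = 2 ^ ((order α : ℝ) * k) := by
    rw [← zpow_natCast, ← zpow_mul, ← two_rpow_intCast]
    push_cast
    rw [mul_comm]
  rw [paraSymbol, norm_mul, norm_mul, Complex.norm_real, Real.norm_of_nonneg (by positivity), e]
  calc _ ≤ ‖taylorCoeff α‖ * (2 ^ ((order α : ℝ) * k) * (D * 2 ^ (-(order α - ν) * (k : ℝ)))) := by
        gcongr
        exact hD k z
    _ = ‖taylorCoeff α‖ * D * (2 ^ ((order α : ℝ) * k) * 2 ^ (-(order α - ν) * (k : ℝ))) := by ring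
    _ = _ := by
      rw [← Real.rpow_add two_pos]
      congr 2
      ring

/-- The cost of `D^α` cancels the gain from `(x - y)^α`, leaving the bare functions `ψ_k * b` of the
reproducing formula. -/
theorem lower_paraSymbol (ψ : 𝓢(E n, ℂ)) (b : 𝓢'(E n, ℂ)) (α : Fin n → ℕ) :
    lower (order α) (paraSymbol ψ b α) = fun k z => taylorCoeff α * distConv ψ k b z := by
  funext k z
  have h : (((((2 : ℝ) ^ k)⁻¹ ^ order α : ℝ)) : ℂ) * ((((2 : ℝ) ^ k) ^ order α : ℝ) : ℂ) = 1 := by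
    rw [← Complex.ofReal_mul, ← mul_pow, inv_mul_cancel₀ (by positivity), one_pow,
      Complex.ofReal_one]
  rw [lower, paraSymbol, mul_left_comm, ← mul_assoc (((_ : ℝ)) : ℂ), h, one_mul]

theorem integral_conv_mul {B : E n → ℂ} (hB : Continuous B) {D : ℝ} (hD : ∀ z, ‖B z‖ ≤ D)
    (u w g : 𝓢(E n, ℂ)) : ∫ x, conv u (fun z => B z * w z) x * g x =
      ∫ z, B z * (cv (reflect u) g z * w z) := by
  have hw : Integrable fun z => B z * w z :=
    w.integrable.bdd_mul hB.aestronglyMeasurable (Eventually.of_forall hD)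
  have hi : Integrable (fun p : E n × E n => u (p.1 - p.2) * (g p.1 * (B p.2 * w p.2)))
      (volume.prod volume) :=
    (g.integrable.mul_prod hw).bdd_mul (by have := u.continuous; fun_prop)
      (Eventually.of_forall fun p => norm_le_seminorm_zero u _)
  calc _ = ∫ x, ∫ z, u (x - z) * (g x * (B z * w z)) := by
        congr 1 with x
        rw [conv, ← integral_mul_const]
        congr 1 with z
        ring
    _ = ∫ z, ∫ x, u (x - z) * (g x * (B z * w z)) := integral_integral_swap hi
    _ = _ := by
      congr 1 with z
      rw [cv_apply', ← integral_mul_const, ← integral_const_mul]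
      congr 1 with x
      rw [reflect_apply, neg_sub]
      ring

/-- Identifies the series defining a paraproduct, term by term, with the sandwich series, so that
the results on represented operators apply. -/
theorem paraTerm_eq_levelPair {ψ : 𝓢(E n, ℂ)} {b : 𝓢'(E n, ℂ)} {α : Fin n → ℕ} {ν : ℝ}
    (h : BesovBound ψ (order α - ν) b) (ψ' φ f g : 𝓢(E n, ℂ)) :
    paraTerm ψ ψ' φ α b f g = levelPair (paraSymbol ψ b α) ψ' (derivS α φ) (tensor g f) := by
  funext k
  obtain ⟨hc, D, -, hD⟩ := h.isSymbol
  have e : ∀ x, conv (dyadic k φ) (derivS α f) x = cv (dyadic k φ) (derivS α f) x := fun x =>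
    (cv_apply' _ _ x).symm
  rw [levelPair_tensor h.isSymbol_paraSymbol, paraTerm, multiD_coe]
  simp only [e]
  rw [integral_conv_mul (hc k) (hD k) (dyadic k ψ') (cv (dyadic k φ) (derivS α f)) g,
    cv_dyadic_derivS, ← integral_const_mul]
  congr 1 with z
  rw [paraSymbol, taylorCoeff, _root_.smul_apply, smul_eq_mul]
  ring

/-- Only the moment of index `α` of `D^α φ` is nonzero, and `β - γ = α` with `|β| ≤ |α|` forces `γ =
0` and `β = α`. This is the triangularity of the system of moments. -/
theorem moment_derivS_eq_zero {φ : 𝓢(E n, ℂ)}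
    (hφ : ∀ γ : Fin n → ℕ, moment γ φ = if γ = 0 then 1 else 0) {α β γ : Fin n → ℕ}
    (hγ : γ ∈ below β) (hαβ : order β ≤ order α) (h : ¬ (α = β ∧ γ = 0)) :
    moment (β - γ) (derivS α φ) = 0 := by
  rw [moment_derivS_of_dual (M := order (β - γ)) (fun γ _ => hφ γ) (β - γ) α le_rfl, if_neg]
  intro e
  have h1 := order_sub (mem_below.1 hγ)
  rw [e] at h1
  have h2 : γ = 0 := order_eq_zero.1 (by omega)
  exact h ⟨by rw [← e, h2, tsub_zero], h2⟩

theorem momentLimit_paraSymbol_of_ne {φ : 𝓢(E n, ℂ)}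
    (hφ : ∀ γ : Fin n → ℕ, moment γ φ = if γ = 0 then 1 else 0) (B : ℤ → E n → ℂ)
    (u ψ : 𝓢(E n, ℂ)) {α β : Fin n → ℕ} (hαβ : order β ≤ order α) (hne : α ≠ β) :
    momentLimit B u (derivS α φ) β ψ = 0 :=
  Finset.sum_eq_zero fun γ hγ => by
    rw [moment_derivS_eq_zero hφ hγ hαβ fun h => hne h.1, zero_mul, mul_zero]

/-- Only the term `γ = 0` survives. The moment `(-1)^|β| β!` of `D^β φ` cancels the coefficient of
the paraproduct, and the remaining series is the reproducing formula for `b`. -/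
theorem momentLimit_paraSymbol_self {φ : 𝓢(E n, ℂ)}
    (hφ : ∀ γ : Fin n → ℕ, moment γ φ = if γ = 0 then 1 else 0) {ψ ψ' θ : 𝓢(E n, ℂ)}
    {b : 𝓢'(E n, ℂ)} (β : Fin n → ℕ)
    (hb : HasSum (symbolPair (fun k => distConv ψ k b) ψ' θ) (b θ)) :
    momentLimit (paraSymbol ψ b β) ψ' (derivS β φ) β θ = b θ := by
  have h0 : (0 : Fin n → ℕ) ∈ below β := mem_below.2 zero_le
  rw [momentLimit, Finset.sum_eq_single_of_mem 0 h0 fun γ hγ h => by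
    rw [moment_derivS_eq_zero hφ hγ le_rfl fun h' => h h'.2, zero_mul, mul_zero]]
  have e1 : ∀ k, symbolPair (fun k z => taylorCoeff β * distConv ψ k b z) ψ' θ k =
      taylorCoeff β * symbolPair (fun k => distConv ψ k b) ψ' θ k := fun k => by
    simp only [symbolPair, mul_assoc]
    exact integral_const_mul _ _
  have e2 : monoMul 0 ψ' = ψ' := by
    ext x
    simp [monoMul_apply, mono]
  have e3 : multiChoose β 0 = 1 := by simp [multiChoose]
  rw [lower_paraSymbol, e2, e3, tsub_zero,
    moment_derivS_of_dual (M := order β) (fun γ _ => hφ γ) β β le_rfl, if_pos rfl]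
  simp only [e1]
  rw [tsum_mul_left, hb.tsum_eq, Nat.cast_one, one_mul]
  linear_combination b θ * taylorCoeff_mul β

/-! ### Solving for the prescribed moments -/

/-- A triangular system `b_β = t_β - ∑_α A_{α,β}(b_α)`, where the sum runs over indices `α` of smaller
order, is solvable. -/
theorem exists_triangular_solution {X ι : Type*} [AddCommGroup X] (d : ι → ℕ) (s : Finset ι)
    (t : ι → X) (A : ι → ι → X → X) :
    ∃ b : ι → X, ∀ β, b β = t β - ∑ α ∈ s, if d α < d β then A α β (b α) else 0 := by
  let F : (β : ι) → ((α : ι) → d α < d β → X) → X := fun β r =>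
    t β - ∑ α ∈ s, if h : d α < d β then A α β (r α h) else 0
  refine ⟨(measure d).wf.fix F, fun β => ?_⟩
  conv_lhs => rw [WellFounded.fix_eq]
  simp only [F, dite_eq_ite]

theorem BesovBound.sub {θ : 𝓢(E n, ℂ)} {s : ℝ} {b b' : 𝓢'(E n, ℂ)} (h : BesovBound θ s b)
    (h' : BesovBound θ s b') : BesovBound θ s (b - b') := by
  have e : b - b' = b + (-1 : ℂ) • b' := by
    ext f
    rw [_root_.sub_apply, _root_.add_apply, _root_.smul_apply, neg_one_smul, sub_eq_add_neg]
  rw [e]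
  exact h.add (h'.smul _)

/-- The unknowns solve `b_β = t_β - ∑ [[Π_{b_α}^α]]_β` over `|α| < |β|`. The Besov bounds propagate
through the recursion for `χ` and for `ψ` at once; the bound for `ψ` makes the paraproducts of `b_β`
meaningful, the one for `χ` is the Besov condition itself. -/
theorem exists_paraproduct_data {χ : 𝓢(E n, ℂ)} (hχ : IsLittlewoodPaley χ) (ν : ℝ) (M : ℕ)
    (t : (Fin n → ℕ) → 𝓢'(E n, ℂ))
    (ht : ∀ α, order α ≤ M → BesovBound χ (order α - ν) (t α)) :
    ∃ (L : ℕ) (ψ ψ' φ : 𝓢(E n, ℂ)) (b : (Fin n → ℕ) → 𝓢'(E n, ℂ)), InDP L ψ ∧ Resolves ψ ψ' ∧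
      (∀ γ, moment γ φ = if γ = 0 then 1 else 0) ∧
      (∀ α, order α ≤ M → BesovBound χ (order α - ν) (b α) ∧ BesovBound ψ (order α - ν) (b α)) ∧
      ∃ P : ℕ, ∀ β, order β ≤ M → ∀ θ, InSP P θ →
        ∑ α ∈ multiIndices n M, momentLimit (paraSymbol ψ (b α) α) ψ' (derivS α φ) β θ =
          t β θ := by
  obtain ⟨φ, hφ⟩ := exists_dual_function n
  obtain ⟨χ', hχ'⟩ := hχ.exists_resolves
  choose P₁ hP₁ using exists_moment_distribution n ν
  choose P₀ hP₀ using fun α : Fin n → ℕ => exists_besovBound_of_symbol n (-(order α - ν))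
  choose Pt hPt using fun α => hχ'.exists_hasSum_symbolPair (t α)
  -- The three thresholds depend only on the dimension, on `ν`, on the multi-indices and on the data
  -- `t` and `χ`, and not on `ψ`, `ψ'` or `b`; so `ψ` can be chosen afterwards with enough vanishing
  -- moments.
  let L := (multiIndices n M).sup fun α => max (P₁ α) (max (P₀ α) (Pt α))
  have hL : ∀ α, order α ≤ M → P₁ α ≤ L ∧ P₀ α ≤ L ∧ Pt α ≤ L := fun α hα => by
    have h := Finset.le_sup (f := fun α => max (P₁ α) (max (P₀ α) (Pt α))) (mem_multiIndices.2 hα)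
    simpa only [max_le_iff] using h
  obtain ⟨ψ, hψ, hψ0⟩ := exists_analysing_function (n := n) L
  obtain ⟨ψ', hψ'⟩ := exists_resolves ψ hψ0
  -- The reproducing formula for `χ` presents `t α` as the functional of the symbol `χ_k * t α`; a
  -- functional of a symbol satisfies the Besov bound for any function with enough moments.
  have ht' : ∀ α, order α ≤ M → BesovBound ψ (order α - ν) (t α) := fun α hα => by
    have := hP₀ α _ χ' (t α) (Pt α) (ht α hα).isSymbol hχ'.inSInf (hPt α) ψ
      (hψ.2.mono (hL α hα).2.1) (hψ.2.mono (hL α hα).2.2)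
    rwa [neg_neg] at this
  -- `A α β b` represents the moment of index `β` of `Π_b^α`. It is set to `0` when `b` violates the
  -- Besov bound, which makes it a total function to which the recursion applies.
  have hA : ∀ (α β : Fin n → ℕ) (b : 𝓢'(E n, ℂ)), ∃ A : 𝓢'(E n, ℂ),
      BesovBound ψ (order α - ν) b →
        (∀ θ, InSP (P₁ β) θ → A θ = momentLimit (paraSymbol ψ b α) ψ' (derivS α φ) β θ) ∧
        ∀ θ, InSP (P₁ β) θ → BesovBound θ (order β - ν) A := fun α β b => by
    by_cases hb : BesovBound ψ (order α - ν) b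
    · obtain ⟨A, h⟩ := hP₁ β _ ψ' (derivS α φ) hb.isSymbol_paraSymbol hψ'.inSInf
      exact ⟨A, fun _ => h⟩
    · exact ⟨0, fun h => absurd h hb⟩
  choose A hA using hA
  obtain ⟨b, hb⟩ := exists_triangular_solution order (multiIndices n M) t A
  have hbB : ∀ m α, order α = m → order α ≤ M →
      BesovBound χ (order α - ν) (b α) ∧ BesovBound ψ (order α - ν) (b α) := by
    intro m
    induction m using Nat.strong_induction_on with
    | _ m ih =>
      intro β hm hβ
      have key : ∀ θ, BesovBound θ (order β - ν) (t β) → InSP (P₁ β) θ →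
          BesovBound θ (order β - ν) (b β) := by
        intro θ h1 h2
        rw [hb β]
        refine h1.sub (BesovBound.sum fun α hα => ?_)
        split_ifs with h
        · exact (hA α β (b α) (ih _ (hm ▸ h) α rfl (mem_multiIndices.1 hα)).2).2 θ h2
        · exact BesovBound.zero _ _
      exact ⟨key χ (ht β hβ) (hχ.1 _), key ψ (ht' β hβ) (hψ.2.mono (hL β hβ).1)⟩
  -- These thresholds do depend on `ψ` and `b`, which does no harm: the final `P` is chosen last.
  choose Pb hPb using fun α => hψ'.exists_hasSum_symbolPair (b α)
  refine ⟨L, ψ, ψ', φ, b, hψ, hψ', hφ, fun α => hbB _ α rfl,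
    max L ((multiIndices n M).sup Pb), fun β hβ θ hθ => ?_⟩
  have hmem := mem_multiIndices.2 hβ
  have hterm : ∀ α ∈ multiIndices n M,
      momentLimit (paraSymbol ψ (b α) α) ψ' (derivS α φ) β θ =
        (if order α < order β then A α β (b α) else 0) θ + if α = β then b β θ else 0 := by
    intro α hα
    split_ifs with h1 h2 h2
    · exact absurd (h2 ▸ h1) (lt_irrefl _)
    · rw [(hA α β (b α) (hbB _ α rfl (mem_multiIndices.1 hα)).2).1 θ
        (hθ.mono ((hL β hβ).1.trans (le_max_left _ _))), add_zero]
    · subst h2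
      have e : (0 : 𝓢'(E n, ℂ)) θ = 0 := rfl
      rw [e, zero_add]
      exact momentLimit_paraSymbol_self hφ α
        (hPb α θ (hθ.mono ((Finset.le_sup hα).trans (le_max_right _ _))))
    · rw [momentLimit_paraSymbol_of_ne hφ _ _ _ (not_lt.1 h1) h2, add_zero]
      rfl
  rw [Finset.sum_congr rfl hterm, Finset.sum_add_distrib, Finset.sum_ite_eq' _ β, if_pos hmem]
  have e : b β θ = t β θ -
      ∑ α ∈ multiIndices n M, (if order α < order β then A α β (b α) else 0) θ := by
    conv_lhs => rw [hb β]
    rw [_root_.sub_apply, _root_.sum_apply]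
  rw [e]
  ring

/-! ### Moments and monomials -/

namespace Operator

theorem HasMoment.add_mul {T T₁ T₂ : Operator n} {β : Fin n → ℕ} {P₁ P₂ : ℕ}
    {u₁ u₂ : 𝓢'(E n, ℂ)} (c : ℂ) (hker : ∀ F, T.ker F = T₁.ker F + c * T₂.ker F)
    (h₁ : T₁.HasMoment β P₁ u₁) (h₂ : T₂.HasMoment β P₂ u₂) :
    T.HasMoment β (max T.P (max P₁ P₂)) (u₁ + c • u₂) := by
  obtain ⟨-, hβ, h₁⟩ := h₁
  obtain ⟨-, -, h₂⟩ := h₂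
  have a₁ : P₁ ≤ max T.P (max P₁ P₂) := (le_max_left _ _).trans (le_max_right _ _)
  have a₂ : P₂ ≤ max T.P (max P₁ P₂) := (le_max_right _ _).trans (le_max_right _ _)
  refine ⟨le_max_left _ _, hβ.trans a₁, fun η hη hη1 ψ hψ => ?_⟩
  have e₁ := h₁ η (hη.mono (by omega)) hη1 ψ (hψ.mono a₁)
  have e₂ := h₂ η (hη.mono (by omega)) hη1 ψ (hψ.mono a₂)
  exact (e₁.add (e₂.const_mul c)).congr fun R => (hker _).symm

/-- Binomial expansion of `y = x - (x - y)`, which expresses the action on a truncated monomial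
through non-convolution moments tested on `x^γ ψ`. -/
theorem tensor_cutMono (α : Fin n → ℕ) (η ψ : 𝓢(E n, ℂ)) {R : ℝ} (hR : R ≠ 0) :
    tensor ψ (cutMono α η R) = ∑ γ ∈ below α,
      ((multiChoose α γ : ℂ) * (-1) ^ order (α - γ)) • cutMoment (α - γ) η (monoMul γ ψ) R := by
  ext p
  obtain ⟨x, y⟩ := p
  have e : y = x + (-1 : ℝ) • (x - y) := by simp
  have e1 := mono_add α x ((-1 : ℝ) • (x - y))
  rw [← e] at e1
  rw [tensor_apply, cutMono_apply _ _ hR, e1, _root_.sum_apply, Finset.sum_mul, Finset.mul_sum]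
  refine Finset.sum_congr rfl fun γ _ => ?_
  rw [_root_.smul_apply, cutMoment_apply _ _ _ hR, monoMul_apply, mono_smul, smul_eq_mul]
  push_cast
  ring

/-- An operator whose non-convolution moments up to `α` vanish annihilates `x ^ α`. -/
theorem Annihilates.of_hasMoment_zero {T : Operator n} {α : Fin n → ℕ}
    (h : ∀ β ≤ α, ∃ P, T.HasMoment β P 0) : T.Annihilates α := by
  have h' : ∀ β, ∃ P, β ≤ α → T.HasMoment β P 0 := fun β => by
    by_cases hβ : β ≤ α
    · obtain ⟨P, hP⟩ := h β hβ
      exact ⟨P, fun _ => hP⟩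
    · exact ⟨0, fun h => absurd h hβ⟩
  choose P hP using h'
  have hle : ∀ γ ∈ below α, P (α - γ) ≤ (below α).sup fun γ => P (α - γ) := fun γ hγ =>
    Finset.le_sup (f := fun γ => P (α - γ)) hγ
  -- Multiplication by `x^γ` costs `|γ| ≤ |α|` vanishing moments of `ψ`, hence the summand `order
  -- α`.
  refine ⟨T.P + order α + (below α).sup fun γ => P (α - γ), by omega, by omega,
    fun η hη hη1 ψ hψ => ?_⟩
  have key : ∀ γ ∈ below α,
      Tendsto (fun R : ℝ => T.ker (cutMoment (α - γ) η (monoMul γ ψ) R)) atTop (𝓝 0) := by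
    intro γ hγ
    have h1 := hle γ hγ
    have h2 := order_mono (mem_below.1 hγ)
    refine (hP (α - γ) tsub_le_self).2.2 η (hη.mono (by omega)) hη1 _ ⟨?_, ?_⟩
    · have e : (monoMul γ ψ : E n → ℂ) = fun x => mono γ x * ψ x := by
        funext x; rw [monoMul_apply]
      rw [e]
      exact hψ.1.mul_left
    · exact hψ.2.monoMul γ (by omega)
  have hs := tendsto_finsetSum (below α) fun γ hγ =>
    (key γ hγ).const_mul ((multiChoose α γ : ℂ) * (-1) ^ order (α - γ))
  simp only [mul_zero, Finset.sum_const_zero] at hs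
  refine hs.congr' ?_
  filter_upwards [eventually_gt_atTop 0] with R hR
  rw [pair, tensor_cutMono _ _ _ hR.ne', map_sum]
  simp only [map_smul, smul_eq_mul]

end Operator

/-- The paraproducts built from Besov distributions, with their properties. -/
theorem exists_sum_of_paraproducts (hn : 0 < n) {ν : ℝ} (hν : -(n : ℝ) < ν) (M : ℕ)
    {ψ ψ' φ : 𝓢(E n, ℂ)} (hψ : Resolves ψ ψ') (b : (Fin n → ℕ) → 𝓢'(E n, ℂ))
    (hb : ∀ α, order α ≤ M → BesovBound ψ (order α - ν) (b α)) :
    ∃ O : Operator n, O.P = 0 ∧ O.IsSingularInf ν ∧ (∀ α, O.trans.Annihilates α) ∧ O.WBP ν ∧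
      IsSumOfParaproducts ψ ψ' φ M b O ∧
      ∀ β : Fin n → ℕ, ∃ P : ℕ, ∀ θ η : 𝓢(E n, ℂ), InSP P θ → η 0 = 1 →
        Tendsto (fun R : ℝ => O.ker (cutMoment β η θ R)) atTop (𝓝 (∑ α ∈ multiIndices n M,
          momentLimit (paraSymbol ψ (b α) α) ψ' (derivS α φ) β θ)) := by
  have hν' : 0 < n + ν := by linarith
  have hpr : HasPrimitives ψ' := fun N => hψ.exists_primitive N
  -- Indices of order above `M` receive the zero operator, so that the family is total and every
  -- member has `P = 0`.
  have hB : ∀ α, ∃ T : Operator n, T.P = 0 ∧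
      (order α ≤ M → Represents T (paraSymbol ψ (b α) α) ψ' (derivS α φ)) := fun α => by
    by_cases hα : order α ≤ M
    · obtain ⟨T, h0, hT⟩ := (hb α hα).isSymbol_paraSymbol.exists_operator hν' hpr (derivS α φ)
      exact ⟨T, h0, fun _ => hT⟩
    · exact ⟨⟨0, 0, 0, fun _ _ _ _ => rfl⟩, rfl, fun h => absurd h hα⟩
  choose B hB0 hB using hB
  have hS : ∀ α ∈ multiIndices n M, IsSymbol (paraSymbol ψ (b α) α) ν := fun α hα =>
    (hb α (mem_multiIndices.1 hα)).isSymbol_paraSymbol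
  have hR : ∀ α ∈ multiIndices n M, Represents (B α) (paraSymbol ψ (b α) α) ψ' (derivS α φ) :=
    fun α hα => hB α (mem_multiIndices.1 hα)
  refine ⟨Operator.sum (multiIndices n M) B 0 fun α => (hB0 α).le, rfl,
    Operator.sum_isSingularInf fun α hα => (hR α hα).isSingularInf (hS α hα) hν',
    fun β => Operator.sum_trans_annihilates fun α hα =>
      (hR α hα).trans_annihilates (hS α hα) hpr β,
    Operator.sum_wbp fun α hα => (hR α hα).wbp hn (hS α hα) hν' hpr,
    ⟨B, fun α hα => ⟨hB0 α, fun f g _ => ?_, fun f g _ => ?_⟩, fun f g _ =>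
      ⟨Operator.sum_ker (hP := fun α => (hB0 α).le) _,
        Operator.sum_kerT (hP := fun α => (hB0 α).le) _⟩⟩, fun β => ?_⟩
  · rw [paraTerm_eq_levelPair (hb α (mem_multiIndices.1 hα))]
    exact (hR α hα).hasSum _
  · rw [paraTerm_eq_levelPair (hb α (mem_multiIndices.1 hα))]
    have e : (B α).trans.pair g f = (B α).ker (tensor g f) := (hR α hα).transpose f g
    rw [e]
    exact (hR α hα).hasSum _
  · obtain ⟨P, hP⟩ := exists_tendsto_moment n ν β
    refine ⟨P, fun θ η hθ hη => ?_⟩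
    simp only [Operator.sum_ker]
    exact tendsto_finsetSum _ fun α hα =>
      hP _ _ _ (B α) (hS α hα) hψ.inSInf (hR α hα) θ η hθ hη

end SingInt

/-! ### The decomposition -/

theorem theorem7p8 {n : ℕ} (hn : 0 < n) (χ : 𝓢(SingInt.E n, ℂ)) (hχ : SingInt.IsLittlewoodPaley χ)
    (ν : ℝ) (hν : -(n : ℝ) < ν) (M : ℕ) (γ : ℝ) (hγ0 : 0 < γ) (hγ1 : γ ≤ 1)
    (T : SingInt.Operator n) (hT : T.IsSingular ν M γ)
    (hmom : ∀ α : Fin n → ℕ, SingInt.order α ≤ M →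
      SingInt.MomentInBesov χ T α ((SingInt.order α : ℝ) - ν)) :
    ∃ S O : SingInt.Operator n,
      S.IsSingular ν M γ ∧ O.IsSingularInf ν ∧ T.IsSum S O ∧
      (∀ α : Fin n → ℕ, SingInt.order α ≤ M → S.Annihilates α) ∧
      (∀ α : Fin n → ℕ, O.trans.Annihilates α) ∧
      SingInt.IsParaproductSum χ ν M O ∧
      (T.WBP ν → S.WBP ν ∧ O.WBP ν) := by
  have hmom' : ∀ α : Fin n → ℕ, ∃ t : 𝓢'(SingInt.E n, ℂ), ∃ P : ℕ, SingInt.order α ≤ M →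
      SingInt.BesovBound χ ((SingInt.order α : ℝ) - ν) t ∧ T.HasMoment α P t := fun α => by
    by_cases hα : SingInt.order α ≤ M
    · obtain ⟨P, t, h⟩ := hmom α hα
      exact ⟨t, P, fun _ => h⟩
    · exact ⟨0, 0, fun h => absurd h hα⟩
  choose t Pt ht using hmom'
  obtain ⟨L, ψ, ψ', φ, b, hψ, hψ', hφ, hb, Pb, hPb⟩ :=
    SingInt.exists_paraproduct_data hχ ν M t fun α hα => (ht α hα).1
  obtain ⟨O, hOP, hOsing, hOann, hOwbp, hOpara, hOmom⟩ :=
    SingInt.exists_sum_of_paraproducts (φ := φ) hn hν M hψ' b fun α hα => (hb α hα).2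
  have hOle : O.P ≤ T.P := hOP ▸ Nat.zero_le _
  -- Subtraction takes place at the level of the distribution kernels of `T` and `T*`, so the sum
  -- formula holds on the whole domain of `T`.
  let S : SingInt.Operator n :=
    { P := T.P
      ker := T.ker - O.ker
      kerT := T.kerT - O.kerT
      transpose_eq := fun f g hf hg => congrArg₂ (· - ·) (T.transpose_eq f g hf hg)
        (O.transpose_eq f g (hf.mono hOle) (hg.mono hOle)) }
  have hker : ∀ F, S.ker F = T.ker F + (-1) * O.ker F := fun F => by
    rw [neg_one_mul, ← sub_eq_add_neg]; rfl
  have hkerT : ∀ F, S.kerT F = T.kerT F + (-1) * O.kerT F := fun F => by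
    rw [neg_one_mul, ← sub_eq_add_neg]; rfl
  -- By the choice of the `b_α`, the moment of `O` at `β` is the same distribution `t β` as that of
  -- `T`, at least on functions with sufficiently many vanishing moments.
  have hO : ∀ β : Fin n → ℕ, SingInt.order β ≤ M → ∃ P, O.HasMoment β P (t β) := fun β hβ => by
    obtain ⟨P, hP⟩ := hOmom β
    refine ⟨max (SingInt.order β) (max P Pb), hOP ▸ Nat.zero_le _, le_max_left _ _,
      fun η _ hη1 θ hθ => ?_⟩
    rw [← hPb β hβ θ (hθ.2.mono ((le_max_right _ _).trans (le_max_right _ _)))]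
    exact hP θ η (hθ.2.mono ((le_max_left _ _).trans (le_max_right _ _)))
      (hη1 0 (Metric.mem_ball_self one_pos))
  refine ⟨S, O, .add_mul (T₁ := T) (-1) le_rfl hOle hker hkerT hT (hOsing M γ hγ0 hγ1), hOsing,
    ⟨T.P, le_rfl, le_rfl, hOle, fun f g _ =>
      ⟨(sub_add_cancel (T.pair f g) _).symm, (sub_add_cancel (T.trans.pair f g) _).symm⟩⟩,
    fun α hα => .of_hasMoment_zero fun β hβ => ?_, hOann,
    ⟨L, ψ, ψ', φ, b, ⟨hψ, hψ'.inSInf, fun f hf => hψ'.hasSum hf⟩, ?_, fun α hα =>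
      hb α (SingInt.mem_multiIndices.1 hα), hOpara⟩,
    fun hTw => ⟨.add_mul (-1) hker hkerT hTw hOwbp, hOwbp⟩⟩
  -- Every `β ≤ α` has order at most `M`, so the moments of `T` and `O` at `β` cancel.
  · have hβM := (SingInt.order_mono hβ).trans hα
    obtain ⟨P, hP⟩ := hO β hβM
    have h := SingInt.Operator.HasMoment.add_mul (-1) hker (ht β hβM).2 hP
    have e : t β + (-1 : ℂ) • t β = 0 := by
      ext f
      simp
    exact ⟨_, e ▸ h⟩
  · have h := hφ 0
    rw [if_pos rfl] at h
    rw [← h]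
    simp [SingInt.moment, SingInt.mono_zero]
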